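/- Let $n\ge 2$, $G=U(n,1)=KAN$, $\mathfrak g=\mathfrak{gl}_{n+1}(\mathbb C)=\mathfrak k\oplus\mathfrak s$ with $\mathfrak k=\mathfrak{gl}_n\oplus\mathfrak{gl}_1$ the complexified Lie algebra of $K=U(n)\times U(1)$, $h=E_{n,n+1}+E_{n+1,n}$, $A=\exp\mathbb Rh$, and let $\mathfrak n$ be spanned by $$X_i=E_{in}-E_{ni}-E_{i,n+1}-E_{n+1,i},\quad Y_i=\sqrt{-1}\,(E_{in}+E_{ni}-E_{i,n+1}+E_{n+1,i})\quad(1\le i\le n-1),$$ $$Z=\sqrt{-1}\,(E_{nn}-E_{n+1,n+1}-E_{n,n+1}+E_{n+1,n}).$$ Let $\eta$ be the character of $N$ with $\eta(Y_{n-1})=\sqrt{-1}\,\xi$, $\xi>0$, and $\eta=0$ on the other $X_i,Y_i,Z$; write $a_t=\exp(\log(\xi/t)h)$, $t>0$. Let $M^\eta=\{\mathrm{diag}(B,x,x,x): B\in U(n-2),\,x\in U(1)\}$ be the stabilizer of $\eta$ in the centralizer of $A$ in $K$. For a dominant integral weight $\lambda=(\lambda_1\ge\dots\ge\lambda_n;\lambda_{n+1})$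 let $V_\lambda$ be the irreducible $K$-module with highest weight $\lambda$ (put $V_\lambda=0$ if $\lambda\in\mathbb Z^{n+1}$ is not dominant), and for an integral dominant weight $\gamma$ let $V_\gamma$ be the irreducible $M^\eta$-module with highest weight $\gamma$. Write $V_{(\lambda/\gamma)^*}=\mathrm{Hom}_{M^\eta}(V_\lambda,V_\gamma)$. The algebra $U(\mathfrak g)$ acts on smooth functions $\phi:A\to\mathrm{Hom}(V_\lambda,V_\gamma)$ through $$\big((u_{\mathfrak n}u_{\mathfrak a}u_{\mathfrak k})\cdot\phi\big)(a_t)(v)=\eta_t(u_{\mathfrak n})\,\partial(u_{\mathfrak a})\,\phi(a_t)(u_{\mathfrak k}v),$$ where $u_{\mathfrak n}\in U(\mathfrak n)$, $u_{\mathfrak a}\in U(\mathbb C h)$, $u_{\mathfrak k}\in U(\mathfrak k)$, $\partial$ and $\eta_t$ are the algebra homomorphisms with $\partial(h)=t\,\frac{d}{dt}$, $\eta_t(Y_{n-1})=\sqrt{-1}\,t$, and $\eta_t=0$ on the other $X_i,Y_i,Z$. For $z$ in the center $Z(\mathfrak g)$ of $U(\mathfrak g)$, let $\mathcal D_{\lambda,\gamma}(z)$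 be the operator $\phi\mapsto z\cdot\phi$ on $C^\infty(A\to V_{(\lambda/\gamma)^*})$. For $k=1,\dots,n$ put $\alpha_k=\epsilon_{n+1-k}-\epsilon_{n+1}$ and $l_{k,n}=l_{k,n}(\lambda)=\lambda^*_k-k=-\lambda_{n+1-k}-k$. For each $\lambda$ and each sign fix a $K$-homomorphism $\iota^\pm_{k}:V_{\lambda\pm\alpha_k}\to V_\lambda\otimes\mathfrak s$, non-zero if $\lambda$ and $\lambda\pm\alpha_k$ are both dominant, and let the $K$-type shift operators $$P_k^\pm:C^\infty(A\to V_{(\lambda/\gamma)^*})\to C^\infty(A\to V_{((\lambda\pm\alpha_k)/\gamma)^*})$$ be given by $(P_k^\pm\phi)(a)=\big(v\otimes X\mapsto (X\cdot\phi)(a)(v)\big)\circ\iota_k^\pm$; the maps $\iota_k^\pm$, hence the operators $P_k^\pm$, are determined up to non-zero scalars that depend on $\lambda$, $k$ and the sign. For $u\in\mathbb C$ and $E_{ij}(u)=E_{ij}+u\,\delta_{ij}$ put $$C_{n+1}(u)=\sum_{\sigma\in\mathfrak S_{n+1}}\mathrm{sgn}(\sigma)\,E_{\sigma(n+1),n+1}(u+n)\,E_{\sigma(n),n}(u+n-1)\cdots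 E_{\sigma(1),1}(u)\in U(\mathfrak g).$$ **Lemma.** The elements $C_{n+1}(u)$ belong to $Z(\mathfrak g)$, and, whatever the choice of the maps $\iota_k^\pm$, these can be rescaled by non-zero constants that do not depend on $\gamma$ so that, for all $\lambda$, $\gamma$ and $k\in\{1,\dots,n\}$, on $C^\infty(A\to V_{(\lambda/\gamma)^*})$, $$P_k^-\circ P_k^+=\mathcal D_{\lambda,\gamma}\big(C_{n+1}(l_{k,n})\big),\qquad P_k^+\circ P_k^-=\mathcal D_{\lambda,\gamma}\big(C_{n+1}(l_{k,n}+1)\big).$$ In fact it suffices to rescale the maps $\iota_k^-$. -/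

import Mathlib

open scoped TensorProduct ContDiff
attribute [local instance] LieRing.ofAssociativeRing
set_option linter.unusedSectionVars false
set_option linter.unusedSimpArgs false
namespace ShiftOps
section generic
variable {g F : Type*} [LieRing g] [LieAlgebra ℂ g] [AddCommGroup F] [Module ℂ F]

/-- The words obtained from `w` by replacing one letter `X` by `⁅k, X⁆`: the terms of `ad(k) w`. -/
def adList (k : g) : List g → List (List g)
  | [] => []
  | X :: w => (⁅k, X⁆ :: w) :: (adList k w).map (List.cons X)

theorem adList_append (k : g) (a b : List g) :
    adList k (a ++ b) = (adList k a).map (· ++ b) ++ (adList k b).map (a ++ ·) := by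
  induction a with
  | nil => simp [adList]
  | cons X a ih => simp [adList, ih, Function.comp_def]

theorem length_of_mem_adList (k : g) (w : List g) : ∀ v ∈ adList k w, v.length = w.length := by
  induction w with
  | nil => simp [adList]
  | cons X w ih =>
    intro v hv
    simp only [adList, List.mem_cons, List.mem_map] at hv
    rcases hv with rfl | ⟨a, ha, rfl⟩
    · simp
    · simp [ih a ha]

variable (ρ : g →ₗ[ℂ] Module.End ℂ F) (κ : g →ₗ[ℂ] g) (r : g →ₗ[ℂ] Module.End ℂ F)

/-- Auxiliary recursion (on the length) for `wordAct`. -/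
def wordActAux : ℕ → List g → Module.End ℂ F
  | 0, _ => 1
  | _ + 1, [] => 1
  | d + 1, X :: w =>
      ρ X * wordActAux d w + ((adList (κ X) w).map (wordActAux d)).sum + r X * wordActAux d w

/-- The action of a word `X w` (`X` a letter, `w` a word), computed with the rule
`X w = X_b w + X_k w`, `X_k w = ad(X_k) w + w X_k`, where `X_b` acts on the left through `ρ` and
`X_k` on the right through `r`. This is only used to prove that the action of `U(g)` exists. -/
def wordAct (w : List g) : Module.End ℂ F := wordActAux ρ κ r w.length w

theorem wordAct_nil : wordAct ρ κ r [] = 1 := rfl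

theorem wordAct_cons (X : g) (w : List g) :
    wordAct ρ κ r (X :: w) = ρ X * wordAct ρ κ r w +
      ((adList (κ X) w).map (wordAct ρ κ r)).sum + r X * wordAct ρ κ r w := by
  have : (adList (κ X) w).map (wordAct ρ κ r) =
      (adList (κ X) w).map (wordActAux ρ κ r w.length) := by
    apply List.map_congr_left
    intro v hv
    rw [wordAct, length_of_mem_adList _ _ v hv]
  rw [this]; rfl

/-- `Ψ` evaluated on `ad(k) w`. -/
def adSum {A : Type*} [AddCommGroup A] (Ψ : List g → A) (k : g) (w : List g) : A :=
  ((adList k w).map Ψ).sum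

theorem adSum_append {A : Type*} [AddCommGroup A] (Ψ : List g → A) (k : g) (a b : List g) :
    adSum Ψ k (a ++ b) = adSum (fun w => Ψ (w ++ b)) k a + adSum (fun w => Ψ (a ++ w)) k b := by
  simp [adSum, adList_append, Function.comp_def]

theorem adSum_cons {A : Type*} [AddCommGroup A] (Ψ : List g → A) (k X : g) (b : List g) :
    adSum Ψ k (X :: b) = Ψ (⁅k, X⁆ :: b) + adSum (fun w => Ψ (X :: w)) k b := by
  simp [adSum, adList, Function.comp_def]

theorem adSum_congr {A : Type*} [AddCommGroup A] {Ψ Φ : List g → A} (k : g) (w : List g)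
    (h : ∀ v, v.length = w.length → Ψ v = Φ v) : adSum Ψ k w = adSum Φ k w := by
  unfold adSum
  congr 1
  exact List.map_congr_left fun v hv => h v (length_of_mem_adList _ _ v hv)

theorem adSum_add {A : Type*} [AddCommGroup A] (Ψ Φ : List g → A) (k : g) (w : List g) :
    adSum (fun v => Ψ v + Φ v) k w = adSum Ψ k w + adSum Φ k w := by
  simp [adSum, List.sum_map_add]

theorem adSum_map {A B : Type*} [AddCommGroup A] [AddCommGroup B] (f : A →+ B)
    (Ψ : List g → A) (k : g) (w : List g) :
    adSum (fun v => f (Ψ v)) k w = f (adSum Ψ k w) := by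
  simp [adSum, map_list_sum, Function.comp_def]

theorem adSum_mul_left (a : Module.End ℂ F) (Ψ : List g → Module.End ℂ F) (k : g) (w : List g) :
    adSum (fun v => a * Ψ v) k w = a * adSum Ψ k w :=
  adSum_map (AddMonoidHom.mulLeft a) Ψ k w

local notation "D" => wordAct ρ κ r

theorem wordAct_cons' (X : g) (w : List g) :
    D (X :: w) = ρ X * D w + adSum D (κ X) w + r X * D w := wordAct_cons ρ κ r X w

theorem word_multilinear (d : ℕ) :
    ∀ w₁ w₂ : List g, w₁.length + w₂.length = d → ∀ (X Y : g) (c : ℂ),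
      D (w₁ ++ (c • X + Y) :: w₂) = c • D (w₁ ++ X :: w₂) + D (w₁ ++ Y :: w₂) := by
  induction d with
  | zero =>
    intro w₁ w₂ h X Y c
    obtain rfl : w₁ = [] := List.eq_nil_of_length_eq_zero (by omega)
    obtain rfl : w₂ = [] := List.eq_nil_of_length_eq_zero (by omega)
    simp [wordAct_cons', adSum, adList, smul_add, add_mul]
    abel
  | succ d ih =>
    have key : ∀ (w : List g), w.length = d + 1 → ∀ (k k' : g) (c : ℂ),
        adSum D (c • k + k') w = c • adSum D k w + adSum D k' w := by
      intro w
      suffices H : ∀ a b : List g, a.length + b.length = d + 1 → ∀ (k k' : g) (c : ℂ),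
          adSum (fun v => D (a ++ v)) (c • k + k') b =
            c • adSum (fun v => D (a ++ v)) k b + adSum (fun v => D (a ++ v)) k' b by
        intro hw k k' c
        simpa using H [] w (by simpa using hw) k k' c
      intro a b
      induction b generalizing a with
      | nil => intros; simp [adSum, adList]
      | cons X b ihb =>
        intro hl k k' c
        simp only [adSum_cons]
        have := ihb (a ++ [X]) (by simp at hl ⊢; omega) k k' c
        simp only [List.append_assoc, List.singleton_append] at this
        rw [this, add_lie, smul_lie, ih a b (by simp at hl; omega)]
        simp only [smul_add]; abel
    intro w₁ w₂ h X Y c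
    cases w₁ with
    | nil =>
      simp only [List.nil_append, wordAct_cons', map_add, map_smul]
      rw [key w₂ (by simpa using h)]
      simp only [add_mul, smul_mul_assoc, smul_add]; abel
    | cons Z w₁ =>
      have hl : w₁.length + w₂.length = d := by simp at h; omega
      simp only [List.cons_append, wordAct_cons', adSum_append, adSum_cons]
      rw [ih w₁ w₂ hl, lie_add, lie_smul, ih w₁ w₂ hl]
      have e1 : adSum (fun w => D (w ++ (c • X + Y) :: w₂)) (κ Z) w₁ =
          c • adSum (fun w => D (w ++ X :: w₂)) (κ Z) w₁ +
            adSum (fun w => D (w ++ Y :: w₂)) (κ Z) w₁ := by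
        rw [adSum_congr (Φ := fun w => c • D (w ++ X :: w₂) + D (w ++ Y :: w₂)) _ _
          (fun v hv => ih v w₂ (by omega) X Y c), adSum_add]
        congr 1
        exact adSum_map (DistribSMul.toAddMonoidHom _ c) (fun w => D (w ++ X :: w₂)) _ _
      have e2 : adSum (fun w => D (w₁ ++ (c • X + Y) :: w)) (κ Z) w₂ =
          c • adSum (fun w => D (w₁ ++ X :: w)) (κ Z) w₂ +
            adSum (fun w => D (w₁ ++ Y :: w)) (κ Z) w₂ := by
        rw [adSum_congr (Φ := fun w => c • D (w₁ ++ X :: w) + D (w₁ ++ Y :: w)) _ _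
          (fun v hv => ih w₁ v (by omega) X Y c), adSum_add]
        congr 1
        exact adSum_map (DistribSMul.toAddMonoidHom _ c) (fun w => D (w₁ ++ X :: w)) _ _
      rw [e1, e2]
      simp only [mul_add, mul_smul_comm, smul_add]; abel

/-- `Ψ` is linear in every letter. -/
def Multilin {A : Type*} [AddCommGroup A] [Module ℂ A] (Ψ : List g → A) : Prop :=
  ∀ (w₁ w₂ : List g) (X Y : g) (c : ℂ),
    Ψ (w₁ ++ (c • X + Y) :: w₂) = c • Ψ (w₁ ++ X :: w₂) + Ψ (w₁ ++ Y :: w₂)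

theorem wordAct_multilin : Multilin (D) := fun w₁ w₂ X Y c =>
  word_multilinear ρ κ r _ w₁ w₂ rfl X Y c

theorem Multilin.add {A : Type*} [AddCommGroup A] [Module ℂ A] {Ψ : List g → A}
    (h : Multilin Ψ) (w₁ w₂ : List g) (X Y : g) :
    Ψ (w₁ ++ (X + Y) :: w₂) = Ψ (w₁ ++ X :: w₂) + Ψ (w₁ ++ Y :: w₂) := by
  simpa using h w₁ w₂ X Y 1

theorem Multilin.zero {A : Type*} [AddCommGroup A] [Module ℂ A] {Ψ : List g → A}
    (h : Multilin Ψ) (w₁ w₂ : List g) : Ψ (w₁ ++ 0 :: w₂) = 0 := by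
  simpa using h.add w₁ w₂ 0 0

theorem Multilin.smul {A : Type*} [AddCommGroup A] [Module ℂ A] {Ψ : List g → A}
    (h : Multilin Ψ) (w₁ w₂ : List g) (c : ℂ) (X : g) :
    Ψ (w₁ ++ (c • X) :: w₂) = c • Ψ (w₁ ++ X :: w₂) := by
  simpa [h.zero] using h w₁ w₂ X 0 c

theorem Multilin.sub {A : Type*} [AddCommGroup A] [Module ℂ A] {Ψ : List g → A}
    (h : Multilin Ψ) (w₁ w₂ : List g) (X Y : g) :
    Ψ (w₁ ++ (X - Y) :: w₂) = Ψ (w₁ ++ X :: w₂) - Ψ (w₁ ++ Y :: w₂) := by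
  have := h.add w₁ w₂ (X - Y) Y
  rw [sub_add_cancel] at this
  rw [this]; abel

theorem Multilin.cons {A : Type*} [AddCommGroup A] [Module ℂ A] {Ψ : List g → A}
    (h : Multilin Ψ) (X : g) : Multilin (fun w => Ψ (X :: w)) :=
  fun w₁ w₂ => h (X :: w₁) w₂

theorem adSum_comm {A : Type*} [AddCommGroup A] [Module ℂ A] {Ψ : List g → A}
    (h : Multilin Ψ) (k k' : g) (w : List g) :
    adSum (adSum Ψ k') k w + adSum Ψ ⁅k, k'⁆ w = adSum (adSum Ψ k) k' w := by
  induction w generalizing Ψ with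
  | nil => simp [adSum, adList]
  | cons X w ih =>
    have e := ih (h.cons X)
    simp only [adSum_cons, adSum_add]
    have j : Ψ (⁅k, ⁅k', X⁆⁆ :: w) = Ψ (⁅⁅k, k'⁆, X⁆ :: w) + Ψ (⁅k', ⁅k, X⁆⁆ :: w) := by
      rw [leibniz_lie]; exact h.add [] w _ _
    change adSum (adSum (fun w => Ψ (X :: w)) k') k w + adSum (fun w => Ψ (X :: w)) ⁅k, k'⁆ w =
      adSum (adSum (fun w => Ψ (X :: w)) k) k' w at e
    change _ + (_ + adSum (adSum (fun w => Ψ (X :: w)) k') k w) + _ =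
      _ + (_ + adSum (adSum (fun w => Ψ (X :: w)) k) k' w)
    rw [j, ← e]; abel

/-- A decomposition `g = b ⊕ k` (with `κ` the projection to `k`) together with a representation `ρ`
of `b` and a commuting right action `r` of `k`. -/
structure Decomp : Prop where
  proj : ∀ X, κ (κ X) = κ X
  sub_k : ∀ X Y, κ ⁅κ X, κ Y⁆ = ⁅κ X, κ Y⁆
  sub_b : ∀ X Y, κ X = 0 → κ Y = 0 → κ ⁅X, Y⁆ = 0
  rho_k : ∀ X, ρ (κ X) = 0
  rho_lie : ∀ X Y, κ X = 0 → κ Y = 0 → ρ ⁅X, Y⁆ = ρ X * ρ Y - ρ Y * ρ X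
  r_k : ∀ X, r (κ X) = r X
  r_lie : ∀ X Y, r ⁅κ X, κ Y⁆ = r Y * r X - r X * r Y
  comm : ∀ X Y, ρ X * r Y = r Y * ρ X

variable {ρ κ r}

theorem Decomp.r_b (h : Decomp ρ κ r) {X : g} (hX : κ X = 0) : r X = 0 := by
  rw [← h.r_k, hX, map_zero]

theorem adSum_zero {A : Type*} [AddCommGroup A] [Module ℂ A] {Ψ : List g → A}
    (h : Multilin Ψ) (w : List g) : adSum Ψ 0 w = 0 := by
  induction w generalizing Ψ with
  | nil => simp [adSum, adList]
  | cons X w ih => rw [adSum_cons, ih (h.cons X), zero_lie]; simpa using h.zero [] w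

theorem wordAct_b (h : Decomp ρ κ r) {X : g} (hX : κ X = 0) (w : List g) :
    D (X :: w) = ρ X * D w := by
  rw [wordAct_cons', hX, h.r_b hX, adSum_zero (wordAct_multilin ρ κ r)]; simp

theorem wordAct_k (h : Decomp ρ κ r) {X : g} (hX : κ X = X) (w : List g) :
    D (X :: w) = adSum D X w + r X * D w := by
  have h0 : ρ X = 0 := by rw [← hX]; exact h.rho_k X
  rw [wordAct_cons', hX, h0]; simp

theorem wordAct_rel_nil (h : Decomp ρ κ r) (X Y : g) (w : List g) :
    D (X :: Y :: w) = D (Y :: X :: w) + D (⁅X, Y⁆ :: w) := by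
  have hM := wordAct_multilin ρ κ r
  have hb : ∀ Z, κ (Z - κ Z) = 0 := fun Z => by rw [map_sub, h.proj, sub_self]
  have e1 : ⁅X, Y⁆ = ⁅X - κ X, Y - κ Y⁆ + (⁅κ X, Y⁆ + (-⁅κ Y, X⁆ + -⁅κ X, κ Y⁆)) := by
    rw [lie_skew]; simp only [sub_lie, lie_sub]; abel
  have neg : ∀ Z, D ((-Z) :: w) = - D (Z :: w) := fun Z => by
    simpa using hM.smul [] w (-1) Z
  have e2 : D (⁅X, Y⁆ :: w) = D (⁅X - κ X, Y - κ Y⁆ :: w) + (D (⁅κ X, Y⁆ :: w) +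
      (-D (⁅κ Y, X⁆ :: w) + -D (⁅κ X, κ Y⁆ :: w))) := by
    conv_lhs => rw [e1]
    have a := hM.add [] w
    simp only [List.nil_append] at a
    rw [a, a, a, neg, neg]
  have e3 : D (⁅X - κ X, Y - κ Y⁆ :: w) = (ρ X * ρ Y - ρ Y * ρ X) * D w := by
    rw [wordAct_b h (h.sub_b _ _ (hb X) (hb Y)), h.rho_lie _ _ (hb X) (hb Y)]
    simp [map_sub, h.rho_k]
  have e4 : D (⁅κ X, κ Y⁆ :: w) = adSum D ⁅κ X, κ Y⁆ w + (r Y * r X - r X * r Y) * D w := by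
    rw [wordAct_k h (h.sub_k X Y), h.r_lie]
  have e5 : ∀ Y k : g, adSum (fun v => D (Y :: v)) k w =
      ρ Y * adSum D k w + adSum (adSum D (κ Y)) k w + r Y * adSum D k w := by
    intro Y k
    simp only [wordAct_cons', adSum_add]
    rw [adSum_mul_left, adSum_mul_left]
  have e6 := adSum_comm hM (κ X) (κ Y) w
  rw [e2, e3, e4, wordAct_cons' ρ κ r X, wordAct_cons' ρ κ r Y (X :: w), adSum_cons, adSum_cons,
    e5, e5, ← e6, wordAct_cons' ρ κ r Y, wordAct_cons' ρ κ r X w]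
  have c1 := h.comm X Y
  have c2 := h.comm Y X
  simp only [mul_add, sub_mul, ← mul_assoc]
  rw [← c1, ← c2]
  abel

/-- `Ψ` is compatible with `X Y - Y X = ⁅X, Y⁆` inside words. -/
def LieRel {A : Type*} [AddCommGroup A] (Ψ : List g → A) : Prop :=
  ∀ (w₁ w₂ : List g) (X Y : g),
    Ψ (w₁ ++ X :: Y :: w₂) = Ψ (w₁ ++ Y :: X :: w₂) + Ψ (w₁ ++ ⁅X, Y⁆ :: w₂)

theorem wordAct_lieRel (h : Decomp ρ κ r) : LieRel (D) := by
  have hM := wordAct_multilin ρ κ r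
  suffices H : ∀ d : ℕ, ∀ w₁ w₂ : List g, w₁.length + w₂.length = d → ∀ (X Y : g),
      D (w₁ ++ X :: Y :: w₂) = D (w₁ ++ Y :: X :: w₂) + D (w₁ ++ ⁅X, Y⁆ :: w₂) from
    fun w₁ w₂ => H _ w₁ w₂ rfl
  intro d
  induction d with
  | zero =>
    intro w₁ w₂ hl X Y
    obtain rfl : w₁ = [] := List.eq_nil_of_length_eq_zero (by omega)
    exact wordAct_rel_nil h X Y w₂
  | succ d ih =>
    intro w₁ w₂ hl X Y
    cases w₁ with
    | nil => exact wordAct_rel_nil h X Y w₂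
    | cons Z w₁ =>
      have hl : w₁.length + w₂.length = d := by simp at hl; omega
      simp only [List.cons_append, wordAct_cons', adSum_append, adSum_cons]
      have e1 : adSum (fun w => D (w ++ X :: Y :: w₂)) (κ Z) w₁ =
          adSum (fun w => D (w ++ Y :: X :: w₂)) (κ Z) w₁ +
          adSum (fun w => D (w ++ ⁅X, Y⁆ :: w₂)) (κ Z) w₁ := by
        rw [adSum_congr _ _ (fun v hv => ih v w₂ (by omega) X Y), adSum_add]
      have e2 : adSum (fun w => D (w₁ ++ X :: Y :: w)) (κ Z) w₂ =
          adSum (fun w => D (w₁ ++ Y :: X :: w)) (κ Z) w₂ +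
          adSum (fun w => D (w₁ ++ ⁅X, Y⁆ :: w)) (κ Z) w₂ := by
        rw [adSum_congr _ _ (fun v hv => ih w₁ v (by omega) X Y), adSum_add]
      rw [e1, e2, ih w₁ w₂ hl X Y, ih w₁ w₂ hl ⁅κ Z, X⁆ Y, ih w₁ w₂ hl X ⁅κ Z, Y⁆, leibniz_lie (κ Z) X Y,
        hM.add w₁ w₂]
      simp only [mul_add]
      abel

theorem wordAct_append_k (h : Decomp ρ κ r) {k : g} (hk : κ k = k) (w : List g) :
    D (w ++ [k]) = r k * D w := by
  suffices H : ∀ d : ℕ, ∀ w : List g, w.length = d → ∀ k : g, κ k = k →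
      D (w ++ [k]) = r k * D w from H _ w rfl k hk
  intro d
  induction d with
  | zero =>
    intro w hl k hk
    obtain rfl : w = [] := List.eq_nil_of_length_eq_zero hl
    simp [wordAct_k h hk, adSum, adList]
  | succ d ih =>
    intro w hl k hk
    cases w with
    | nil => simp at hl
    | cons X w =>
      have hl : w.length = d := by simpa using hl
      have hk2 : κ ⁅κ X, k⁆ = ⁅κ X, k⁆ := by rw [← hk]; exact h.sub_k X k
      simp only [List.cons_append, wordAct_cons', adSum_append, adSum_cons]
      have e : adSum (fun v => D (v ++ [k])) (κ X) w = r k * adSum D (κ X) w := by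
        rw [adSum_congr _ _ (fun v hv => ih v (by omega) k hk)]
        exact adSum_mul_left _ _ _ _
      have e' : r ⁅κ X, k⁆ = r k * r X - r X * r k := by
        have := h.r_lie X k
        rwa [hk] at this
      rw [e, ih w hl k hk, ih w hl _ hk2, e']
      have c := h.comm X k
      simp only [mul_add, sub_mul, ← mul_assoc, c]
      simp [adSum, adList]
      abel

/-- Functions on words that descend to `U(g)` and are `b`-equivariant on the left. -/
def wordFun (ρ : g →ₗ[ℂ] Module.End ℂ F) (κ : g →ₗ[ℂ] g) :
    Submodule ℂ (List g → Module.End ℂ F) where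
  carrier := {Ψ | Multilin Ψ ∧ LieRel Ψ ∧ ∀ X w, κ X = 0 → Ψ (X :: w) = ρ X * Ψ w}
  add_mem' := by
    rintro Ψ Φ ⟨a, b, c⟩ ⟨a', b', c'⟩
    refine ⟨fun w₁ w₂ X Y t => ?_, fun w₁ w₂ X Y => ?_, fun X w hX => ?_⟩
    · simp only [Pi.add_apply, a w₁, a' w₁, smul_add]; abel
    · simp only [Pi.add_apply, b w₁ w₂ X, b' w₁ w₂ X]; abel
    · simp only [Pi.add_apply, c X w hX, c' X w hX, mul_add]
  zero_mem' := ⟨fun _ _ _ _ _ => by simp, fun _ _ _ _ => by simp, fun _ _ _ => by simp⟩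
  smul_mem' := by
    rintro s Ψ ⟨a, b, c⟩
    refine ⟨fun w₁ w₂ X Y t => ?_, fun w₁ w₂ X Y => ?_, fun X w hX => ?_⟩
    · simp only [Pi.smul_apply, a w₁, smul_add]; rw [smul_comm s t]
    · simp only [Pi.smul_apply, b w₁ w₂ X, smul_add]
    · simp only [Pi.smul_apply, c X w hX, mul_smul_comm]

/-- Translation on `wordFun`: appending a letter on the right. -/
def transl (ρ : g →ₗ[ℂ] Module.End ℂ F) (κ : g →ₗ[ℂ] g) :
    g →ₗ⁅ℂ⁆ Module.End ℂ (wordFun ρ κ) where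
  toFun X :=
    { toFun := fun Ψ => ⟨fun w => Ψ.1 (w ++ [X]), by
        obtain ⟨Ψ, a, b, c⟩ := Ψ
        refine ⟨fun w₁ w₂ Y Z t => ?_, fun w₁ w₂ Y Z => ?_, fun Y w hY => ?_⟩
        · simpa using a w₁ (w₂ ++ [X]) Y Z t
        · simpa using b w₁ (w₂ ++ [X]) Y Z
        · simpa using c Y (w ++ [X]) hY⟩
      map_add' := fun _ _ => rfl
      map_smul' := fun _ _ => rfl }
  map_add' X Y := by
    ext Ψ w : 3
    exact Ψ.2.1.add w [] X Y
  map_smul' c X := by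
    ext Ψ w : 3
    exact Ψ.2.1.smul w [] c X
  map_lie' {X Y} := by
    ext Ψ w : 3
    have := Ψ.2.2.1 w [] X Y
    change Ψ.1 (w ++ [⁅X, Y⁆]) = Ψ.1 (w ++ [X] ++ [Y]) - Ψ.1 (w ++ [Y] ++ [X])
    simp only [List.append_assoc, List.singleton_append, this]; abel

theorem adjoin_range_ι :
    Algebra.adjoin ℂ (Set.range (UniversalEnvelopingAlgebra.ι ℂ : g → _)) = ⊤ := by
  let S := Algebra.adjoin ℂ (Set.range (UniversalEnvelopingAlgebra.ι ℂ : g → _))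
  have hS : ∀ X, UniversalEnvelopingAlgebra.ι ℂ (X : g) ∈ S := fun X =>
    Algebra.subset_adjoin ⟨X, rfl⟩
  let f : g →ₗ⁅ℂ⁆ S :=
    { toFun := fun X => ⟨UniversalEnvelopingAlgebra.ι ℂ X, hS X⟩
      map_add' := fun X Y => by ext; simp
      map_smul' := fun c X => by ext; simp
      map_lie' := fun {X Y} => by
        ext
        simp [LieRing.of_associative_ring_bracket] }
  have h : S.val.comp (UniversalEnvelopingAlgebra.lift ℂ f) = AlgHom.id ℂ _ := by
    apply UniversalEnvelopingAlgebra.hom_ext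
    ext X
    change S.val (UniversalEnvelopingAlgebra.lift ℂ f (UniversalEnvelopingAlgebra.ι ℂ X)) =
      UniversalEnvelopingAlgebra.ι ℂ X
    rw [UniversalEnvelopingAlgebra.lift_ι_apply]
    rfl
  rw [eq_top_iff]
  intro u _
  have := DFunLike.congr_fun h u
  rw [← show _ = u from this]
  exact (UniversalEnvelopingAlgebra.lift ℂ f u).2

/-- A subspace of `U(g)` containing `1`, stable under left multiplication by `b` and right
multiplication by `k`, is everything, when `g = b + k`. -/
theorem submodule_eq_top (S : Submodule ℂ (UniversalEnvelopingAlgebra ℂ g))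
    (κ : g →ₗ[ℂ] g) (hκ : ∀ X, κ (κ X) = κ X) (h1 : (1 : UniversalEnvelopingAlgebra ℂ g) ∈ S)
    (hb : ∀ X u, κ X = 0 → u ∈ S → UniversalEnvelopingAlgebra.ι ℂ X * u ∈ S)
    (hk : ∀ X u, κ X = X → u ∈ S → u * UniversalEnvelopingAlgebra.ι ℂ X ∈ S) : S = ⊤ := by
  let P : List g → UniversalEnvelopingAlgebra ℂ g :=
    fun w => (w.map (UniversalEnvelopingAlgebra.ι ℂ)).prod
  have hP : ∀ X w, P (X :: w) = UniversalEnvelopingAlgebra.ι ℂ X * P w := fun X w => by simp [P]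
  have had : ∀ k w, UniversalEnvelopingAlgebra.ι ℂ k * P w =
      adSum P k w + P w * UniversalEnvelopingAlgebra.ι ℂ k := by
    intro k w
    induction w with
    | nil => simp [P, adSum, adList]
    | cons X w ih =>
      have e : adSum (fun v => P (X :: v)) k w =
          UniversalEnvelopingAlgebra.ι ℂ X * adSum P k w := by
        simp only [hP]
        exact adSum_map (AddMonoidHom.mulLeft (UniversalEnvelopingAlgebra.ι ℂ X)) P k w
      have l : UniversalEnvelopingAlgebra.ι ℂ ⁅k, X⁆ =
          UniversalEnvelopingAlgebra.ι ℂ k * UniversalEnvelopingAlgebra.ι ℂ X -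
          UniversalEnvelopingAlgebra.ι ℂ X * UniversalEnvelopingAlgebra.ι ℂ k := by
        rw [LieHom.map_lie, LieRing.of_associative_ring_bracket]
      rw [adSum_cons, e, hP, hP, l, sub_mul, mul_assoc _ _ (P w), mul_assoc _ _ (P w), ih,
        mul_add, mul_assoc]
      abel
  have hw : ∀ d : ℕ, ∀ w : List g, w.length = d → P w ∈ S := by
    intro d
    induction d with
    | zero =>
      intro w hl
      obtain rfl : w = [] := List.eq_nil_of_length_eq_zero hl
      simpa [P] using h1
    | succ d ih =>
      intro w hl
      cases w with
      | nil => simp at hl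
      | cons X w =>
        have hl : w.length = d := by simpa using hl
        have e : P (X :: w) = UniversalEnvelopingAlgebra.ι ℂ (X - κ X) * P w +
            (adSum P (κ X) w + P w * UniversalEnvelopingAlgebra.ι ℂ (κ X)) := by
          rw [← had, ← add_mul, ← map_add, sub_add_cancel, hP]
        rw [e]
        refine S.add_mem (hb _ _ (by rw [map_sub, hκ, sub_self]) (ih w hl))
          (S.add_mem (S.list_sum_mem ?_) (hk _ _ (hκ X) (ih w hl)))
        intro x hx
        obtain ⟨v, hv, rfl⟩ := List.mem_map.1 hx
        exact ih v (by rw [length_of_mem_adList _ _ v hv, hl])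
  rw [eq_top_iff]
  rintro u -
  have hu : u ∈ Algebra.adjoin ℂ (Set.range (UniversalEnvelopingAlgebra.ι ℂ : g → _)) := by
    rw [adjoin_range_ι]; exact Algebra.mem_top
  rw [← Subalgebra.mem_toSubmodule, Algebra.adjoin_eq_span] at hu
  refine Submodule.span_le.2 ?_ hu
  intro x hx
  obtain ⟨l, hl, rfl⟩ := Submonoid.exists_list_of_mem_closure hx
  obtain ⟨w, rfl⟩ : ∃ w : List g, w.map (UniversalEnvelopingAlgebra.ι ℂ) = l := by
    clear hx
    induction l with
    | nil => exact ⟨[], rfl⟩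
    | cons y l ih =>
      obtain ⟨w, rfl⟩ := ih fun z hz => hl z (List.mem_cons_of_mem _ hz)
      obtain ⟨X, rfl⟩ := hl y List.mem_cons_self
      exact ⟨X :: w, rfl⟩
  exact hw _ w rfl

open UniversalEnvelopingAlgebra in
theorem exists_act (h : Decomp ρ κ r) :
    ∃ act : UniversalEnvelopingAlgebra ℂ g →ₗ[ℂ] Module.End ℂ F, act 1 = 1 ∧
      (∀ X u, κ X = 0 → act (ι ℂ X * u) = ρ X * act u) ∧
      (∀ X u, κ X = X → act (u * ι ℂ X) = r X * act u) := by
  let T := lift ℂ (transl ρ κ)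
  let D₀ : wordFun ρ κ :=
    ⟨D, wordAct_multilin ρ κ r, wordAct_lieRel h, fun X w hX => wordAct_b h hX w⟩
  have hT : ∀ X, T (ι ℂ X) = transl ρ κ X := fun X => lift_ι_apply ℂ (transl ρ κ) X
  let ev : wordFun ρ κ →ₗ[ℂ] Module.End ℂ F :=
    { toFun := fun Ψ => Ψ.1 [], map_add' := fun _ _ => rfl, map_smul' := fun _ _ => rfl }
  refine ⟨ev ∘ₗ LinearMap.applyₗ D₀ ∘ₗ T.toLinearMap, ?_, ?_, ?_⟩
  · change ev ((T 1) D₀) = 1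
    rw [map_one]; exact wordAct_nil ρ κ r
  · intro X u hX
    change ev (T (ι ℂ X * u) D₀) = ρ X * ev (T u D₀)
    rw [map_mul, hT]
    change (T u D₀).1 ([] ++ [X]) = _
    exact (T u D₀).2.2.2 X [] hX
  · intro X u hX
    let R : Module.End ℂ (wordFun ρ κ) :=
      { toFun := fun Ψ => ⟨fun w => r X * Ψ.1 w, by
          obtain ⟨Ψ, a, b, c⟩ := Ψ
          refine ⟨fun w₁ w₂ Y Z t => ?_, fun w₁ w₂ Y Z => ?_, fun Y w hY => ?_⟩
          · simp only [a w₁, mul_add, mul_smul_comm]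
          · simp only [b w₁ w₂ Y, mul_add]
          · simp only [c Y w hY, ← mul_assoc, h.comm]⟩
        map_add' := fun _ _ => by ext : 2; exact mul_add _ _ _
        map_smul' := fun c Ψ => by ext w : 2; exact mul_smul_comm c (r X) (Ψ.1 w) }
    have hR : T (ι ℂ X) D₀ = R D₀ := by
      rw [hT]; ext w : 2
      exact wordAct_append_k h hX w
    have hcomm : ∀ u, T u * R = R * T u := by
      intro u
      have hle : Algebra.adjoin ℂ (Set.range (ι ℂ : g → _)) ≤
          (Subalgebra.centralizer ℂ {R}).comap T := by
        refine Algebra.adjoin_le ?_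
        rintro _ ⟨Y, rfl⟩
        rw [SetLike.mem_coe, Subalgebra.mem_comap, hT, Subalgebra.mem_centralizer_iff]
        rintro _ rfl
        rfl
      rw [adjoin_range_ι] at hle
      have := hle (Algebra.mem_top (x := u))
      rw [Subalgebra.mem_comap, Subalgebra.mem_centralizer_iff] at this
      exact (this R rfl).symm
    change ev (T (u * ι ℂ X) D₀) = r X * ev (T u D₀)
    rw [map_mul, Module.End.mul_apply, hR, ← Module.End.mul_apply, hcomm]
    rfl

end generic
noncomputable section
/-- The complexified Lie algebra `g = gl_{n+1}(ℂ)` of `U(n,1)`, where `n = m + 2 ≥ 2`. -/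
abbrev Gl (m : ℕ) : Type := Matrix (Fin (m + 3)) (Fin (m + 3)) ℂ

/-- The index `n + 1` (indices are counted from `1` in comments). -/
abbrev iL (m : ℕ) : Fin (m + 3) := Fin.last (m + 2)
/-- The index `n`. -/
abbrev iM (m : ℕ) : Fin (m + 3) := (Fin.last (m + 1)).castSucc
/-- The indices `1, …, n - 1`. -/
abbrev iP {m : ℕ} (i : Fin (m + 1)) : Fin (m + 3) := i.castSucc.castSucc

/-- The matrix unit `E_{ij}`. -/
def E {m : ℕ} (i j : Fin (m + 3)) : Gl m := Matrix.single i j 1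

/-- `h = E_{n,n+1} + E_{n+1,n}`, which spans the Lie algebra of `A`. -/
def hA (m : ℕ) : Gl m := E (iM m) (iL m) + E (iL m) (iM m)
/-- `X_i = E_{in} - E_{ni} - E_{i,n+1} - E_{n+1,i}`, `1 ≤ i ≤ n - 1`. -/
def rootX {m : ℕ} (i : Fin (m + 1)) : Gl m :=
  E (iP i) (iM m) - E (iM m) (iP i) - E (iP i) (iL m) - E (iL m) (iP i)
/-- `Y_i = √-1 (E_{in} + E_{ni} - E_{i,n+1} + E_{n+1,i})`, `1 ≤ i ≤ n - 1`. -/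
def rootY {m : ℕ} (i : Fin (m + 1)) : Gl m :=
  Complex.I • (E (iP i) (iM m) + E (iM m) (iP i) - E (iP i) (iL m) + E (iL m) (iP i))
/-- `Z = √-1 (E_{nn} - E_{n+1,n+1} - E_{n,n+1} + E_{n+1,n})`. The elements `X_i`, `Y_i`, `Z` span `n`,
the complexified Lie algebra of `N`. -/
def rootZ (m : ℕ) : Gl m :=
  Complex.I • (E (iM m) (iM m) - E (iL m) (iL m) - E (iM m) (iL m) + E (iL m) (iM m))

/-- `k = gl_n ⊕ gl_1` (block diagonal matrices), the complexified Lie algebra of `K = U(n) × U(1)`. -/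
def kAlg (m : ℕ) : LieSubalgebra ℂ (Gl m) where
  carrier := {A | ∀ i j, ¬(i = iL m ↔ j = iL m) → A i j = 0}
  add_mem' := fun {A B} hA hB i j h => by rw [Matrix.add_apply, hA i j h, hB i j h, add_zero]
  zero_mem' := fun i j h => rfl
  smul_mem' := fun c A hA i j h => by rw [Matrix.smul_apply, hA i j h, smul_zero]
  lie_mem' := fun {A B} hA hB i j h => by
    rw [LieRing.of_associative_ring_bracket, Matrix.sub_apply, Matrix.mul_apply, Matrix.mul_apply,
      Finset.sum_eq_zero, Finset.sum_eq_zero, sub_zero]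
    · intro l _
      by_cases hl : i = iL m ↔ l = iL m
      · rw [hA l j (by tauto), mul_zero]
      · rw [hB i l hl, zero_mul]
    · intro l _
      by_cases hl : i = iL m ↔ l = iL m
      · rw [hB l j (by tauto), mul_zero]
      · rw [hA i l hl, zero_mul]

/-- `s`, the block off-diagonal matrices, with the adjoint action of `k`; `g = k ⊕ s`. -/
def sMod (m : ℕ) : LieSubmodule ℂ (kAlg m) (Gl m) where
  carrier := {A | ∀ i j, (i = iL m ↔ j = iL m) → A i j = 0}
  add_mem' := fun {A B} hA hB i j h => by rw [Matrix.add_apply, hA i j h, hB i j h, add_zero]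
  zero_mem' := fun i j h => rfl
  smul_mem' := fun c A hA i j h => by rw [Matrix.smul_apply, hA i j h, smul_zero]
  lie_mem := fun {A B} hB i j h => by
    obtain ⟨A, hA⟩ := A
    change (⁅A, B⁆ : Gl m) i j = 0
    rw [LieRing.of_associative_ring_bracket, Matrix.sub_apply, Matrix.mul_apply, Matrix.mul_apply,
      Finset.sum_eq_zero, Finset.sum_eq_zero, sub_zero]
    · intro l _
      by_cases hl : i = iL m ↔ l = iL m
      · rw [hB i l hl, zero_mul]
      · rw [hA l j (by tauto), mul_zero]
    · intro l _
      by_cases hl : i = iL m ↔ l = iL m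
      · rw [hB l j (by tauto), mul_zero]
      · rw [hA i l hl, zero_mul]

/-- The complexified Lie algebra of `M^η ≃ U(n-2) × U(1)`: the matrices `diag(B, x, x, x)` with `B` of
size `n - 2`. -/
def mEta (m : ℕ) : LieSubalgebra ℂ (Gl m) where
  carrier := {A | (∀ i j : Fin (m + 3), i ≠ j → (m ≤ i.val ∨ m ≤ j.val) → A i j = 0) ∧
    ∀ i j : Fin (m + 3), m ≤ i.val → m ≤ j.val → A i i = A j j}
  add_mem' := fun {A B} hA hB =>
    ⟨fun i j h h' => by rw [Matrix.add_apply, hA.1 i j h h', hB.1 i j h h', add_zero],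
      fun i j h h' => by simp only [Matrix.add_apply, hA.2 i j h h', hB.2 i j h h']⟩
  zero_mem' := ⟨fun _ _ _ _ => rfl, fun _ _ _ _ => rfl⟩
  smul_mem' := fun c A hA =>
    ⟨fun i j h h' => by rw [Matrix.smul_apply, hA.1 i j h h', smul_zero],
      fun i j h h' => by simp only [Matrix.smul_apply, hA.2 i j h h']⟩
  lie_mem' := fun {A B} hA hB => by
    have row : ∀ {A B : Gl m}, (∀ i j : Fin (m + 3), i ≠ j → (m ≤ i.val ∨ m ≤ j.val) → A i j = 0) →
        ∀ i j : Fin (m + 3), m ≤ i.val → (A * B) i j = A i i * B i j := by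
      intro A B hA i j hi
      rw [Matrix.mul_apply, Finset.sum_eq_single i]
      · intro l _ hl; rw [hA i l hl.symm (Or.inl hi), zero_mul]
      · simp
    have col : ∀ {A B : Gl m}, (∀ i j : Fin (m + 3), i ≠ j → (m ≤ i.val ∨ m ≤ j.val) → B i j = 0) →
        ∀ i j : Fin (m + 3), m ≤ j.val → (A * B) i j = A i j * B j j := by
      intro A B hB i j hj
      rw [Matrix.mul_apply, Finset.sum_eq_single j]
      · intro l _ hl; rw [hB l j hl (Or.inr hj), mul_zero]
      · simp
    refine ⟨fun i j h h' => ?_, fun i j h h' => ?_⟩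
    · rw [LieRing.of_associative_ring_bracket, Matrix.sub_apply]
      rcases h' with h' | h'
      · rw [row hA.1 i j h', row hB.1 i j h', hA.1 i j h (Or.inl h'), hB.1 i j h (Or.inl h')]; ring
      · rw [col hA.1 i j h', col hB.1 i j h', hA.1 i j h (Or.inr h'), hB.1 i j h (Or.inr h')]; ring
    · simp only [LieRing.of_associative_ring_bracket, Matrix.sub_apply]
      rw [row hA.1 i i h, row hB.1 i i h, row hA.1 j j h', row hB.1 j j h']; ring

theorem mEta_le (m : ℕ) : mEta m ≤ kAlg m := by
  intro A hA i j h
  refine hA.1 i j (fun e => h (by rw [e])) ?_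
  by_contra hc
  push Not at hc
  apply h
  constructor <;> rintro rfl <;> simp at hc

/-- Coordinate in the decomposition `g = ℂh ⊕ n ⊕ k`. -/
def coordX {m : ℕ} (i : Fin (m + 1)) : Gl m →ₗ[ℂ] ℂ where
  toFun A := -(A (iP i) (iL m) + A (iL m) (iP i)) / 2
  map_add' A B := by simp only [Matrix.add_apply]; ring
  map_smul' c A := by simp only [Matrix.smul_apply, smul_eq_mul, RingHom.id_apply]; ring
/-- Coordinate in the decomposition `g = ℂh ⊕ n ⊕ k`. -/
def coordY {m : ℕ} (i : Fin (m + 1)) : Gl m →ₗ[ℂ] ℂ where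
  toFun A := (A (iL m) (iP i) - A (iP i) (iL m)) / (2 * Complex.I)
  map_add' A B := by simp only [Matrix.add_apply]; ring
  map_smul' c A := by simp only [Matrix.smul_apply, smul_eq_mul, RingHom.id_apply]; ring
/-- Coordinate in the decomposition `g = ℂh ⊕ n ⊕ k`. -/
def coordZ (m : ℕ) : Gl m →ₗ[ℂ] ℂ where
  toFun A := (A (iL m) (iM m) - A (iM m) (iL m)) / (2 * Complex.I)
  map_add' A B := by simp only [Matrix.add_apply]; ring
  map_smul' c A := by simp only [Matrix.smul_apply, smul_eq_mul, RingHom.id_apply]; ring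
/-- Coordinate in the decomposition `g = ℂh ⊕ n ⊕ k`. -/
def coordH (m : ℕ) : Gl m →ₗ[ℂ] ℂ where
  toFun A := (A (iL m) (iM m) + A (iM m) (iL m)) / 2
  map_add' A B := by simp only [Matrix.add_apply]; ring
  map_smul' c A := by simp only [Matrix.smul_apply, smul_eq_mul, RingHom.id_apply]; ring

/-- The projection of `g = (ℂh ⊕ n) ⊕ k` to `ℂh ⊕ n`. -/
def projB (m : ℕ) : Gl m →ₗ[ℂ] Gl m :=
  (coordH m).smulRight (hA m) + (coordZ m).smulRight (rootZ m) +
    (∑ i, (coordX i).smulRight (rootX i)) + ∑ i, (coordY i).smulRight (rootY i)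

/-- The projection of `g = (ℂh ⊕ n) ⊕ k` to `k`. -/
def projK (m : ℕ) : Gl m →ₗ[ℂ] Gl m := LinearMap.id - projB m

theorem iP_ne_iL {m : ℕ} (i : Fin (m + 1)) : iP i ≠ iL m := (Fin.castSucc_lt_last _).ne
theorem iP_ne_iM {m : ℕ} (i : Fin (m + 1)) : iP i ≠ iM m := fun h =>
  (Fin.castSucc_lt_last i).ne (Fin.castSucc_injective _ h)
theorem iM_ne_iL (m : ℕ) : iM m ≠ iL m := (Fin.castSucc_lt_last _).ne
theorem iP_inj {m : ℕ} (i j : Fin (m + 1)) : iP i = iP j ↔ i = j :=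
  ⟨fun h => Fin.castSucc_injective _ (Fin.castSucc_injective _ h), fun h => by rw [h]⟩


theorem idx_cases {m : ℕ} (x : Fin (m + 3)) : x = iL m ∨ x = iM m ∨ ∃ i, x = iP i := by
  induction x using Fin.lastCases with
  | last => exact Or.inl rfl
  | cast x =>
    induction x using Fin.lastCases with
    | last => exact Or.inr (Or.inl rfl)
    | cast x => exact Or.inr (Or.inr ⟨x, rfl⟩)

theorem sum_idx {m : ℕ} {A : Type*} [AddCommMonoid A] (f : Fin (m + 3) → A) :
    ∑ x, f x = ∑ i, f (iP i) + f (iM m) + f (iL m) := by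
  rw [Fin.sum_univ_castSucc, Fin.sum_univ_castSucc]

section entries
variable {m : ℕ} (A : Gl m)

theorem projB_apply : projB m A = coordH m A • hA m + coordZ m A • rootZ m +
    (∑ i, coordX i A • rootX i) + ∑ i, coordY i A • rootY i := by
  simp [projB]


theorem projB_PP (i j : Fin (m + 1)) : projB m A (iP i) (iP j) = 0 := by
  simp [projB_apply, hA, rootX, rootY, rootZ, E, Matrix.single_apply, Matrix.sum_apply,
    (iP_ne_iL _).symm, (iP_ne_iM _).symm, (iM_ne_iL m).symm, iM_ne_iL, iP_ne_iL, iP_ne_iM,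
    -Fin.castSucc_ne_last]
theorem projB_PM (i : Fin (m + 1)) : projB m A (iP i) (iM m) = -A (iP i) (iL m) := by
  simp [projB_apply, hA, rootX, rootY, rootZ, E, Matrix.single_apply, Matrix.sum_apply,
    (iP_ne_iL _).symm, (iP_ne_iM _).symm, (iM_ne_iL m).symm, iM_ne_iL, iP_ne_iL, iP_ne_iM,
    -Fin.castSucc_ne_last]
  simp [coordX, coordY]
  field_simp
  ring
theorem projB_PL (i : Fin (m + 1)) : projB m A (iP i) (iL m) = A (iP i) (iL m) := by
  simp [projB_apply, hA, rootX, rootY, rootZ, E, Matrix.single_apply, Matrix.sum_apply,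
    (iP_ne_iL _).symm, (iP_ne_iM _).symm, (iM_ne_iL m).symm, iM_ne_iL, iP_ne_iL, iP_ne_iM,
    -Fin.castSucc_ne_last]
  simp [coordX, coordY]
  field_simp
  ring
theorem projB_MP (i : Fin (m + 1)) : projB m A (iM m) (iP i) = A (iL m) (iP i) := by
  simp [projB_apply, hA, rootX, rootY, rootZ, E, Matrix.single_apply, Matrix.sum_apply,
    (iP_ne_iL _).symm, (iP_ne_iM _).symm, (iM_ne_iL m).symm, iM_ne_iL, iP_ne_iL, iP_ne_iM,
    -Fin.castSucc_ne_last]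
  simp [coordX, coordY]
  field_simp
  ring
theorem projB_LP (i : Fin (m + 1)) : projB m A (iL m) (iP i) = A (iL m) (iP i) := by
  simp [projB_apply, hA, rootX, rootY, rootZ, E, Matrix.single_apply, Matrix.sum_apply,
    (iP_ne_iL _).symm, (iP_ne_iM _).symm, (iM_ne_iL m).symm, iM_ne_iL, iP_ne_iL, iP_ne_iM,
    -Fin.castSucc_ne_last]
  simp [coordX, coordY]
  field_simp
  ring
theorem projB_MM : projB m A (iM m) (iM m) = (A (iL m) (iM m) - A (iM m) (iL m)) / 2 := by
  simp [projB_apply, hA, rootX, rootY, rootZ, E, Matrix.single_apply, Matrix.sum_apply,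
    (iP_ne_iL _).symm, (iP_ne_iM _).symm, (iM_ne_iL m).symm, iM_ne_iL, iP_ne_iL, iP_ne_iM,
    -Fin.castSucc_ne_last]
  simp [coordZ, coordH]
  field_simp
theorem projB_LL : projB m A (iL m) (iL m) = -(A (iL m) (iM m) - A (iM m) (iL m)) / 2 := by
  simp [projB_apply, hA, rootX, rootY, rootZ, E, Matrix.single_apply, Matrix.sum_apply,
    (iP_ne_iL _).symm, (iP_ne_iM _).symm, (iM_ne_iL m).symm, iM_ne_iL, iP_ne_iL, iP_ne_iM,
    -Fin.castSucc_ne_last]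
  simp [coordZ, coordH]
  field_simp
  ring
theorem projB_ML : projB m A (iM m) (iL m) = A (iM m) (iL m) := by
  simp [projB_apply, hA, rootX, rootY, rootZ, E, Matrix.single_apply, Matrix.sum_apply,
    (iP_ne_iL _).symm, (iP_ne_iM _).symm, (iM_ne_iL m).symm, iM_ne_iL, iP_ne_iL, iP_ne_iM,
    -Fin.castSucc_ne_last]
  simp [coordZ, coordH]
  field_simp
  ring
theorem projB_LM : projB m A (iL m) (iM m) = A (iL m) (iM m) := by
  simp [projB_apply, hA, rootX, rootY, rootZ, E, Matrix.single_apply, Matrix.sum_apply,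
    (iP_ne_iL _).symm, (iP_ne_iM _).symm, (iM_ne_iL m).symm, iM_ne_iL, iP_ne_iL, iP_ne_iM,
    -Fin.castSucc_ne_last]
  simp [coordZ, coordH]
  field_simp
  ring
end entries

/-- Equations for `ℂh ⊕ n` inside `g`. -/
structure InB {m : ℕ} (A : Gl m) : Prop where
  pp : ∀ i j, A (iP i) (iP j) = 0
  pm : ∀ i, A (iP i) (iM m) = -A (iP i) (iL m)
  mp : ∀ i, A (iM m) (iP i) = A (iL m) (iP i)
  mm : A (iM m) (iM m) = (A (iL m) (iM m) - A (iM m) (iL m)) / 2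
  ll : A (iL m) (iL m) = -(A (iL m) (iM m) - A (iM m) (iL m)) / 2

theorem inB_iff {m : ℕ} {A : Gl m} : projK m A = 0 ↔ InB A := by
  have h0 : projK m A = 0 ↔ A = projB m A := by
    rw [projK, LinearMap.sub_apply, LinearMap.id_apply, sub_eq_zero]
  rw [h0]
  constructor
  · intro h
    have e : ∀ x y, A x y = projB m A x y := fun x y => by rw [← h]
    exact ⟨fun i j => by rw [e, projB_PP], fun i => by rw [e, projB_PM], fun i => by
      rw [e, projB_MP], by rw [e, projB_MM], by rw [e, projB_LL]⟩
  · intro h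
    ext x y
    rcases idx_cases x with rfl | rfl | ⟨i, rfl⟩ <;> rcases idx_cases y with rfl | rfl | ⟨j, rfl⟩
    · rw [projB_LL, h.ll]
    · rw [projB_LM]
    · rw [projB_LP]
    · rw [projB_ML]
    · rw [projB_MM, h.mm]
    · rw [projB_MP, h.mp]
    · rw [projB_PL]
    · rw [projB_PM, h.pm]
    · rw [projB_PP, h.pp]

theorem projK_mem {m : ℕ} (A : Gl m) : projK m A ∈ kAlg m := by
  intro x y hxy
  rw [projK, LinearMap.sub_apply, LinearMap.id_apply, Matrix.sub_apply, sub_eq_zero]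
  rcases idx_cases x with rfl | rfl | ⟨i, rfl⟩ <;> rcases idx_cases y with rfl | rfl | ⟨j, rfl⟩
  · simp at hxy
  · rw [projB_LM]
  · rw [projB_LP]
  · rw [projB_ML]
  · simp at hxy
  · simp [iM_ne_iL, iP_ne_iL] at hxy
  · rw [projB_PL]
  · simp [iM_ne_iL, iP_ne_iL] at hxy
  · simp [iM_ne_iL, iP_ne_iL] at hxy

theorem coords_of_mem {m : ℕ} {A : Gl m} (h : A ∈ kAlg m) : coordH m A = 0 ∧ coordZ m A = 0 ∧
    (∀ i, coordX i A = 0) ∧ ∀ i, coordY i A = 0 := by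
  have h1 : ∀ x, x ≠ iL m → A x (iL m) = 0 := fun x hx => h x (iL m) (by simp [hx])
  have h2 : ∀ x, x ≠ iL m → A (iL m) x = 0 := fun x hx => h (iL m) x (by simp [hx])
  refine ⟨?_, ?_, fun i => ?_, fun i => ?_⟩
  · simp [coordH, h1 _ (iM_ne_iL m), h2 _ (iM_ne_iL m)]
  · simp [coordZ, h1 _ (iM_ne_iL m), h2 _ (iM_ne_iL m)]
  · simp [coordX, h1 _ (iP_ne_iL i), h2 _ (iP_ne_iL i)]
  · simp [coordY, h1 _ (iP_ne_iL i), h2 _ (iP_ne_iL i)]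

theorem projK_of_mem {m : ℕ} {A : Gl m} (h : A ∈ kAlg m) : projK m A = A := by
  obtain ⟨a, b, c, d⟩ := coords_of_mem h
  rw [projK, LinearMap.sub_apply, LinearMap.id_apply, projB_apply, a, b]
  simp [c, d]

theorem projK_eq_self {m : ℕ} {A : Gl m} : projK m A = A ↔ A ∈ kAlg m :=
  ⟨fun h => h ▸ projK_mem A, projK_of_mem⟩

theorem lie_entry {m : ℕ} (A B : Gl m) (x y : Fin (m + 3)) : (⁅A, B⁆ : Gl m) x y =
    (∑ i, A x (iP i) * B (iP i) y + A x (iM m) * B (iM m) y + A x (iL m) * B (iL m) y) -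
    (∑ i, B x (iP i) * A (iP i) y + B x (iM m) * A (iM m) y + B x (iL m) * A (iL m) y) := by
  rw [LieRing.of_associative_ring_bracket, Matrix.sub_apply, Matrix.mul_apply, Matrix.mul_apply,
    sum_idx, sum_idx]

theorem InB.lie {m : ℕ} {A B : Gl m} (hA : InB A) (hB : InB B) : InB ⁅A, B⁆ where
  pp i j := by
    simp only [lie_entry, hA.pp, hB.pp, hA.pm, hB.pm, hA.mp, hB.mp]; simp
  pm i := by
    simp only [lie_entry, hA.pp, hB.pp, hA.pm, hB.pm, hA.mm, hB.mm, hA.ll, hB.ll]; simp; ring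
  mp i := by
    simp only [lie_entry, hA.pp, hB.pp, hA.mp, hB.mp, hA.mm, hB.mm, hA.ll, hB.ll]; simp; ring
  mm := by
    simp only [lie_entry, hA.pm, hB.pm, hA.mp, hB.mp, hA.mm, hB.mm, hA.ll, hB.ll]
    simp only [mul_neg, Finset.sum_neg_distrib]; ring
  ll := by
    simp only [lie_entry, hA.pm, hB.pm, hA.mp, hB.mp, hA.mm, hB.mm, hA.ll, hB.ll]
    simp only [mul_neg, Finset.sum_neg_distrib]; ring

theorem InB.coordH_lie {m : ℕ} {A B : Gl m} (hA : InB A) (hB : InB B) : coordH m ⁅A, B⁆ = 0 := by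
  simp only [coordH, LinearMap.coe_mk, AddHom.coe_mk, lie_entry, hA.pm, hB.pm, hA.mp, hB.mp, hA.mm,
    hB.mm, hA.ll, hB.ll]
  simp only [mul_neg, Finset.sum_neg_distrib]; ring

theorem InB.coordY_lie {m : ℕ} {A B : Gl m} (hA : InB A) (hB : InB B) (i : Fin (m + 1)) :
    coordY i ⁅A, B⁆ = coordH m A * coordY i B - coordH m B * coordY i A := by
  simp only [coordY, coordH, LinearMap.coe_mk, AddHom.coe_mk, lie_entry, hA.pp, hB.pp, hA.pm,
    hB.pm, hA.mp, hB.mp, hA.mm, hB.mm, hA.ll, hB.ll]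
  simp; field_simp; ring

theorem InB.lie_mEta {m : ℕ} {X A : Gl m} (hX : X ∈ mEta m) (hA : InB A) : InB ⁅X, A⁆ ∧
    coordH m ⁅X, A⁆ = 0 ∧ coordY (Fin.last m) ⁅X, A⁆ = 0 := by
  have d0 : X (iM m) (iM m) = X (iL m) (iL m) := hX.2 _ _ (by simp) (by simp)
  have d1 : X (iP (Fin.last m)) (iP (Fin.last m)) = X (iL m) (iL m) :=
    hX.2 _ _ (by simp) (by simp)
  have z1 : ∀ i, X (iP i) (iM m) = 0 := fun i => hX.1 _ _ (iP_ne_iM i) (by simp)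
  have z2 : ∀ i, X (iM m) (iP i) = 0 := fun i => hX.1 _ _ (iP_ne_iM i).symm (by simp)
  have z3 : ∀ i, X (iP i) (iL m) = 0 := fun i => hX.1 _ _ (iP_ne_iL i) (by simp)
  have z4 : ∀ i, X (iL m) (iP i) = 0 := fun i => hX.1 _ _ (iP_ne_iL i).symm (by simp)
  have z5 : X (iM m) (iL m) = 0 := hX.1 _ _ (iM_ne_iL m) (by simp)
  have z6 : X (iL m) (iM m) = 0 := hX.1 _ _ (iM_ne_iL m).symm (by simp)
  have s1 : ∀ f : Fin (m + 1) → ℂ, ∑ i, X (iP (Fin.last m)) (iP i) * f i =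
      X (iL m) (iL m) * f (Fin.last m) := by
    intro f
    rw [Finset.sum_eq_single (Fin.last m), d1]
    · intro i _ hi
      rw [hX.1 _ _ (fun h => hi ((iP_inj _ _).1 h).symm) (by simp), zero_mul]
    · simp
  have s2 : ∀ f : Fin (m + 1) → ℂ, ∑ i, f i * X (iP i) (iP (Fin.last m)) =
      f (Fin.last m) * X (iL m) (iL m) := by
    intro f
    rw [Finset.sum_eq_single (Fin.last m), d1]
    · intro i _ hi
      rw [hX.1 _ _ (fun h => hi ((iP_inj _ _).1 h)) (by simp), mul_zero]
    · simp
  refine ⟨⟨fun i j => ?_, fun i => ?_, fun i => ?_, ?_, ?_⟩, ?_, ?_⟩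
  · simp only [lie_entry, hA.pp, z1, z2, z3, z4]; simp
  · simp only [lie_entry, hA.pp, hA.pm, z1, z3, z5, z6, d0]; simp; ring
  · simp only [lie_entry, hA.pp, hA.mp, z2, z4, z5, z6, d0]; simp
  · simp only [lie_entry, hA.mm, z1, z2, z3, z4, z5, z6, d0]; simp; ring
  · simp only [lie_entry, hA.ll, z1, z2, z3, z4, z5, z6, d0]; simp; ring
  · simp only [coordH, LinearMap.coe_mk, AddHom.coe_mk, lie_entry, z1, z2, z3, z4, z5, z6, d0]
    simp; ring
  · simp only [coordY, LinearMap.coe_mk, AddHom.coe_mk, lie_entry, s1, s2, z1, z2, z3, z4, z5, z6,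
      hA.pp]
    simp; ring


section analysis
variable (W : Type*) [NormedAddCommGroup W] [NormedSpace ℂ W]

/-- `C^∞(A → W)`. The group `A` is identified with `ℝ`: the point `x` is `a_t = exp(log(ξ/t) h)` with
`t = e^x`, where `η(Y_{n-1}) = √-1 ξ`. -/
def SmoothA : Submodule ℂ (ℝ → W) where
  carrier := {f | ContDiff ℝ ∞ f}
  add_mem' {f g} (hf : ContDiff ℝ ∞ f) (hg : ContDiff ℝ ∞ g) := hf.add hg
  zero_mem' := (contDiff_const : ContDiff ℝ ∞ fun _ : ℝ => (0 : W))
  smul_mem' c f (hf : ContDiff ℝ ∞ f) := hf.const_smul c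

variable {W} in
theorem SmoothA.contDiff (f : SmoothA W) : ContDiff ℝ ∞ f.1 := f.2

variable {W} in
theorem SmoothA.differentiable (f : SmoothA W) : Differentiable ℝ f.1 :=
  (SmoothA.contDiff f).differentiable (by simp)

/-- The operator `t d/dt`, which is `d/dx` for `t = e^x`. -/
def eulerOp : Module.End ℂ (SmoothA W) where
  toFun f := ⟨deriv f.1, (contDiff_infty_iff_deriv.1 (SmoothA.contDiff f)).2⟩
  map_add' f g := by
    ext x
    exact deriv_add ((SmoothA.differentiable f) x) ((SmoothA.differentiable g) x)
  map_smul' c f := by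
    ext x
    exact deriv_const_smul c ((SmoothA.differentiable f) x)

/-- Multiplication by `√-1 t`, `t = e^x`. -/
def mulIT : Module.End ℂ (SmoothA W) where
  toFun f := ⟨fun x => (Complex.I * (Real.exp x : ℂ)) • f.1 x, by
    have : ContDiff ℝ ∞ fun x : ℝ => Complex.I * (Real.exp x : ℂ) :=
      contDiff_const.mul (Complex.ofRealCLM.contDiff.comp Real.contDiff_exp)
    exact this.smul (SmoothA.contDiff f)⟩
  map_add' f g := by ext x; exact smul_add _ _ _
  map_smul' c f := by ext x; exact smul_comm _ _ _

theorem eulerOp_mulIT : eulerOp W * mulIT W = mulIT W * eulerOp W + mulIT W := by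
  ext f x
  have h1 : HasDerivAt (fun x : ℝ => Complex.I * (Real.exp x : ℂ))
      (Complex.I * (Real.exp x : ℂ)) x := ((Real.hasDerivAt_exp x).ofReal_comp).const_mul _
  have h2 : HasDerivAt f.1 (deriv f.1 x) x := ((SmoothA.differentiable f) x).hasDerivAt
  exact (h1.smul h2).deriv

end analysis

/-- `C^∞(A → Hom(V, W))` for finite-dimensional `V`: `φ` is stored as `v ↦ (a ↦ φ(a)(v))`. -/
abbrev SmoothHom (V W : Type*) [AddCommGroup V] [Module ℂ V] [NormedAddCommGroup W] [NormedSpace ℂ W] :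
    Type _ := V →ₗ[ℂ] SmoothA W

section action
variable {m : ℕ} {V : Type*} [AddCommGroup V] [Module ℂ V] [LieRingModule (kAlg m) V]
  [LieModule ℂ (kAlg m) V]
variable {W : Type*} [NormedAddCommGroup W] [NormedSpace ℂ W]

/-- Composition with an operator on `C^∞(A → W)`. -/
def postAct (T : Module.End ℂ (SmoothA W)) : Module.End ℂ (SmoothHom V W) where
  toFun φ := T ∘ₗ φ
  map_add' φ ψ := by ext; simp
  map_smul' c φ := by ext; simp

/-- The action of `X ∈ k`: `(X · φ)(a)(v) = φ(a)(τ(X) v)`. -/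
def preAct (X : kAlg m) : Module.End ℂ (SmoothHom V W) where
  toFun φ := φ ∘ₗ LieModule.toEnd ℂ (kAlg m) V X
  map_add' _ _ := rfl
  map_smul' _ _ := rfl

/-- `act u φ` is `u · φ`, the restriction to `A` of the left derivative `L(u)` of the
`V`-isotypic family of `W`-valued functions on `G`, with `f(g n) = η(n)⁻¹ f(g)`, that `φ` determines:
for `u_n ∈ U(n)`, `u_a ∈ U(a)`, `u_k ∈ U(k)`,
`((u_n u_a u_k) · φ)(a_t)(v) = η_t(u_n) ∂(u_a) φ(a_t)(τ(u_k) v)`, where `∂(h) = t d/dt`,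
`η_t(Y_{n-1}) = √-1 t` and `η_t` vanishes on the other `X_i`, `Y_i`, `Z`. Such an `act` exists
(`exists_isAct`) and is unique (`IsAct.unique`). -/
structure IsAct (act : UniversalEnvelopingAlgebra ℂ (Gl m) →ₗ[ℂ] Module.End ℂ (SmoothHom V W)) :
    Prop where
  one : act 1 = 1
  h_mul : ∀ u, act (UniversalEnvelopingAlgebra.ι ℂ (hA m) * u) = postAct (eulerOp W) * act u
  x_mul : ∀ i u, act (UniversalEnvelopingAlgebra.ι ℂ (rootX i) * u) = 0
  y_mul : ∀ i u, act (UniversalEnvelopingAlgebra.ι ℂ (rootY i) * u) =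
    if i = Fin.last m then postAct (mulIT W) * act u else 0
  z_mul : ∀ u, act (UniversalEnvelopingAlgebra.ι ℂ (rootZ m) * u) = 0
  mul_k : ∀ (X : kAlg m) u, act (u * UniversalEnvelopingAlgebra.ι ℂ (X : Gl m)) = preAct X * act u

variable (m V W) in
/-- The left action of `ℂh ⊕ n`, extended by zero to `k`. -/
def rhoB : Gl m →ₗ[ℂ] Module.End ℂ (SmoothHom V W) :=
  (coordH m).smulRight (postAct (eulerOp W)) + (coordY (Fin.last m)).smulRight (postAct (mulIT W))

theorem rhoB_apply (A : Gl m) : rhoB m V W A = coordH m A • postAct (eulerOp W) +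
    coordY (Fin.last m) A • postAct (mulIT W) := rfl

variable (m V W) in
/-- The right action of `k`, extended by zero to `ℂh ⊕ n`. -/
def rK : Gl m →ₗ[ℂ] Module.End ℂ (SmoothHom V W) where
  toFun A := preAct ⟨projK m A, projK_mem A⟩
  map_add' A B := by
    ext φ v x
    simp only [map_add]
    change (φ (⁅(⟨projK m A, projK_mem A⟩ + ⟨projK m B, projK_mem B⟩ : kAlg m), v⁆)).1 x = _
    rw [add_lie, map_add]; rfl
  map_smul' c A := by
    ext φ v x
    simp only [map_smul]
    change (φ (⁅c • (⟨projK m A, projK_mem A⟩ : kAlg m), v⁆)).1 x = _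
    rw [smul_lie, map_smul]; rfl

theorem rK_of_mem (X : kAlg m) : rK m V W X = preAct X := by
  change preAct _ = _
  congr 1
  exact Subtype.ext (projK_of_mem X.2)

theorem rhoB_aux {F : Type*} [AddCommGroup F] [Module ℂ F] {P Q : Module.End ℂ F} (e : P * Q = Q * P + Q)
    {a b a' b' : ℂ} : (0 : ℂ) • P + (a * b' - a' * b) • Q =
      (a • P + b • Q) * (a' • P + b' • Q) - (a' • P + b' • Q) * (a • P + b • Q) := by
  simp only [add_mul, mul_add, smul_mul_assoc, mul_smul_comm, e]
  module

theorem decomp : Decomp (F := SmoothHom V W) (rhoB m V W) (projK m) (rK m V W) where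
  proj A := projK_of_mem (projK_mem A)
  sub_k A B := projK_of_mem ((kAlg m).lie_mem (projK_mem A) (projK_mem B))
  sub_b A B hA hB := inB_iff.2 ((inB_iff.1 hA).lie (inB_iff.1 hB))
  rho_k A := by
    obtain ⟨a, -, -, b⟩ := coords_of_mem (projK_mem A)
    rw [rhoB_apply, a, b]; simp
  rho_lie A B hA hB := by
    rw [inB_iff] at hA hB
    rw [rhoB_apply, rhoB_apply, rhoB_apply, hA.coordH_lie hB, hA.coordY_lie hB]
    have e : (postAct (eulerOp W) * postAct (mulIT W) : Module.End ℂ (SmoothHom V W)) =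
        postAct (mulIT W) * postAct (eulerOp W) + postAct (mulIT W) := by
      ext φ v : 2
      exact LinearMap.congr_fun (eulerOp_mulIT W) (φ v)
    exact rhoB_aux (F := SmoothHom V W) e
  r_k A := by
    change preAct _ = preAct _
    congr 1
    exact Subtype.ext (projK_of_mem (projK_mem A))
  r_lie A B := by
    have e := rK_of_mem (V := V) (W := W)
      ⁅(⟨projK m A, projK_mem A⟩ : kAlg m), (⟨projK m B, projK_mem B⟩ : kAlg m)⁆
    change rK m V W ⁅projK m A, projK m B⁆ = _ at e
    rw [e]
    ext φ v x
    change (φ ⁅⁅(⟨projK m A, projK_mem A⟩ : kAlg m), (⟨projK m B, projK_mem B⟩ : kAlg m)⁆, v⁆).1 x =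
      (φ ⁅(⟨projK m A, projK_mem A⟩ : kAlg m), ⁅(⟨projK m B, projK_mem B⟩ : kAlg m), v⁆⁆).1 x -
      (φ ⁅(⟨projK m B, projK_mem B⟩ : kAlg m), ⁅(⟨projK m A, projK_mem A⟩ : kAlg m), v⁆⁆).1 x
    rw [lie_lie, map_sub]; rfl
  comm A B := by
    rw [rhoB_apply]
    simp only [add_mul, mul_add, smul_mul_assoc, mul_smul_comm]
    rfl

theorem inB_hA : InB (hA m) ∧ rhoB m V W (hA m) = postAct (eulerOp W) := by
  refine ⟨⟨fun i j => ?_, fun i => ?_, fun i => ?_, ?_, ?_⟩, ?_⟩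
  all_goals simp [rhoB_apply, coordH, coordY, hA, E, Matrix.single_apply, (iP_ne_iL _).symm,
    (iP_ne_iM _).symm, (iM_ne_iL m).symm, iM_ne_iL, iP_ne_iL, iP_ne_iM]

theorem inB_rootX (i : Fin (m + 1)) : InB (rootX i) ∧ rhoB m V W (rootX i) = 0 := by
  refine ⟨⟨fun i j => ?_, fun i => ?_, fun i => ?_, ?_, ?_⟩, ?_⟩
  all_goals simp [rhoB_apply, coordH, coordY, rootX, E, Matrix.single_apply, (iP_ne_iL _).symm,
    (iP_ne_iM _).symm, (iM_ne_iL m).symm, iM_ne_iL, iP_ne_iL, iP_ne_iM]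

theorem inB_rootZ : InB (rootZ m) ∧ rhoB m V W (rootZ m) = 0 := by
  refine ⟨⟨fun i j => ?_, fun i => ?_, fun i => ?_, ?_, ?_⟩, ?_⟩
  all_goals simp [rhoB_apply, coordH, coordY, rootZ, E, Matrix.single_apply, (iP_ne_iL _).symm,
    (iP_ne_iM _).symm, (iM_ne_iL m).symm, iM_ne_iL, iP_ne_iL, iP_ne_iM]

theorem inB_rootY (i : Fin (m + 1)) : InB (rootY i) ∧
    rhoB m V W (rootY i) = if i = Fin.last m then postAct (mulIT W) else 0 := by
  refine ⟨⟨fun i j => ?_, fun i => ?_, fun i => ?_, ?_, ?_⟩, ?_⟩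
  all_goals simp [rhoB_apply, coordH, coordY, rootY, E, Matrix.single_apply, (iP_ne_iL _).symm,
    (iP_ne_iM _).symm, (iM_ne_iL m).symm, iM_ne_iL, iP_ne_iL, iP_ne_iM]
  split_ifs with h
  · have : (Complex.I + Complex.I) / (2 * Complex.I) = 1 := by field_simp; norm_num
    simp [this]
  · simp

theorem IsAct.b_mul {act : UniversalEnvelopingAlgebra ℂ (Gl m) →ₗ[ℂ] Module.End ℂ (SmoothHom V W)}
    (h : IsAct act) {A : Gl m} (hA : projK m A = 0) (u : UniversalEnvelopingAlgebra ℂ (Gl m)) :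
    act (UniversalEnvelopingAlgebra.ι ℂ A * u) = rhoB m V W A * act u := by
  have hA' : A = projB m A := by
    rwa [projK, LinearMap.sub_apply, LinearMap.id_apply, sub_eq_zero] at hA
  rw [rhoB_apply]
  conv_lhs => rw [hA', projB_apply]
  simp only [map_add, map_sum, LieHom.coe_toLinearMap, add_mul, Finset.sum_mul, smul_mul_assoc, map_smul,
    h.h_mul, h.x_mul, h.y_mul, h.z_mul]
  simp

theorem exists_isAct : ∃ act : UniversalEnvelopingAlgebra ℂ (Gl m) →ₗ[ℂ] Module.End ℂ (SmoothHom V W),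
    IsAct act := by
  obtain ⟨act, h1, hb, hk⟩ := exists_act (decomp (m := m) (V := V) (W := W))
  refine ⟨act, h1, fun u => ?_, fun i u => ?_, fun i u => ?_, fun u => ?_, fun X u => ?_⟩
  · have := hb (hA m) u (inB_iff.2 (inB_hA (V := V) (W := W)).1)
    rw [inB_hA.2] at this
    exact this
  · have := hb (rootX i) u (inB_iff.2 (inB_rootX (V := V) (W := W) i).1)
    rw [(inB_rootX i).2] at this
    exact this.trans (zero_mul _)
  · have := hb (rootY i) u (inB_iff.2 (inB_rootY (V := V) (W := W) i).1)
    rw [(inB_rootY i).2] at this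
    refine this.trans ?_
    split_ifs
    · rfl
    · exact zero_mul _
  · have := hb (rootZ m) u (inB_iff.2 (inB_rootZ (V := V) (W := W)).1)
    rw [inB_rootZ.2] at this
    exact this.trans (zero_mul _)
  · have := hk (X : Gl m) u (projK_of_mem X.2)
    rw [rK_of_mem] at this
    exact this

theorem IsAct.unique {act act' : UniversalEnvelopingAlgebra ℂ (Gl m) →ₗ[ℂ] Module.End ℂ (SmoothHom V W)}
    (h : IsAct act) (h' : IsAct act') : act = act' := by
  have := submodule_eq_top (LinearMap.eqLocus act act') (projK m)
    (fun A => projK_of_mem (projK_mem A)) (h.one.trans h'.one.symm) ?_ ?_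
  · ext1 u
    exact (this ▸ Submodule.mem_top : u ∈ LinearMap.eqLocus act act')
  · intro X u hX (hu : act u = act' u)
    change act _ = act' _
    rw [h.b_mul hX, h'.b_mul hX, hu]
  · intro X u hX (hu : act u = act' u)
    change act _ = act' _
    have := h.mul_k ⟨X, projK_eq_self.1 hX⟩ u
    have h2 := h'.mul_k ⟨X, projK_eq_self.1 hX⟩ u
    rw [this, h2, hu]

variable (m V W) in
/-- The action `u ↦ (φ ↦ u · φ)` of `U(g)` on `C^∞(A → Hom(V, W))`; see `IsAct`. -/
def envAct : UniversalEnvelopingAlgebra ℂ (Gl m) →ₗ[ℂ] Module.End ℂ (SmoothHom V W) :=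
  exists_isAct.choose

theorem isAct_envAct : IsAct (envAct m V W) := exists_isAct.choose_spec

end action

section equivariant
variable {m : ℕ} {V V' : Type*} [AddCommGroup V] [Module ℂ V] [LieRingModule (kAlg m) V]
  [LieModule ℂ (kAlg m) V] [AddCommGroup V'] [Module ℂ V'] [LieRingModule (kAlg m) V']
  [LieModule ℂ (kAlg m) V']
variable {W : Type*} [NormedAddCommGroup W] [NormedSpace ℂ W] [LieRingModule (mEta m) W]
  [LieModule ℂ (mEta m) W]

/-- The inclusion of the Lie algebra of `M^η` in `k`. -/
def mEtaToK (m : ℕ) : mEta m →ₗ⁅ℂ⁆ kAlg m := LieSubalgebra.inclusion (mEta_le m)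

variable (m V W) in
/-- `C^∞(A → Hom_{M^η}(V, W))`. For `V` the `K`-type with highest weight `λ` and `W` the
`M^η`-representation with highest weight `γ` this is the space of smooth functions on `A` with values
in `V_{(λ/γ)^*} ≃ Hom_{M^η}(V_λ, V_γ)` (`M^η` is connected). -/
def WhittakerSpace : Submodule ℂ (SmoothHom V W) where
  carrier := {φ | ∀ (X : mEta m) (v : V) (x : ℝ),
    (φ ⁅mEtaToK m X, v⁆).1 x = ⁅X, (φ v).1 x⁆}
  add_mem' {φ ψ} hφ hψ X v x := by
    exact (congrArg₂ (· + ·) (hφ X v x) (hψ X v x)).trans (lie_add X _ _).symm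
  zero_mem' X v x := (lie_zero X).symm
  smul_mem' c φ hφ X v x := by
    exact (congrArg (c • ·) (hφ X v x)).trans (lie_smul c X _).symm

theorem rhoB_comm_lie [FiniteDimensional ℂ W] (A : Gl m) (X : mEta m) (φ ψ : SmoothHom V W) (v v' : V)
    (h : ∀ x, (φ v).1 x = ⁅X, (ψ v').1 x⁆) (x : ℝ) :
    (rhoB m V W A φ v).1 x = ⁅X, (rhoB m V W A ψ v').1 x⁆ := by
  let L : W →L[ℂ] W := LinearMap.toContinuousLinearMap (LieModule.toEnd ℂ (mEta m) W X)
  have hL : ∀ w, ⁅X, w⁆ = L w := fun w => rfl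
  have hf : (φ v).1 = fun x => L ((ψ v').1 x) := funext h
  have hd : deriv (φ v).1 x = L (deriv (ψ v').1 x) := by
    rw [hf]
    have h2 : HasDerivAt (ψ v').1 (deriv (ψ v').1 x) x := (SmoothA.differentiable _ x).hasDerivAt
    exact ((L.restrictScalars ℝ).hasFDerivAt.comp_hasDerivAt x h2).deriv
  change coordH m A • deriv (φ v).1 x +
      coordY (Fin.last m) A • ((Complex.I * (Real.exp x : ℂ)) • (φ v).1 x) =
    ⁅X, coordH m A • deriv (ψ v').1 x +
      coordY (Fin.last m) A • ((Complex.I * (Real.exp x : ℂ)) • (ψ v').1 x)⁆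
  rw [hd, h x, hL, hL, map_add, map_smul, map_smul, map_smul]

theorem act_mEta [FiniteDimensional ℂ W] (u : UniversalEnvelopingAlgebra ℂ (Gl m))
    {φ : SmoothHom V W} (hφ : φ ∈ WhittakerSpace m V W) (X : mEta m) (v : V) (x : ℝ) :
    (envAct m V W (UniversalEnvelopingAlgebra.ι ℂ (X : Gl m) * u) φ v).1 x =
      ⁅X, (envAct m V W u φ v).1 x⁆ := by
  let S : Submodule ℂ (UniversalEnvelopingAlgebra ℂ (Gl m)) :=
    { carrier := {u | ∀ (v : V) (x : ℝ),
        (envAct m V W (UniversalEnvelopingAlgebra.ι ℂ (X : Gl m) * u) φ v).1 x =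
          ⁅X, (envAct m V W u φ v).1 x⁆}
      add_mem' := fun {a b} ha hb v x => by
        rw [mul_add, map_add, map_add]
        exact (congrArg₂ (· + ·) (ha v x) (hb v x)).trans (lie_add X _ _).symm
      zero_mem' := fun v x => by
        rw [mul_zero, map_zero]; exact (lie_zero X).symm
      smul_mem' := fun c a ha v x => by
        rw [mul_smul_comm, map_smul, map_smul]
        exact (congrArg (c • ·) (ha v x)).trans (lie_smul c X _).symm }
  have hS : S = ⊤ := by
    have hact := isAct_envAct (m := m) (V := V) (W := W)
    refine submodule_eq_top S (projK m) (fun A => projK_of_mem (projK_mem A)) ?_ ?_ ?_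
    · intro v x
      have := hact.mul_k (mEtaToK m X) 1
      rw [one_mul, hact.one, mul_one] at this
      rw [mul_one, hact.one]
      change (envAct m V W (UniversalEnvelopingAlgebra.ι ℂ ((mEtaToK m X : kAlg m) : Gl m)) φ v).1 x = _
      rw [this]
      exact hφ X v x
    · intro A u hA hu v x
      have hA' := inB_iff.1 hA
      obtain ⟨b1, b2, b3⟩ := hA'.lie_mEta X.2
      have e : UniversalEnvelopingAlgebra.ι ℂ (X : Gl m) *
          (UniversalEnvelopingAlgebra.ι ℂ A * u) =
          UniversalEnvelopingAlgebra.ι ℂ A * (UniversalEnvelopingAlgebra.ι ℂ (X : Gl m) * u) +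
          UniversalEnvelopingAlgebra.ι ℂ ⁅(X : Gl m), A⁆ * u := by
        rw [LieHom.map_lie, LieRing.of_associative_ring_bracket]
        simp only [sub_mul, mul_assoc]; abel
      rw [e, map_add, hact.b_mul hA, hact.b_mul hA, hact.b_mul (inB_iff.2 b1), rhoB_apply ⁅(X : Gl m), A⁆,
        b2, b3]
      simp only [zero_smul, add_zero, zero_mul]
      exact rhoB_comm_lie A X _ _ v v (hu v) x
    · intro A u hA hu v x
      have e := hact.mul_k ⟨A, projK_eq_self.1 hA⟩ u
      have e' := hact.mul_k ⟨A, projK_eq_self.1 hA⟩ (UniversalEnvelopingAlgebra.ι ℂ (X : Gl m) * u)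
      rw [← mul_assoc, e, e']
      exact hu _ x
  exact (hS ▸ Submodule.mem_top : u ∈ S) v x

variable (V W) in
/-- The operator `D_{λ,γ}(z)`, `z ∈ Z(g)`: `φ ↦ z · φ` on `C^∞(A → Hom_{M^η}(V, W))`. -/
def centralAction [FiniteDimensional ℂ W] (z : UniversalEnvelopingAlgebra ℂ (Gl m))
    (hz : z ∈ Subalgebra.center ℂ (UniversalEnvelopingAlgebra ℂ (Gl m))) :
    Module.End ℂ (WhittakerSpace m V W) :=
  (envAct m V W z).restrict fun φ hφ X v x => by
    have e := (isAct_envAct (m := m) (V := V) (W := W)).mul_k (mEtaToK m X) z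
    have e2 := act_mEta z hφ X v x
    rw [(Subalgebra.mem_center_iff.1 hz _ : _ = _)] at e2
    change (envAct m V W (z * UniversalEnvelopingAlgebra.ι ℂ ((mEtaToK m X : kAlg m) : Gl m)) φ v).1 x
      = _ at e2
    rw [e] at e2
    exact e2

/-- `∇φ : v ⊗ X ↦ (X · φ)(v)`, for `v ∈ V` and `X ∈ s`; this is `∑ W_i · φ ⊗ W_i`, for an orthonormal
basis `W_i` of `s`, as a functional of `V ⊗ s`. -/
def nabla (φ : SmoothHom V W) : V ⊗[ℂ] sMod m →ₗ[ℂ] SmoothA W :=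
  TensorProduct.lift (LinearMap.mk₂ ℂ
    (fun v X => envAct m V W (UniversalEnvelopingAlgebra.ι ℂ (X : Gl m)) φ v)
    (fun v v' X => map_add _ v v') (fun c v X => map_smul _ c v)
    (fun v X X' => by simp) (fun c v X => by simp))

theorem nabla_tmul (φ : SmoothHom V W) (v : V) (X : sMod m) : nabla φ (v ⊗ₜ X) =
    envAct m V W (UniversalEnvelopingAlgebra.ι ℂ (X : Gl m)) φ v := by
  simp [nabla]

theorem nabla_mEta [FiniteDimensional ℂ W] {φ : SmoothHom V W} (hφ : φ ∈ WhittakerSpace m V W)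
    (X : mEta m) (t : V ⊗[ℂ] sMod m) (x : ℝ) :
    (nabla φ ⁅mEtaToK m X, t⁆).1 x = ⁅X, (nabla φ t).1 x⁆ := by
  induction t with
  | zero => rw [lie_zero, map_zero]; exact (lie_zero X).symm
  | add a b ha hb =>
    rw [lie_add, map_add, map_add]
    exact (congrArg₂ (· + ·) ha hb).trans (lie_add X _ _).symm
  | tmul v S =>
    rw [TensorProduct.LieModule.lie_tmul_right, map_add, nabla_tmul, nabla_tmul, nabla_tmul,
      ← act_mEta _ hφ]
    have e := (isAct_envAct (m := m) (V := V) (W := W)).mul_k (mEtaToK m X)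
      (UniversalEnvelopingAlgebra.ι ℂ (S : Gl m))
    have e2 : UniversalEnvelopingAlgebra.ι ℂ (X : Gl m) * UniversalEnvelopingAlgebra.ι ℂ (S : Gl m) =
        UniversalEnvelopingAlgebra.ι ℂ (S : Gl m) *
          UniversalEnvelopingAlgebra.ι ℂ ((mEtaToK m X : kAlg m) : Gl m) +
        UniversalEnvelopingAlgebra.ι ℂ ⁅(X : Gl m), (S : Gl m)⁆ := by
      rw [LieHom.map_lie, LieRing.of_associative_ring_bracket]
      change _ = _ * UniversalEnvelopingAlgebra.ι ℂ (X : Gl m) + _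
      abel
    rw [e2, map_add, e]
    rfl

variable (W) in
/-- The `K`-type shift operator `φ ↦ ∇φ ∘ ι` given by a `K`-homomorphism `ι : V' → V ⊗ s`. For `V'` of
highest weight `λ + α` and `ι ≠ 0` it is `P_α = pr ∘ ∇`, with `pr` the projection of `V^* ⊗ s` to
`V'^*` that is transposed to `ι`. -/
def shiftOp [FiniteDimensional ℂ W] (ι : V' →ₗ⁅ℂ, kAlg m⁆ V ⊗[ℂ] sMod m) :
    WhittakerSpace m V W →ₗ[ℂ] WhittakerSpace m V' W where
  toFun φ := ⟨nabla φ.1 ∘ₗ (ι : V' →ₗ[ℂ] V ⊗[ℂ] sMod m), fun X v x => by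
    change (nabla φ.1 (ι ⁅mEtaToK m X, v⁆)).1 x = ⁅X, (nabla φ.1 (ι v)).1 x⁆
    rw [LieModuleHom.map_lie]
    exact nabla_mEta φ.2 X (ι v) x⟩
  map_add' φ ψ := by
    have : nabla (m := m) (φ.1 + ψ.1) = nabla φ.1 + nabla ψ.1 := by
      ext : 3; simp [nabla_tmul]
    ext : 1
    change nabla (φ.1 + ψ.1) ∘ₗ _ = _
    rw [this]; rfl
  map_smul' c φ := by
    have : nabla (m := m) (c • φ.1) = c • nabla φ.1 := by
      ext : 3; simp [nabla_tmul]
    ext : 1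
    change nabla (c • φ.1) ∘ₗ _ = _
    rw [this]; rfl

end equivariant

/-- `C_{n+1}(u) = ∑_σ sgn(σ) E_{σ(n+1),n+1}(u+n) E_{σ(n),n}(u+n-1) ⋯ E_{σ(1),1}(u)`, where
`E_{ij}(u) = E_{ij} + u δ_{ij}`. -/
def capelli (m : ℕ) (u : ℂ) : UniversalEnvelopingAlgebra ℂ (Gl m) :=
  ∑ σ : Equiv.Perm (Fin (m + 3)), (Equiv.Perm.sign σ : ℤ) •
    (List.ofFn fun q : Fin (m + 3) =>
      UniversalEnvelopingAlgebra.ι ℂ (E (σ q.rev) q.rev) +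
        algebraMap ℂ _ (if σ q.rev = q.rev then u + (q.rev.val : ℂ) else 0)).prod

/-- Integral weights `λ = (λ_1, …, λ_n; λ_{n+1})` of `K = U(n) × U(1)`. -/
abbrev Weight (m : ℕ) : Type := Fin (m + 3) → ℤ

/-- `λ_1 ≥ ⋯ ≥ λ_n`. -/
def Dominant {m : ℕ} (lam : Weight m) : Prop :=
  ∀ i j : Fin (m + 2), i ≤ j → lam j.castSucc ≤ lam i.castSucc

/-- `V` is the irreducible representation `V_λ` of `K` with highest weight `λ` if `λ` is dominant,
and `V = 0` if not. (The highest weight vector is the vector on which the upper triangular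
`X ∈ k` act by `∑ λ_i X_{ii}`.) -/
def IsKType {m : ℕ} (lam : Weight m) (V : Type*) [AddCommGroup V] [Module ℂ V]
    [LieRingModule (kAlg m) V] : Prop :=
  (Dominant lam → LieModule.IsIrreducible ℂ (kAlg m) V ∧
    ∃ v : V, v ≠ 0 ∧ ∀ X : kAlg m, (∀ i j, j < i → (X : Gl m) i j = 0) →
      ⁅X, v⁆ = (∑ i, (lam i : ℂ) * (X : Gl m) i i) • v) ∧
  (¬Dominant lam → Subsingleton V)

/-- `W` is the irreducible representation of `M^η ≃ U(n-2) × U(1)` with highest weight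
`γ = (γ_1, …, γ_{n-2}; γ_{n-1})`. -/
def IsMEtaType {m : ℕ} (gam : Fin (m + 1) → ℤ) (W : Type*) [AddCommGroup W] [Module ℂ W]
    [LieRingModule (mEta m) W] : Prop :=
  LieModule.IsIrreducible ℂ (mEta m) W ∧
    ∃ w : W, w ≠ 0 ∧ ∀ X : mEta m, (∀ i j, j < i → (X : Gl m) i j = 0) →
      ⁅X, w⁆ = (∑ i, (gam i : ℂ) * (X : Gl m) (iP i) (iP i)) • w

/-- The weight `ε_{n+1-k} - ε_{n+1}` of `s`, by which `P_k^+` shifts `λ` (here `k` is counted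
from `0`). -/
def shiftWeight {m : ℕ} (k : Fin (m + 2)) : Weight m :=
  Pi.single k.rev.castSucc 1 - Pi.single (iL m) 1

/-- `λ^*_k = -λ_{n+1-k}`. -/
def dualWeight {m : ℕ} (lam : Weight m) (k : Fin (m + 2)) : ℤ := -lam k.rev.castSucc

/-- `l_{k,n} = λ^*_k - k`, for `k = 1, …, n`. -/
def lParam {m : ℕ} (lam : Weight m) (k : Fin (m + 2)) : ℂ :=
  ((dualWeight lam k - ((k.val : ℤ) + 1) : ℤ) : ℂ)

end
end ShiftOps

/-! Write L = n+1, and read the columns of the matrix (E_ij) as odd elements ∑_i e_i E_ij with e_i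
in an exterior algebra. Two columns anticommute once their spectral shifts differ by one
(`letter_swap`). Hence a product of columns with shifts decreasing by one is alternating in the
columns. Its top coefficient is the quantum determinant `qdet`, and with all n+1 columns this is
C_{n+1}(u) (`qdet_inl`). Alternation yields expansions along a column with the entries on either
side (`qdet_expand_left`, `qdet_expand_right`) and the commutators with E_ab (`qdet_comm`), hence
centrality.

Expanding along the last column and row gives two formulas whose rightmost factors come from U(gl_n)
(`qdet_inl_expand`, `qdet_inl_expand'`): C(u) = (E_LL + u + n) M(u) - ∑ E_iL E_Lj cof_ij(u) = (E_LL
+ u) M(u+1) - ∑ E_Lj E_iL cof_ij(u), with M the quantum minor and cof_ij the quantum cofactors of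
the upper left block. A rightmost factor from U(k) acts on φ through the vector of the K-type
(`evAct_mul_kToG`).

Put λ' = λ + α_k, r = n+1-k and u = l_{k,n}(λ). The eigenvalues of the minor show that M(u+1)
vanishes on V_λ and M(u) vanishes on V_λ', so only the quadratic sums over s remain. Comparing the
eigenvalues of E_LL gives ι⁺ x = ∑ A_i x ⊗ E_iL and ι⁻ x = ∑ B_j x ⊗ E_Lj. Thus P⁻P⁺ is the sum of
the E_Lj E_iL with coefficients A_i B_j, and P⁺P⁻ the sum of the E_iL E_Lj with coefficients B_j
A_i. The lemma becomes an identity of operators on K-types (`exists_cofK_eq`): cof_ij(u) equals c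
A_i B_j on V_λ and c B_j A_i on V_λ', with one non-zero c.

Both sides are tensor operators subject to the same first order relation: for the cofactors because
the minor vanishes, for the products because of the relation satisfied by A
(`vec_contract_eq_zero`). A tensor operator is determined by its diagonal entries between highest
weight vectors. The relation determines these from the r-th one, because the numbers λ_b - b are
distinct (`tensor_eq_zero_left`, `tensor_eq_zero_right`). For the cofactors the r-th one is an
explicit product `cofVal` that does not involve λ_r, hence is the same for λ and λ'.

If λ and λ' are both dominant the product is non-zero, and ι⁻ is rescaled by -c. If exactly one is
dominant the product has a zero factor, so the cofactors vanish, and C(u) acts by zero as the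
composition does. The constant is chosen before γ, and a given ι⁻ occurs for one pair (λ, λ') only,
so the choices do not conflict. The second identity is read on λ', where l_{k,n}(λ') + 1 = u. -/

namespace ShiftOps
noncomputable section

/-! ### Creation and annihilation operators; the top coefficient. -/

section fermions
variable {N : ℕ}

/-- The exterior algebra of `ℂ^N`. -/
abbrev Ext (N : ℕ) : Type := ExteriorAlgebra ℂ (Fin N → ℂ)

/-- The creation operator: exterior multiplication by the `i`-th basis vector. -/
def cre (i : Fin N) : Module.End ℂ (Ext N) :=
  LinearMap.mulLeft ℂ (ExteriorAlgebra.ι ℂ (Pi.single i (1 : ℂ) : Fin N → ℂ))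

/-- The annihilation operator: contraction with the `i`-th coordinate. -/
def ann (i : Fin N) : Module.End ℂ (Ext N) :=
  CliffordAlgebra.contractLeft (Q := (0 : QuadraticForm ℂ (Fin N → ℂ)))
    (LinearMap.proj i : (Fin N → ℂ) →ₗ[ℂ] ℂ)

theorem cre_mul_self (i : Fin N) : cre i * cre i = 0 := by
  refine LinearMap.ext fun x => ?_
  have h := ExteriorAlgebra.ι_sq_zero (R := ℂ) (Pi.single i (1 : ℂ) : Fin N → ℂ)
  simp only [cre, Module.End.mul_apply, LinearMap.mulLeft_apply, LinearMap.zero_apply]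
  rw [← mul_assoc, h, zero_mul]

theorem cre_anticomm (i j : Fin N) : cre i * cre j + cre j * cre i = 0 := by
  refine LinearMap.ext fun x => ?_
  have h := ExteriorAlgebra.ι_add_mul_swap (R := ℂ) (Pi.single i (1 : ℂ) : Fin N → ℂ)
    (Pi.single j (1 : ℂ))
  simp only [cre, Module.End.mul_apply, LinearMap.mulLeft_apply, LinearMap.zero_apply,
    LinearMap.add_apply]
  rw [← mul_assoc, ← mul_assoc, ← add_mul, h, zero_mul]

theorem ann_mul_self (i : Fin N) : ann i * ann i = 0 := by
  refine LinearMap.ext fun x => ?_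
  exact CliffordAlgebra.contractLeft_contractLeft (LinearMap.proj i : (Fin N → ℂ) →ₗ[ℂ] ℂ) x

theorem ann_mul_ann (i j : Fin N) : ann i * ann j = -(ann j * ann i) := by
  refine LinearMap.ext fun x => ?_
  exact CliffordAlgebra.contractLeft_comm (LinearMap.proj i : (Fin N → ℂ) →ₗ[ℂ] ℂ) (LinearMap.proj j) x

theorem ann_cre (i j : Fin N) : ann i * cre j + cre j * ann i = if i = j then 1 else 0 := by
  refine LinearMap.ext fun x => ?_
  have := CliffordAlgebra.contractLeft_ι_mul (Q := (0 : QuadraticForm ℂ (Fin N → ℂ)))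
    (LinearMap.proj i : (Fin N → ℂ) →ₗ[ℂ] ℂ) (Pi.single j (1 : ℂ)) x
  have e : (ann i * cre j + cre j * ann i) x =
      (LinearMap.proj i : (Fin N → ℂ) →ₗ[ℂ] ℂ) (Pi.single j (1 : ℂ)) • x := by
    rw [eq_sub_iff_add_eq] at this
    exact this
  rw [e]
  by_cases h : i = j
  · subst h; simp
  · simp [h]

theorem ann_one (i : Fin N) : ann i 1 = 0 := CliffordAlgebra.contractLeft_one 0
  (LinearMap.proj i : (Fin N → ℂ) →ₗ[ℂ] ℂ)

theorem ann_prod_ann (a : Fin N) (l : List (Fin N)) : ann a * (l.map ann).prod * ann a = 0 := by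
  induction l with
  | nil => simpa using ann_mul_self a
  | cons b l ih =>
    rw [List.map_cons, List.prod_cons, ← mul_assoc, ann_mul_ann a b, neg_mul, neg_mul, mul_assoc,
      mul_assoc, ← mul_assoc (ann a), ih, mul_zero, neg_zero]

theorem prod_ann_mul_ann {a : Fin N} {l : List (Fin N)} (h : a ∈ l) :
    (l.map ann).prod * ann a = 0 := by
  induction l with
  | nil => simp at h
  | cons b l ih =>
    rcases List.mem_cons.1 h with rfl | h
    · exact ann_prod_ann a l
    · rw [List.map_cons, List.prod_cons, mul_assoc, ih h, mul_zero]

theorem ann_prod_cre {a : Fin N} {l : List (Fin N)} (h : a ∉ l) :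
    ann a ((l.map cre).prod 1) = 0 := by
  induction l with
  | nil => exact ann_one a
  | cons b l ih =>
    have e := ann_cre a b
    rw [if_neg (fun e' => h (by rw [e']; exact List.mem_cons_self)), add_eq_zero_iff_eq_neg] at e
    have := LinearMap.congr_fun e ((l.map cre).prod 1)
    rw [List.map_cons, List.prod_cons]
    refine this.trans ?_
    change -(cre b (ann a _)) = 0
    rw [ih fun h' => h (List.mem_cons_of_mem _ h'), map_zero, neg_zero]

/-- The innermost annihilator meets the creator of the same index and cancels it. This normalizes
`topCoeff`. -/
theorem prod_ann_prod_cre (l : List (Fin N)) (h : l.Nodup) :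
    (l.map ann).prod ((l.reverse.map cre).prod 1) = (1 : Ext N) := by
  induction l using List.reverseRecOn with
  | nil => rfl
  | append_singleton l a ih =>
    obtain ⟨h1, -, h2⟩ := List.nodup_append.1 h
    have ha : a ∉ l.reverse := fun h' => h2 a (List.mem_reverse.1 h') a List.mem_cons_self rfl
    have e := LinearMap.congr_fun (ann_cre a a) ((l.reverse.map cre).prod 1)
    rw [if_pos rfl] at e
    change ann a (cre a _) + cre a (ann a _) = _ at e
    rw [ann_prod_cre ha, map_zero, add_zero] at e
    rw [List.reverse_append, List.map_append, List.map_append, List.prod_append, List.prod_append]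
    simp only [List.map_cons, List.map_nil, List.reverse_cons, List.reverse_nil, List.nil_append,
      List.prod_cons, List.prod_nil, mul_one, Module.End.mul_apply]
    rw [e]
    exact ih h1

/-- The top coefficient of `T 1`, normalized to be `1` on `e_{N-1} ⋯ e_0`. -/
def topCoeff (N : ℕ) : Module.End ℂ (Ext N) →ₗ[ℂ] ℂ where
  toFun T := ExteriorAlgebra.algebraMapInv ((((List.finRange N).map ann).prod * T) 1)
  map_add' S T := by simp [mul_add]
  map_smul' c T := by simp

/-- The product of all annihilators already contains `ann a`. With the next lemma, annihilators
disappear at both ends under `topCoeff`; `qdet_comm` and `qdet_snoc_inr` rest on this. -/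
theorem topCoeff_ann_mul (a : Fin N) (T : Module.End ℂ (Ext N)) : topCoeff N (ann a * T) = 0 := by
  change ExteriorAlgebra.algebraMapInv ((_ * (_ * T)) 1) = 0
  rw [← mul_assoc, prod_ann_mul_ann (List.mem_finRange a), zero_mul]
  exact map_zero _

theorem topCoeff_mul_ann (a : Fin N) (T : Module.End ℂ (Ext N)) : topCoeff N (T * ann a) = 0 := by
  change ExteriorAlgebra.algebraMapInv (((List.finRange N).map ann).prod (T (ann a 1))) = 0
  rw [ann_one, map_zero, map_zero, map_zero]

theorem topCoeff_prod_cre :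
    topCoeff N (List.ofFn fun q : Fin N => cre q.rev).prod = 1 := by
  have : (List.ofFn fun q : Fin N => cre q.rev) = (List.finRange N).reverse.map cre := by
    rw [List.finRange_reverse, List.map_map, List.ofFn_eq_map]
    rfl
  rw [this]
  change ExteriorAlgebra.algebraMapInv (((List.finRange N).map ann).prod
    (((List.finRange N).reverse.map cre).prod 1)) = 1
  rw [prod_ann_prod_cre _ (List.nodup_finRange N), map_one]

theorem prod_cre_one {k : ℕ} (f : Fin k → Fin N) :
    (List.ofFn fun q => cre (f q)).prod 1 =
      ExteriorAlgebra.ιMulti ℂ k (fun q => (Pi.single (f q) (1 : ℂ) : Fin N → ℂ)) := by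
  rw [ExteriorAlgebra.ιMulti_apply]
  induction k with
  | zero => simp
  | succ k ih =>
    rw [List.ofFn_succ, List.ofFn_succ, List.prod_cons, List.prod_cons, ← ih fun q => f q.succ]
    rfl

theorem topCoeff_eq (T : Module.End ℂ (Ext N)) : topCoeff N T =
    ExteriorAlgebra.algebraMapInv (((List.finRange N).map ann).prod (T 1)) := rfl

theorem topCoeff_prod_cre_perm (σ : Equiv.Perm (Fin N)) :
    topCoeff N (List.ofFn fun q : Fin N => cre (σ q.rev)).prod = ((Equiv.Perm.sign σ : ℤ) : ℂ) := by
  have h := topCoeff_prod_cre (N := N)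
  rw [topCoeff_eq, prod_cre_one] at h
  rw [topCoeff_eq, prod_cre_one]
  -- The factors are listed in decreasing order, so σ enters conjugated by the reversal, which
  -- leaves its sign unchanged.
  let τ : Equiv.Perm (Fin N) := Fin.revPerm.trans (σ.trans Fin.revPerm)
  have hτ : Equiv.Perm.sign τ = Equiv.Perm.sign σ := by
    change Equiv.Perm.sign (Fin.revPerm * σ * Fin.revPerm) = _
    rw [Equiv.Perm.sign_mul, Equiv.Perm.sign_mul, mul_comm, ← mul_assoc, ← Equiv.Perm.sign_mul]
    have : (Fin.revPerm * Fin.revPerm : Equiv.Perm (Fin N)) = 1 := by ext q; simp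
    rw [this]; simp
  have e : (fun q : Fin N => (Pi.single (σ q.rev) (1 : ℂ) : Fin N → ℂ)) =
      (fun q : Fin N => (Pi.single q.rev (1 : ℂ) : Fin N → ℂ)) ∘ τ := by
    funext q
    simp [τ]
  rw [e, AlternatingMap.map_perm, hτ]
  rw [Units.smul_def, map_zsmul, map_zsmul, h]
  simp

theorem topCoeff_prod_cre_of_not_injective {f : Fin N → Fin N} (hf : ¬Function.Injective f) :
    topCoeff N (List.ofFn fun q : Fin N => cre (f q)).prod = 0 := by
  rw [topCoeff_eq, prod_cre_one, AlternatingMap.map_eq_zero_of_not_injective, map_zero, map_zero]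
  intro h
  refine hf fun a b hab => h ?_
  simp [hab]

end fermions

/-! ### Fermionic operators with coefficients in an algebra. -/

section fock
variable {N : ℕ} {A B : Type*} [Ring A] [Algebra ℂ A] [Ring B] [Algebra ℂ B]

/-- Operators on the exterior algebra of `ℂ^N` with coefficients in `A`. -/
abbrev PreFock (N : ℕ) (A : Type*) [Ring A] [Algebra ℂ A] : Type _ := Module.End ℂ (Ext N) ⊗[ℂ] A

variable (A) in
/-- Creation operators. -/
def pfe (i : Fin N) : PreFock N A := cre i ⊗ₜ 1
variable (A) in
/-- Annihilation operators. -/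
def pfd (i : Fin N) : PreFock N A := ann i ⊗ₜ 1
variable (N) in
/-- Coefficients. -/
def pinc : A →ₐ[ℂ] PreFock N A := Algebra.TensorProduct.includeRight

theorem pre_fe_anticomm (i j : Fin N) : pfe A i * pfe A j + pfe A j * pfe A i = 0 := by
  simp only [pfe, Algebra.TensorProduct.tmul_mul_tmul, ← TensorProduct.add_tmul, cre_anticomm,
    TensorProduct.zero_tmul]

theorem pre_fe_mul_self (i : Fin N) : pfe A i * pfe A i = 0 := by
  simp only [pfe, Algebra.TensorProduct.tmul_mul_tmul, cre_mul_self, TensorProduct.zero_tmul]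

theorem pre_fd_mul_fe (i j : Fin N) : pfd A i * pfe A j + pfe A j * pfd A i = (if i = j then 1 else 0) := by
  simp only [pfe, pfd, Algebra.TensorProduct.tmul_mul_tmul, ← TensorProduct.add_tmul, ann_cre]
  split_ifs
  · rw [mul_one]; rfl
  · exact TensorProduct.zero_tmul _ _

theorem pre_inc_mul_fe (x : A) (i : Fin N) : pinc N x * pfe A i = pfe A i * pinc N x := by
  simp [pinc, pfe, Algebra.TensorProduct.tmul_mul_tmul]

theorem pre_inc_mul_fd (x : A) (i : Fin N) : pinc N x * pfd A i = pfd A i * pinc N x := by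
  simp [pinc, pfd, Algebra.TensorProduct.tmul_mul_tmul]

variable (N A) in
/-- The top coefficient of the value at `1`. -/
def ptau : PreFock N A →ₗ[ℂ] A :=
  (TensorProduct.lid ℂ A).toLinearMap ∘ₗ TensorProduct.map (topCoeff N) LinearMap.id

theorem pre_tau_tmul (T : Module.End ℂ (Ext N)) (x : A) : ptau N A (T ⊗ₜ x) = topCoeff N T • x := by
  simp [ptau]

theorem pre_tau_inc_mul (x : A) (X : PreFock N A) : ptau N A (pinc N x * X) = x * ptau N A X := by
  induction X using TensorProduct.induction_on with
  | zero => simp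
  | add a b ha hb => simp [mul_add, ha, hb]
  | tmul T y => simp [pinc, Algebra.TensorProduct.tmul_mul_tmul, pre_tau_tmul]

theorem pre_tau_mul_inc (x : A) (X : PreFock N A) : ptau N A (X * pinc N x) = ptau N A X * x := by
  induction X using TensorProduct.induction_on with
  | zero => simp
  | add a b ha hb => simp [add_mul, ha, hb]
  | tmul T y => simp [pinc, Algebra.TensorProduct.tmul_mul_tmul, pre_tau_tmul]

theorem pre_tau_fd_mul (a : Fin N) (X : PreFock N A) : ptau N A (pfd A a * X) = 0 := by
  induction X using TensorProduct.induction_on with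
  | zero => simp
  | add a b ha hb => simp [mul_add, ha, hb]
  | tmul T y => simp [pfd, Algebra.TensorProduct.tmul_mul_tmul, pre_tau_tmul, topCoeff_ann_mul]

theorem pre_tau_mul_fd (a : Fin N) (X : PreFock N A) : ptau N A (X * pfd A a) = 0 := by
  induction X using TensorProduct.induction_on with
  | zero => simp
  | add a b ha hb => simp [add_mul, ha, hb]
  | tmul T y => simp [pfd, Algebra.TensorProduct.tmul_mul_tmul, pre_tau_tmul, topCoeff_mul_ann]

variable (N) in
/-- Change of coefficients. -/
def preFockMap (f : A →ₐ[ℂ] B) : PreFock N A →ₐ[ℂ] PreFock N B :=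
  Algebra.TensorProduct.map (AlgHom.id ℂ _) f

theorem pre_fockMap_fe (f : A →ₐ[ℂ] B) (i : Fin N) : preFockMap N f (pfe A i) = pfe B i := by
  simp [preFockMap, pfe]

theorem pre_fockMap_inc (f : A →ₐ[ℂ] B) (x : A) : preFockMap N f (pinc N x) = pinc N (f x) := by
  simp [preFockMap, pinc]

theorem pre_tau_fockMap (f : A →ₐ[ℂ] B) (X : PreFock N A) :
    ptau N B (preFockMap N f X) = f (ptau N A X) := by
  induction X using TensorProduct.induction_on with
  | zero => simp
  | add a b ha hb => simp [ha, hb]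
  | tmul T y => simp [preFockMap, pre_tau_tmul]

theorem pre_prod_fe {k : ℕ} (f : Fin k → Fin N) :
    (List.ofFn fun q => pfe A (f q)).prod = (List.ofFn fun q => cre (f q)).prod ⊗ₜ 1 := by
  induction k with
  | zero => rfl
  | succ k ih =>
    rw [List.ofFn_succ, List.ofFn_succ, List.prod_cons, List.prod_cons, ih, pfe,
      Algebra.TensorProduct.tmul_mul_tmul, mul_one]


variable (N A) in
/-- The ring `PreFock N A`, sealed. -/
def Fock : Type _ := PreFock N A

instance : Ring (Fock N A) := inferInstanceAs (Ring (PreFock N A))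
instance : Algebra ℂ (Fock N A) := inferInstanceAs (Algebra ℂ (PreFock N A))

variable (A) in
/-- Creation operators. -/
def fe (i : Fin N) : Fock N A := pfe A i
variable (A) in
/-- Annihilation operators. -/
def fd (i : Fin N) : Fock N A := pfd A i
variable (N) in
/-- Coefficients. -/
def inc : A →ₐ[ℂ] Fock N A := pinc N
variable (N A) in
/-- The top coefficient of the value at `1`. -/
def tau : Fock N A →ₗ[ℂ] A := ptau N A
variable (N) in
/-- Change of coefficients. -/
def fockMap (f : A →ₐ[ℂ] B) : Fock N A →ₐ[ℂ] Fock N B := preFockMap N f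

theorem fe_anticomm (i j : Fin N) : fe A i * fe A j = -(fe A j * fe A i) :=
  eq_neg_of_add_eq_zero_left (pre_fe_anticomm i j)
theorem fe_mul_self (i : Fin N) : fe A i * fe A i = 0 := pre_fe_mul_self i
theorem fd_mul_fe (i j : Fin N) : fd A i * fe A j = (if i = j then 1 else 0) - fe A j * fd A i :=
  eq_sub_of_add_eq (pre_fd_mul_fe i j)
theorem inc_mul_fe (x : A) (i : Fin N) : inc N x * fe A i = fe A i * inc N x := pre_inc_mul_fe x i
theorem inc_mul_fd (x : A) (i : Fin N) : inc N x * fd A i = fd A i * inc N x := pre_inc_mul_fd x i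
theorem tau_inc_mul (x : A) (X : Fock N A) : tau N A (inc N x * X) = x * tau N A X :=
  pre_tau_inc_mul x X
theorem tau_mul_inc (x : A) (X : Fock N A) : tau N A (X * inc N x) = tau N A X * x :=
  pre_tau_mul_inc x X
theorem tau_fd_mul (a : Fin N) (X : Fock N A) : tau N A (fd A a * X) = 0 := pre_tau_fd_mul a X
theorem tau_mul_fd (a : Fin N) (X : Fock N A) : tau N A (X * fd A a) = 0 := pre_tau_mul_fd a X
theorem fockMap_fe (f : A →ₐ[ℂ] B) (i : Fin N) : fockMap N f (fe A i) = fe B i := pre_fockMap_fe f i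
theorem fockMap_inc (f : A →ₐ[ℂ] B) (x : A) : fockMap N f (inc N x) = inc N (f x) :=
  pre_fockMap_inc f x
theorem tau_fockMap (f : A →ₐ[ℂ] B) (X : Fock N A) : tau N B (fockMap N f X) = f (tau N A X) :=
  pre_tau_fockMap f X
theorem tau_prod_fe (f : Fin N → Fin N) : tau N A (List.ofFn fun q => fe A (f q)).prod =
    algebraMap ℂ A (topCoeff N (List.ofFn fun q => cre (f q)).prod) := by
  rw [Algebra.algebraMap_eq_smul_one]
  exact (congrArg (ptau N A) (pre_prod_fe f)).trans (pre_tau_tmul _ _)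

end fock
end
end ShiftOps

namespace ShiftOps
noncomputable section

/-! ### Columns as odd elements; words in shifted columns are alternating. -/

section words
variable {N : ℕ} {C A B : Type*} [DecidableEq C] [Ring A] [Algebra ℂ A] [Ring B] [Algebra ℂ B]

/-- The commutation relations of `gl_N` for the columns indexed by `C` of a matrix with `N` rows. -/
def GlRel (M : Fin N → C → A) (c : C → Fin N) : Prop :=
  ∀ i j k l, M i j * M k l - M k l * M i j =
    (if c j = k then M i l else 0) - (if c l = i then M k j else 0)

variable (M : Fin N → C → A) (c : C → Fin N)

/-- The column `j` as an odd element. -/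
def oddCol (j : C) : Fock N A := ∑ i, fe A i * inc N (M i j)

/-- The odd element attached to a letter: `inl j` is the column `j` of `M` with `v` added to the
diagonal entry, `inr i` is the `i`-th standard basis vector. -/
def letter : C ⊕ Fin N → ℂ → Fock N A
  | Sum.inl j, v => oddCol M j + v • fe A (c j)
  | Sum.inr i, _ => fe A i

/-- `1` for columns and `0` for basis vectors. -/
def isCol : C ⊕ Fin N → ℕ := Sum.elim (fun _ => 1) (fun _ => 0)

/-- The number of columns of a word. -/
def ncol {k : ℕ} (w : Fin k → C ⊕ Fin N) : ℕ := ∑ p, isCol (w p)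

/-- The product of the letters of a word; a column is shifted by `u` plus the number of columns
to the right of it. -/
def word : (k : ℕ) → (Fin k → C ⊕ Fin N) → ℂ → Fock N A
  | 0, _, _ => 1
  | k + 1, w, u => letter M c (w 0) (u + ncol (Fin.tail w)) * word k (Fin.tail w) u

variable {M c}

theorem fe_oddCol (i : Fin N) (j : C) : fe A i * oddCol M j = -(oddCol M j * fe A i) := by
  simp only [oddCol, Finset.mul_sum, Finset.sum_mul, ← Finset.sum_neg_distrib]
  refine Finset.sum_congr rfl fun a _ => ?_
  rw [mul_assoc, inc_mul_fe, ← mul_assoc, ← mul_assoc, fe_anticomm i a, neg_mul]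

theorem fd_oddCol (a : Fin N) (j : C) :
    fd A a * oddCol M j = inc N (M a j) - oddCol M j * fd A a := by
  simp only [oddCol, Finset.mul_sum, Finset.sum_mul]
  have : ∀ i, fd A a * (fe A i * inc N (M i j)) =
      (if a = i then inc N (M i j) else 0) - fe A i * inc N (M i j) * fd A a := by
    intro i
    rw [← mul_assoc, fd_mul_fe, sub_mul, mul_assoc _ _ (fd A a), inc_mul_fd, mul_assoc]
    split_ifs <;> simp
  simp [this]

/-- The anticommutator of two columns collects the commutators of their entries, and the relations
of gl_N make these linear in the columns. -/
theorem oddCol_oddCol (h : GlRel M c) (i j : C) : oddCol M i * oddCol M j =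
    -(oddCol M j * oddCol M i) - (fe A (c i) * oddCol M j + fe A (c j) * oddCol M i) := by
  have e1 : oddCol M i * oddCol M j + oddCol M j * oddCol M i =
      ∑ a, ∑ b, fe A a * fe A b * inc N (M a i * M b j - M b j * M a i) := by
    have t1 : oddCol M i * oddCol M j = ∑ a, ∑ b, fe A a * fe A b * inc N (M a i * M b j) := by
      simp only [oddCol, Finset.sum_mul_sum]
      refine Finset.sum_congr rfl fun a _ => Finset.sum_congr rfl fun b _ => ?_
      rw [map_mul, mul_assoc, ← mul_assoc (inc N (M a i)), inc_mul_fe]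
      simp only [mul_assoc]
    have t2 : oddCol M j * oddCol M i = ∑ a, ∑ b, -(fe A a * fe A b * inc N (M b j * M a i)) := by
      simp only [oddCol, Finset.sum_mul_sum]
      rw [Finset.sum_comm]
      refine Finset.sum_congr rfl fun a _ => Finset.sum_congr rfl fun b _ => ?_
      rw [map_mul, mul_assoc, ← mul_assoc (inc N (M b j)), inc_mul_fe, fe_anticomm a b]
      simp only [mul_assoc, neg_mul, neg_neg]
    rw [t1, t2, ← Finset.sum_add_distrib]
    refine Finset.sum_congr rfl fun a _ => ?_
    rw [← Finset.sum_add_distrib]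
    refine Finset.sum_congr rfl fun b _ => ?_
    rw [map_sub, mul_sub, sub_eq_add_neg]
  have e2 : ∑ a, ∑ b, fe A a * fe A b * inc N (M a i * M b j - M b j * M a i) =
      oddCol M j * fe A (c i) + oddCol M i * fe A (c j) := by
    simp only [h _ i _ j, map_sub, mul_sub, Finset.sum_sub_distrib]
    rw [sub_eq_add_neg]
    congr 1
    · simp only [oddCol, Finset.sum_mul]
      refine Finset.sum_congr rfl fun a _ => ?_
      rw [Finset.sum_eq_single (c i)]
      · rw [if_pos rfl, mul_assoc, mul_assoc, inc_mul_fe]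
      · intro b _ hb; rw [if_neg hb.symm, map_zero, mul_zero]
      · simp
    · rw [Finset.sum_comm, ← Finset.sum_neg_distrib]
      simp only [oddCol, Finset.sum_mul]
      refine Finset.sum_congr rfl fun a _ => ?_
      rw [Finset.sum_eq_single (c j)]
      · rw [if_pos rfl, fe_anticomm, neg_mul, neg_neg, mul_assoc, mul_assoc, inc_mul_fe]
      · intro b _ hb; rw [if_neg hb.symm, map_zero, mul_zero]
      · simp
  rw [e2] at e1
  rw [fe_oddCol, fe_oddCol, eq_sub_of_add_eq e1]
  abel

theorem fe_letter (i : Fin N) (x : C ⊕ Fin N) (v : ℂ) :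
    fe A i * letter M c x v = -(letter M c x v * fe A i) := by
  cases x with
  | inl j =>
    simp only [letter, mul_add, add_mul, fe_oddCol, mul_smul_comm, smul_mul_assoc,
      fe_anticomm i (c j), smul_neg, neg_add]
  | inr j => exact fe_anticomm i j

/-- For two columns, the linear terms of `oddCol_oddCol` are exactly what the unit difference
between the two shifts compensates. Basis vectors simply anticommute with everything, so they do not
change the shift. -/
theorem letter_swap (h : GlRel M c) (x y : C ⊕ Fin N) (v : ℂ) :
    letter M c x (v + isCol y) * letter M c y v =
      -(letter M c y (v + isCol x) * letter M c x v) := by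
  cases x with
  | inr i =>
    change fe A i * letter M c y v = -(letter M c y (v + (0 : ℕ)) * fe A i)
    rw [fe_letter, Nat.cast_zero, add_zero]
  | inl i =>
    cases y with
    | inr j =>
      change letter M c (Sum.inl i) (v + (0 : ℕ)) * fe A j = -(fe A j * letter M c (Sum.inl i) v)
      rw [fe_letter, Nat.cast_zero, add_zero, neg_neg]
    | inl j =>
      change (oddCol M i + (v + (1 : ℕ)) • fe A (c i)) * (oddCol M j + v • fe A (c j)) =
        -((oddCol M j + (v + (1 : ℕ)) • fe A (c j)) * (oddCol M i + v • fe A (c i)))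
      simp only [mul_add, add_mul, mul_smul_comm, smul_mul_assoc, oddCol_oddCol h i j,
        fe_oddCol, fe_anticomm (c i) (c j), Nat.cast_one]
      module

theorem ncol_succ {k : ℕ} (w : Fin (k + 1) → C ⊕ Fin N) :
    ncol w = isCol (w 0) + ncol (Fin.tail w) := Fin.sum_univ_succ _

theorem ncol_comp {k : ℕ} (w : Fin k → C ⊕ Fin N) (σ : Equiv.Perm (Fin k)) :
    ncol (w ∘ σ) = ncol w := Equiv.sum_comp σ fun p => isCol (w p)

theorem tail_swap {X : Type*} {k : ℕ} (w : Fin (k + 2) → X) (i : Fin k) :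
    Fin.tail (w ∘ Equiv.swap i.succ.castSucc i.succ.succ) =
      Fin.tail w ∘ Equiv.swap i.castSucc i.succ := by
  funext p
  change w (Equiv.swap i.castSucc.succ i.succ.succ p.succ) = w (Equiv.swap i.castSucc i.succ p).succ
  congr 1
  exact (Function.Injective.swap_apply (Fin.succ_injective _) _ _ _)

/-- Each shift counts the columns to the right, so exchanging neighbours changes only their own two
shifts, in the way `letter_swap` requires. -/
theorem word_swap (h : GlRel M c) {k : ℕ} (w : Fin (k + 1) → C ⊕ Fin N) (i : Fin k) (u : ℂ) :
    word M c (k + 1) (w ∘ Equiv.swap i.castSucc i.succ) u = -word M c (k + 1) w u := by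
  induction k with
  | zero => exact i.elim0
  | succ k ih =>
    cases i using Fin.cases with
    | zero =>
      have t : Fin.tail (Fin.tail (w ∘ Equiv.swap (Fin.castSucc 0) (Fin.succ 0))) =
          Fin.tail (Fin.tail w) := by
        funext p
        change w (Equiv.swap _ _ p.succ.succ) = w p.succ.succ
        rw [Equiv.swap_apply_of_ne_of_ne]
        · exact (Fin.succ_ne_zero _)
        · exact fun e => Fin.succ_ne_zero _ (Fin.succ_injective _ e)
      have t0 : (w ∘ Equiv.swap (Fin.castSucc 0) (Fin.succ 0)) 0 = w 1 := by
        change w (Equiv.swap 0 1 0) = _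
        rw [Equiv.swap_apply_left]
      have t1 : Fin.tail (w ∘ Equiv.swap (Fin.castSucc 0) (Fin.succ 0)) 0 = w 0 := by
        change w (Equiv.swap 0 1 1) = _
        rw [Equiv.swap_apply_right]
      rw [word, word, word, word, ncol_succ, ncol_succ, t, t0, t1]
      change _ = -(letter M c (w 0) (u + (isCol (w 1) + _ : ℕ)) * (letter M c (w 1) _ * _))
      rw [← mul_assoc, ← mul_assoc, ← neg_mul]
      congr 1
      have := letter_swap h (w 1) (w 0) (u + (ncol (Fin.tail (Fin.tail w)) : ℂ))
      rw [← this.symm.trans (by push_cast; congr 2; ring_nf : _ =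
        letter M c (w 1) (u + (isCol (w 0) + ncol (Fin.tail (Fin.tail w)) : ℕ)) *
          letter M c (w 0) (u + (ncol (Fin.tail (Fin.tail w)) : ℂ)))]
      push_cast; congr 3; ring
    | succ i =>
      have t0 : (w ∘ Equiv.swap i.succ.castSucc i.succ.succ) 0 = w 0 := by
        change w (Equiv.swap _ _ 0) = _
        rw [Equiv.swap_apply_of_ne_of_ne]
        · exact (Fin.succ_ne_zero i.castSucc).symm
        · exact (Fin.succ_ne_zero _).symm
      rw [word.eq_2, word.eq_2 M c u (k + 1) w, tail_swap, ih, ncol_comp, t0, mul_neg]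

theorem word_perm (h : GlRel M c) {k : ℕ} (w : Fin k → C ⊕ Fin N) (σ : Equiv.Perm (Fin k)) (u : ℂ) :
    word M c k (w ∘ σ) u = (Equiv.Perm.sign σ : ℤ) • word M c k w u := by
  cases k with
  | zero => rw [Subsingleton.elim σ 1]; simp
  | succ k =>
    have hσ : σ ∈ Submonoid.closure (Set.range fun i : Fin k => Equiv.swap i.castSucc i.succ) := by
      rw [Equiv.Perm.mclosure_swap_castSucc_succ]; trivial
    induction hσ using Submonoid.closure_induction generalizing w with
    | mem x hx =>
      obtain ⟨i, rfl⟩ := hx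
      rw [word_swap h, Equiv.Perm.sign_swap (Fin.castSucc_lt_succ).ne]
      simp
    | one => simp
    | mul x y _ _ hx hy =>
      rw [Equiv.Perm.coe_mul, ← Function.comp_assoc, hy, hx, Equiv.Perm.sign_mul, mul_comm]
      simp [mul_smul]

theorem word_last {k : ℕ} (w : Fin (k + 1) → C ⊕ Fin N) (u : ℂ) : word M c (k + 1) w u =
    word M c k (Fin.init w) (u + isCol (w (Fin.last k))) * letter M c (w (Fin.last k)) u := by
  induction k with
  | zero => simp [word, ncol]
  | succ k ih =>
    rw [word, ih, word]
    have t : Fin.tail (Fin.init w) = Fin.init (Fin.tail w) := rfl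
    have t0 : Fin.init w 0 = w 0 := rfl
    have t1 : Fin.tail w (Fin.last k) = w (Fin.last (k + 1)) := rfl
    have t2 : ncol (Fin.tail w) = ncol (Fin.init (Fin.tail w)) + isCol (w (Fin.last (k + 1))) :=
      Fin.sum_univ_castSucc _
    rw [t, t0, t1, t2, mul_assoc]
    push_cast
    congr 2
    ring

/-- The index of a letter. -/
def idx (c : C → Fin N) : C ⊕ Fin N → Fin N := Sum.elim c id

/-- The letter of the same kind with another index. -/
def reindex (c : C → Fin N) (b : C) : C ⊕ Fin N → C ⊕ Fin N
  | Sum.inl _ => Sum.inl b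
  | Sum.inr _ => Sum.inr (c b)

theorem isCol_reindex (b : C) (x : C ⊕ Fin N) : isCol (reindex c b x) = isCol x := by
  cases x <;> rfl

variable (M c) in
/-- The element whose commutator acts on letters as minus a matrix unit. -/
def totalE (a : Fin N) (b : C) : Fock N A := inc N (M a b) - fe A (c b) * fd A a

theorem totalE_fe (a : Fin N) (b : C) (k : Fin N) : totalE M c a b * fe A k =
    fe A k * totalE M c a b - if a = k then fe A (c b) else 0 := by
  simp only [totalE, sub_mul, mul_sub, inc_mul_fe, mul_assoc, fd_mul_fe]
  rw [← mul_assoc, ← mul_assoc (fe A k) (fe A (c b)), fe_anticomm k (c b)]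
  split_ifs
  · simp only [mul_sub, mul_one, neg_mul, mul_assoc]; abel
  · simp

/-- The commutator with M_ab changes a row index and a column index. The fermionic bilinear in
`totalE` cancels the change of the row index, so only the replacement of column `c j = a` by column
`b` survives. -/
theorem totalE_oddCol (h : GlRel M c) (a : Fin N) (b j : C) : totalE M c a b * oddCol M j =
    oddCol M j * totalE M c a b - if a = c j then oddCol M b else 0 := by
  have e1 : inc N (M a b) * oddCol M j = oddCol M j * inc N (M a b) +
      fe A (c b) * inc N (M a j) - if a = c j then oddCol M b else 0 := by
    have : ∀ i, inc N (M a b) * (fe A i * inc N (M i j)) = fe A i * inc N (M i j) * inc N (M a b) +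
        (if c b = i then fe A i * inc N (M a j) else 0) -
        if c j = a then fe A i * inc N (M i b) else 0 := by
      intro i
      rw [← mul_assoc, inc_mul_fe, mul_assoc, mul_assoc, ← map_mul, ← map_mul,
        eq_add_of_sub_eq (h a b i j)]
      split_ifs <;> simp [mul_add, mul_sub] <;> abel
    simp only [oddCol, Finset.mul_sum, Finset.sum_mul, this, Finset.sum_add_distrib,
      Finset.sum_sub_distrib]
    by_cases hc : a = c j
    · simp [hc]
    · simp [hc, Ne.symm hc]
  simp only [totalE, sub_mul, mul_sub, e1, mul_assoc, fd_oddCol]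
  rw [← mul_assoc, ← mul_assoc (oddCol M j) (fe A (c b)), fe_oddCol, neg_mul]
  abel

theorem totalE_letter (h : GlRel M c) (a : Fin N) (b : C) (x : C ⊕ Fin N) (v : ℂ) :
    totalE M c a b * letter M c x v = letter M c x v * totalE M c a b -
      if a = idx c x then letter M c (reindex c b x) v else 0 := by
  cases x with
  | inr k => exact totalE_fe a b k
  | inl j =>
    change _ * (_ + _) = (_ + _) * _ - if a = c j then (oddCol M b + _) else 0
    rw [mul_add, totalE_oddCol h, mul_smul_comm, totalE_fe, add_mul, smul_mul_assoc]
    split_ifs <;> simp [smul_sub]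
    abel

theorem ncol_update {k : ℕ} (w : Fin k → C ⊕ Fin N) (p : Fin k) (y : C ⊕ Fin N)
    (hy : isCol y = isCol (w p)) : ncol (Function.update w p y) = ncol w := by
  refine Finset.sum_congr rfl fun q _ => ?_
  by_cases hq : q = p
  · subst hq; rw [Function.update_self, hy]
  · rw [Function.update_of_ne hq]

/-- Leibniz rule over the letters. Replacing a letter by one of the same kind keeps the number of
columns, hence all shifts. -/
theorem word_totalE (h : GlRel M c) (a : Fin N) (b : C) {k : ℕ} (w : Fin k → C ⊕ Fin N) (u : ℂ) :
    totalE M c a b * word M c k w u = word M c k w u * totalE M c a b -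
      ∑ p, if a = idx c (w p) then word M c k (Function.update w p (reindex c b (w p))) u else 0 := by
  induction k with
  | zero => simp [word]
  | succ k ih =>
    rw [Fin.sum_univ_succ, word, ← mul_assoc, totalE_letter h, sub_mul, mul_assoc, ih, mul_sub,
      ← mul_assoc, Finset.mul_sum]
    have e0 : (if a = idx c (w 0) then
        word M c (k + 1) (Function.update w 0 (reindex c b (w 0))) u else 0) =
        (if a = idx c (w 0) then letter M c (reindex c b (w 0)) (u + ncol (Fin.tail w)) else 0) *
          word M c k (Fin.tail w) u := by
      split_ifs
      · rw [word, Fin.tail_update_zero, Function.update_self]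
      · rw [zero_mul]
    have e1 : ∀ p : Fin k, (if a = idx c (w p.succ) then
        word M c (k + 1) (Function.update w p.succ (reindex c b (w p.succ))) u else 0) =
        letter M c (w 0) (u + ncol (Fin.tail w)) * (if a = idx c (Fin.tail w p) then
          word M c k (Function.update (Fin.tail w) p (reindex c b (Fin.tail w p))) u else 0) := by
      intro p
      change (if a = idx c (Fin.tail w p) then _ else _) = _
      split_ifs
      · rw [word, Fin.tail_update_succ, Function.update_of_ne (Fin.succ_ne_zero p).symm]
        change letter M c (w 0) (u + ncol (Function.update (Fin.tail w) p
          (reindex c b (Fin.tail w p)))) * _ = _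
        rw [ncol_update _ _ _ (isCol_reindex _ _)]
        rfl
      · rw [mul_zero]
    simp only [e0, e1]
    abel

end words
end
end ShiftOps

namespace ShiftOps
noncomputable section

/-! ### Quantum determinants: alternation, expansions, commutators. -/

section qdet
variable {N : ℕ} {C A B : Type*} [DecidableEq C] [Ring A] [Algebra ℂ A] [Ring B] [Algebra ℂ B]

variable (M : Fin N → C → A) (c : C → Fin N)

/-- The quantum determinant of the matrix with the columns `W q`, `q : Fin N`; a column is shifted by
`u` plus the number of columns of `M` with a smaller label. -/
def qdet (W : Fin N → C ⊕ Fin N) (u : ℂ) : A := tau N A (word M c N (W ∘ Fin.rev) u)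

/-- The entry of a shifted column. -/
def entry (i : Fin N) (b : C) (v : ℂ) : A := M i b + algebraMap ℂ A (if i = c b then v else 0)

variable {M c}

theorem qdet_perm (h : GlRel M c) (W : Fin N → C ⊕ Fin N) (σ : Equiv.Perm (Fin N)) (u : ℂ) :
    qdet M c (W ∘ σ) u = (Equiv.Perm.sign σ : ℤ) • qdet M c W u := by
  have e : (W ∘ σ) ∘ Fin.rev = (W ∘ Fin.rev) ∘ (Fin.revPerm * σ * Fin.revPerm : Equiv.Perm (Fin N)) := by
    funext p; simp
  have hs : Equiv.Perm.sign (Fin.revPerm * σ * Fin.revPerm : Equiv.Perm (Fin N)) =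
      Equiv.Perm.sign σ := by
    rw [Equiv.Perm.sign_mul, Equiv.Perm.sign_mul, mul_comm, ← mul_assoc, ← Equiv.Perm.sign_mul]
    have : (Fin.revPerm * Fin.revPerm : Equiv.Perm (Fin N)) = 1 := by ext q; simp
    rw [this]; simp
  rw [qdet, e, word_perm h, hs, map_zsmul]
  rfl

theorem qdet_swap (h : GlRel M c) (W : Fin N → C ⊕ Fin N) {p q : Fin N} (hpq : p ≠ q) (u : ℂ) :
    qdet M c (W ∘ Equiv.swap p q) u = -qdet M c W u := by
  rw [qdet_perm h, Equiv.Perm.sign_swap hpq]; simp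

theorem qdet_eq_zero (h : GlRel M c) {W : Fin N → C ⊕ Fin N} {p q : Fin N} (hpq : p ≠ q)
    (hW : W p = W q) (u : ℂ) : qdet M c W u = 0 := by
  have e := qdet_swap h W hpq u
  have e2 : W ∘ Equiv.swap p q = W := by
    funext r
    change W (Equiv.swap p q r) = W r
    rw [Equiv.swap_apply_def]
    split_ifs with h1 h2
    · rw [h1, hW]
    · rw [h2, hW]
    · rfl
  rw [e2] at e
  have : (2 : ℂ) • qdet M c W u = 0 := by
    rw [two_smul]; nth_rewrite 1 [e]; exact neg_add_cancel _
  exact (smul_eq_zero.1 this).resolve_left two_ne_zero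

/-- Reduces an expansion along an arbitrary column to one along an outermost column. -/
theorem qdet_update_swap (h : GlRel M c) (W : Fin N → C ⊕ Fin N) (p q : Fin N) (x : C ⊕ Fin N)
    (u : ℂ) : qdet M c (Function.update W p x) u = (Equiv.Perm.sign (Equiv.swap p q) : ℤ) •
      qdet M c (Function.update (W ∘ Equiv.swap p q) q x) u := by
  have e : Function.update (W ∘ Equiv.swap p q) q x =
      Function.update W p x ∘ Equiv.swap p q := by
    rw [Function.update_comp_equiv]; simp
  rw [e, qdet_perm h, ← mul_smul]
  rw [← Units.val_mul, Int.units_mul_self, Units.val_one, one_smul]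

theorem sum_isCol_swap (W : Fin N → C ⊕ Fin N) (p q : Fin N) :
    ∑ r ∈ Finset.univ.erase q, isCol ((W ∘ Equiv.swap p q) r) =
      ∑ r ∈ Finset.univ.erase p, isCol (W r) := by
  have h1 := Finset.add_sum_erase Finset.univ (fun r => isCol ((W ∘ Equiv.swap p q) r))
    (Finset.mem_univ q)
  have h2 := Finset.add_sum_erase Finset.univ (fun r => isCol (W r)) (Finset.mem_univ p)
  have h3 := Equiv.sum_comp (Equiv.swap p q) fun r => isCol (W r)
  simp only [Function.comp_apply, Equiv.swap_apply_right] at h1 ⊢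
  omega

theorem letter_inl (b : C) (v : ℂ) :
    letter M c (Sum.inl b) v = ∑ i, inc N (entry M c i b v) * fe A i := by
  simp only [letter, entry, oddCol, map_add, add_mul, Finset.sum_add_distrib, inc_mul_fe]
  congr 1
  rw [Finset.sum_eq_single (c b)]
  · rw [if_pos rfl, AlgHom.commutes, Algebra.algebraMap_eq_smul_one, mul_smul_comm, mul_one]
  · intro i _ hi; rw [if_neg hi, map_zero, map_zero, mul_zero]
  · simp

/-- Expansion along a column, with the entries of the column on the left. -/
theorem qdet_expand_left {k : ℕ} {M : Fin (k + 1) → C → A} {c : C → Fin (k + 1)} (h : GlRel M c)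
    (W : Fin (k + 1) → C ⊕ Fin (k + 1)) (q : Fin (k + 1)) (b : C) (u : ℂ) :
    qdet M c (Function.update W q (Sum.inl b)) u =
      ∑ i, entry M c i b (u + (∑ p ∈ Finset.univ.erase q, isCol (W p) : ℕ)) *
        qdet M c (Function.update W q (Sum.inr i)) u := by
  -- `qdet` multiplies the columns in reverse order, so the last column is the leftmost letter and
  -- its entries come out on the left.
  suffices H : ∀ W : Fin (k + 1) → C ⊕ Fin (k + 1),
      qdet M c (Function.update W (Fin.last k) (Sum.inl b)) u =
      ∑ i, entry M c i b (u + (∑ p ∈ Finset.univ.erase (Fin.last k), isCol (W p) : ℕ)) *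
        qdet M c (Function.update W (Fin.last k) (Sum.inr i)) u by
    simp only [qdet_update_swap h W q (Fin.last k)]
    rw [H, Finset.smul_sum, sum_isCol_swap]
    simp only [mul_smul_comm]
  intro W
  have t : ∀ x, Fin.tail (Function.update W (Fin.last k) x ∘ Fin.rev) = Fin.tail (W ∘ Fin.rev) := by
    intro x; funext p
    change Function.update W (Fin.last k) x p.succ.rev = W p.succ.rev
    rw [Function.update_of_ne]
    rw [Fin.rev_succ]; exact (Fin.castSucc_lt_last _).ne
  have t0 : ∀ x, (Function.update W (Fin.last k) x ∘ Fin.rev) 0 = x := by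
    intro x
    change Function.update W (Fin.last k) x (Fin.rev 0) = x
    rw [Fin.rev_zero, Function.update_self]
  have n : ncol (Fin.tail (W ∘ Fin.rev)) =
      ∑ p ∈ Finset.univ.erase (Fin.last k), isCol (W p) := by
    have h1 := Finset.add_sum_erase Finset.univ (fun r => isCol (W r)) (Finset.mem_univ (Fin.last k))
    have h2 : ncol (W ∘ Fin.rev) = ncol W := ncol_comp W Fin.revPerm
    have h3 := ncol_succ (W ∘ Fin.rev)
    have h4 : (W ∘ Fin.rev) 0 = W (Fin.last k) := by simp
    rw [h4] at h3
    have h5 : _ = ncol W := h1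
    omega
  simp only [qdet, word, t, t0, n, letter_inl, Finset.sum_mul, map_sum, mul_assoc, tau_inc_mul]
  rfl

/-- Expansion along a column, with the entries of the column on the right. -/
theorem qdet_expand_right {k : ℕ} {M : Fin (k + 1) → C → A} {c : C → Fin (k + 1)} (h : GlRel M c)
    (W : Fin (k + 1) → C ⊕ Fin (k + 1)) (q : Fin (k + 1)) (b : C) (u : ℂ) :
    qdet M c (Function.update W q (Sum.inl b)) u =
      ∑ i, qdet M c (Function.update W q (Sum.inr i)) (u + 1) * entry M c i b u := by
  -- Column `0` is the rightmost letter. It carries the shift `u` and raises the parameter of the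
  -- remaining letters to `u + 1`.
  suffices H : ∀ W : Fin (k + 1) → C ⊕ Fin (k + 1),
      qdet M c (Function.update W 0 (Sum.inl b)) u =
      ∑ i, qdet M c (Function.update W 0 (Sum.inr i)) (u + 1) * entry M c i b u by
    simp only [qdet_update_swap h W q 0]
    rw [H, Finset.smul_sum]
    simp only [smul_mul_assoc]
  intro W
  have t : ∀ x, Fin.init (Function.update W 0 x ∘ Fin.rev) = Fin.init (W ∘ Fin.rev) := by
    intro x; funext p
    change Function.update W 0 x p.castSucc.rev = W p.castSucc.rev
    rw [Function.update_of_ne]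
    rw [Fin.rev_castSucc]; exact Fin.succ_ne_zero _
  have t0 : ∀ x, (Function.update W 0 x ∘ Fin.rev) (Fin.last k) = x := by
    intro x
    change Function.update W 0 x (Fin.rev (Fin.last k)) = x
    rw [Fin.rev_last, Function.update_self]
  simp only [qdet, word_last, t, t0, letter_inl, inc_mul_fe, Finset.mul_sum, map_sum, ← mul_assoc,
    tau_mul_inc]
  simp [isCol, letter]

/-- This is the top coefficient of `word_totalE`. On the right of the word the annihilator in
`totalE` dies; on the left, moving it to the front costs the anticommutator, which is the diagonal
term. -/
theorem qdet_comm (h : GlRel M c) (a : Fin N) (b : C) (W : Fin N → C ⊕ Fin N) (u : ℂ) :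
    M a b * qdet M c W u - qdet M c W u * M a b = (if a = c b then qdet M c W u else 0) -
      ∑ q, if a = idx c (W q) then
        qdet M c (Function.update W q (reindex c b (W q))) u else 0 := by
  have e := congrArg (tau N A) (word_totalE h a b (W ∘ Fin.rev) u)
  have e1 : tau N A (totalE M c a b * word M c N (W ∘ Fin.rev) u) = M a b * qdet M c W u -
      if a = c b then qdet M c W u else 0 := by
    have : fe A (c b) * fd A a = (if a = c b then 1 else 0) - fd A a * fe A (c b) := by
      rw [fd_mul_fe]; abel
    rw [totalE, sub_mul, map_sub, tau_inc_mul, this, sub_mul, map_sub, mul_assoc, tau_fd_mul]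
    split_ifs <;> simp [qdet]
  have e2 : tau N A (word M c N (W ∘ Fin.rev) u * totalE M c a b) = qdet M c W u * M a b := by
    rw [totalE, mul_sub, map_sub, tau_mul_inc, ← mul_assoc, tau_mul_fd, sub_zero]; rfl
  have e3 : ∀ q, tau N A (if a = idx c ((W ∘ Fin.rev) q) then word M c N
      (Function.update (W ∘ Fin.rev) q (reindex c b ((W ∘ Fin.rev) q))) u else 0) =
      (fun q => if a = idx c (W q) then
        qdet M c (Function.update W q (reindex c b (W q))) u else 0) (Fin.revPerm q) := by
    intro q
    change _ = if a = idx c (W q.rev) then _ else 0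
    have : Function.update (W ∘ Fin.rev) q (reindex c b ((W ∘ Fin.rev) q)) =
        Function.update W q.rev (reindex c b (W q.rev)) ∘ Fin.rev := by
      have := Function.update_comp_equiv W (Fin.revPerm (n := N)) q.rev (reindex c b (W q.rev))
      simp only [Fin.revPerm_symm, Fin.revPerm_apply, Fin.rev_rev] at this
      exact this.symm
    simp only [Function.comp_apply] at this ⊢
    rw [this]
    split_ifs
    · rfl
    · exact map_zero _
  rw [map_sub, map_sum, e1, e2] at e
  simp only [e3] at e
  rw [Equiv.sum_comp Fin.revPerm (fun q => if a = idx c (W q) then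
        qdet M c (Function.update W q (reindex c b (W q))) u else 0)] at e
  rw [sub_eq_iff_eq_add] at e ⊢
  rw [e]; abel

theorem word_inr {k : ℕ} (f : Fin k → Fin N) (u : ℂ) :
    word M c k (fun q => Sum.inr (f q)) u = (List.ofFn fun q => fe A (f q)).prod := by
  induction k with
  | zero => rfl
  | succ k ih =>
    rw [word, List.ofFn_succ, List.prod_cons, ← ih]
    rfl

theorem qdet_inr (u : ℂ) : qdet M c (fun q => Sum.inr q) u = 1 := by
  change tau N A (word M c N (fun q => Sum.inr q.rev) u) = 1
  rw [word_inr, tau_prod_fe, topCoeff_prod_cre, map_one]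

theorem map_word (f : A →ₐ[ℂ] B) {k : ℕ} (w : Fin k → C ⊕ Fin N) (u : ℂ) :
    fockMap N f (word M c k w u) = word (fun i j => f (M i j)) c k w u := by
  induction k with
  | zero => exact map_one _
  | succ k ih =>
    rw [word, word, map_mul, ih]
    congr 1
    cases w 0 with
    | inl j => simp [letter, oddCol, fockMap_fe, fockMap_inc]
    | inr j => exact fockMap_fe f j

theorem map_qdet (f : A →ₐ[ℂ] B) (W : Fin N → C ⊕ Fin N) (u : ℂ) :
    f (qdet M c W u) = qdet (fun i j => f (M i j)) c W u := by
  rw [qdet, ← tau_fockMap, map_word]; rfl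

/-- The factor e_i anticommutes through all letters and e_i² = 0, so the i-th entries of the columns
never contribute. -/
theorem fe_mul_word_congr {M' : Fin N → C → A} {i : Fin N} (hM : ∀ a j, a ≠ i → M a j = M' a j)
    {k : ℕ} (w : Fin k → C ⊕ Fin N) (u : ℂ) : fe A i * word M c k w u = fe A i * word M' c k w u := by
  have hl : ∀ x v, fe A i * letter M c x v = fe A i * letter M' c x v := by
    intro x v
    cases x with
    | inr j => rfl
    | inl j =>
      simp only [letter, mul_add, oddCol, Finset.mul_sum]
      congr 1
      refine Finset.sum_congr rfl fun a _ => ?_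
      by_cases ha : a = i
      · rw [ha, ← mul_assoc, ← mul_assoc, fe_mul_self, zero_mul, zero_mul]
      · rw [hM a j ha]
  induction k with
  | zero => rfl
  | succ k ih =>
    rw [word, word, ← mul_assoc, hl, fe_letter, neg_mul, mul_assoc, ih, ← mul_assoc, ← neg_mul,
      ← fe_letter, mul_assoc]

/-- A basis vector e_i among the columns makes row `i` irrelevant. This allows cofactors to be
compared between U(k) and U(g), where row n+1 differs. -/
theorem qdet_congr {k : ℕ} {M M' : Fin (k + 1) → C → A} {c : C → Fin (k + 1)} (h : GlRel M c)
    (h' : GlRel M' c) {i : Fin (k + 1)} (hM : ∀ a j, a ≠ i → M a j = M' a j)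
    (W : Fin (k + 1) → C ⊕ Fin (k + 1)) (q : Fin (k + 1)) (u : ℂ) :
    qdet M c (Function.update W q (Sum.inr i)) u =
      qdet M' c (Function.update W q (Sum.inr i)) u := by
  rw [qdet_update_swap h W q (Fin.last k), qdet_update_swap h' W q (Fin.last k)]
  congr 1
  have t0 : ∀ W : Fin (k + 1) → C ⊕ Fin (k + 1),
      (Function.update W (Fin.last k) (Sum.inr i) ∘ Fin.rev) 0 = Sum.inr i := by
    intro W
    change Function.update W (Fin.last k) (Sum.inr i) (Fin.rev 0) = _
    rw [Fin.rev_zero, Function.update_self]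
  rw [qdet, qdet, word, word, t0]
  exact congrArg _ (fe_mul_word_congr hM _ u)

end qdet

/-! ### Products of columns: change of the parameter, and contraction with a row. -/

section minors
variable {N : ℕ} {C A : Type*} [DecidableEq C] [Ring A] [Algebra ℂ A]
  {M : Fin N → C → A} {c : C → Fin N}

theorem ncol_update_inr {k : ℕ} (g : Fin k → C) (q : Fin k) (i : Fin N) :
    ((ncol (Function.update (fun p => (Sum.inl (g p) : C ⊕ Fin N)) q (Sum.inr i)) : ℕ) : ℂ) + 1 = k := by
  have h : ∀ p, isCol (Function.update (fun p => (Sum.inl (g p) : C ⊕ Fin N)) q (Sum.inr i) p) =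
      if p = q then 0 else 1 := by
    intro p
    by_cases hp : p = q
    · subst hp; simp [isCol]
    · simp [isCol, hp]
  have e : ncol (Function.update (fun p => (Sum.inl (g p) : C ⊕ Fin N)) q (Sum.inr i)) + 1 = k := by
    simp only [ncol, h]
    have := Finset.add_sum_erase Finset.univ (fun p => if p = q then 0 else 1) (Finset.mem_univ q)
    have e2 : ∑ p ∈ Finset.univ.erase q, (if p = q then 0 else 1) = k - 1 := by
      rw [Finset.sum_congr rfl fun p hp => if_neg (Finset.ne_of_mem_erase hp)]
      simp
    rw [e2] at this
    have := q.pos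
    simp only [if_true] at *
    omega
  exact_mod_cast e

theorem ncol_inl {k : ℕ} (g : Fin k → C) : ncol (fun p => (Sum.inl (g p) : C ⊕ Fin N)) = k := by
  simp [ncol, isCol]

theorem word_update_succ {k : ℕ} (g : Fin (k + 1) → C) (q : Fin k) (i : Fin N) (u : ℂ) :
    word M c (k + 1) (Function.update (fun p => Sum.inl (g p)) q.succ (Sum.inr i)) (u + 1) =
      letter M c (Sum.inl (g 0)) (u + k) *
        word M c k (Function.update (fun p => Sum.inl (g p.succ)) q (Sum.inr i)) (u + 1) := by
  rw [word, Fin.tail_update_succ, Function.update_of_ne (Fin.succ_ne_zero q).symm, add_assoc,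
    add_comm (1 : ℂ)]
  have : (Fin.tail fun p => (Sum.inl (g p) : C ⊕ Fin N)) = fun p => Sum.inl (g p.succ) := rfl
  rw [this, ncol_update_inr]

theorem word_update_zero {k : ℕ} (g : Fin (k + 1) → C) (i : Fin N) (u : ℂ) :
    word M c (k + 1) (Function.update (fun p => Sum.inl (g p)) 0 (Sum.inr i)) u =
      fe A i * word M c k (fun p => Sum.inl (g p.succ)) u := by
  rw [word, Fin.tail_update_zero, Function.update_self]
  rfl

theorem word_inl_succ {k : ℕ} (g : Fin (k + 1) → C) (u : ℂ) :
    word M c (k + 1) (fun p => Sum.inl (g p)) u =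
      letter M c (Sum.inl (g 0)) (u + k) * word M c k (fun p => Sum.inl (g p.succ)) u := by
  have : (Fin.tail fun p => (Sum.inl (g p) : C ⊕ Fin N)) = fun p => Sum.inl (g p.succ) := rfl
  rw [word, this, ncol_inl]

/-- Telescoping: raising one shift by one adds a basis vector, and the factors are raised one after
the other. -/
theorem word_inl_add_one {k : ℕ} (g : Fin k → C) (u : ℂ) :
    word M c k (fun q => Sum.inl (g q)) (u + 1) = word M c k (fun q => Sum.inl (g q)) u +
        ∑ q, word M c k (Function.update (fun q => Sum.inl (g q)) q (Sum.inr (c (g q)))) (u + 1) := by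
  induction k with
  | zero => simp [word]
  | succ k ih =>
    rw [word_inl_succ, word_inl_succ, Fin.sum_univ_succ, word_update_zero]
    simp only [word_update_succ]
    rw [← Finset.mul_sum]
    have e : letter M c (Sum.inl (g 0)) (u + 1 + k) =
        letter M c (Sum.inl (g 0)) (u + k) + fe A (c (g 0)) := by
      simp only [letter]; module
    rw [e, add_mul]
    nth_rewrite 1 [ih]
    rw [mul_add]; abel

theorem fe_mul_word_update (h : GlRel M c) {k : ℕ} (w : Fin k → C ⊕ Fin N) (q : Fin k) (a b : Fin N)
    (u : ℂ) : fe A a * word M c k (Function.update w q (Sum.inr b)) u =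
      -(fe A b * word M c k (Function.update w q (Sum.inr a)) u) := by
  have e : ∀ a b : Fin N, fe A a * word M c k (Function.update w q (Sum.inr b)) u =
      word M c (k + 1) (Fin.cons (Sum.inr a) (Function.update w q (Sum.inr b))) u := by
    intro a b
    rw [word, Fin.tail_cons]; rfl
  have s : (Fin.cons (Sum.inr a) (Function.update w q (Sum.inr b)) : Fin (k + 1) → C ⊕ Fin N) =
      (Fin.cons (Sum.inr b) (Function.update w q (Sum.inr a)) : Fin (k + 1) → C ⊕ Fin N) ∘
        Equiv.swap 0 q.succ := by
    funext p
    rw [Function.comp_apply]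
    cases p using Fin.cases with
    | zero => rw [Equiv.swap_apply_left, Fin.cons_succ, Function.update_self, Fin.cons_zero]
    | succ p =>
      by_cases hp : p = q
      · subst hp
        rw [Equiv.swap_apply_right, Fin.cons_succ, Function.update_self, Fin.cons_zero]
      · rw [Equiv.swap_apply_of_ne_of_ne (Fin.succ_ne_zero _) fun h => hp (Fin.succ_injective _ h),
          Fin.cons_succ, Fin.cons_succ, Function.update_of_ne hp, Function.update_of_ne hp]
  rw [e, e, s, word_perm h, Equiv.Perm.sign_swap (Fin.succ_ne_zero q).symm]
  simp

/-- The even operator e_i d_l acts as a derivation that turns column j into M_lj e_i. Moving the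
coefficient M_lj to the far left past other columns produces corrections, which raise the parameter
from `u` to `u + 1`. The row `l` is assumed to carry no diagonal shift. -/
theorem fe_fd_mul_word (h : GlRel M c) {l : Fin N} (hl : ∀ j, c j ≠ l) (i : Fin N) {k : ℕ}
    (g : Fin k → C) (u : ℂ) : fe A i * fd A l * word M c k (fun q => Sum.inl (g q)) u =
      ∑ q, inc N (M l (g q)) *
        word M c k (Function.update (fun q => Sum.inl (g q)) q (Sum.inr i)) (u + 1) +
      word M c k (fun q => Sum.inl (g q)) u * (fe A i * fd A l) := by
  induction k with
  | zero => simp [word]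
  | succ k ih =>
    have e1 : ∀ j v, fe A i * fd A l * letter M c (Sum.inl j) v = inc N (M l j) * fe A i +
        letter M c (Sum.inl j) v * (fe A i * fd A l) := by
      intro j v
      rw [← mul_assoc (letter M c _ v), ← neg_neg (letter M c _ v * _), ← fe_letter]
      simp only [letter, mul_add, mul_assoc, fd_oddCol, mul_smul_comm, fd_mul_fe, if_neg (hl j).symm,
        add_mul, mul_sub, smul_mul_assoc, mul_neg, inc_mul_fe, zero_sub]
      simp only [neg_mul, add_mul, smul_mul_assoc, mul_assoc]
      module
    have e2 : ∀ j j' v, letter M c (Sum.inl j) v * inc N (M l j') =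
        inc N (M l j') * letter M c (Sum.inl j) v - inc N (M l j) * fe A (c j') := by
      intro j j' v
      have e := totalE_oddCol h l j' j
      rw [if_neg (hl j).symm, sub_zero] at e
      simp only [totalE, sub_mul, mul_sub, mul_assoc, fd_oddCol] at e
      rw [← mul_assoc (fe A (c j')) (oddCol M j), fe_oddCol, neg_mul, mul_assoc] at e
      have e' : oddCol M j * inc N (M l j') = inc N (M l j') * oddCol M j -
          fe A (c j') * inc N (M l j) := by
        rw [sub_neg_eq_add] at e
        have := congrArg (· + oddCol M j * (fe A (c j') * fd A l)) e
        simp only [sub_add_cancel] at this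
        rw [← this]; abel
      simp only [letter, add_mul, mul_add, e', smul_mul_assoc, mul_smul_comm, inc_mul_fe]
      abel
    rw [word_inl_succ, ← mul_assoc, e1, add_mul, mul_assoc (letter M c _ _), ih, Fin.sum_univ_succ,
      word_update_zero]
    simp only [word_update_succ, ← mul_assoc]
    rw [mul_add, Finset.mul_sum]
    simp only [← mul_assoc, e2, sub_mul, Finset.sum_sub_distrib]
    -- The corrections from moving coefficients past the first column add up, by telescoping, to the
    -- change from `u` to `u + 1` in the term where the first column itself is replaced.
    have e3 : ∑ q, inc N (M l (g 0)) * fe A (c (g q.succ)) *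
        word M c k (Function.update (fun p => Sum.inl (g p.succ)) q (Sum.inr i)) (u + 1) =
        inc N (M l (g 0)) * fe A i * word M c k (fun p => Sum.inl (g p.succ)) u -
        inc N (M l (g 0)) * fe A i * word M c k (fun p => Sum.inl (g p.succ)) (u + 1) := by
      rw [word_inl_add_one, mul_add, sub_add_cancel_left, Finset.mul_sum, ← Finset.sum_neg_distrib]
      refine Finset.sum_congr rfl fun q _ => ?_
      rw [mul_assoc, fe_mul_word_update h, mul_neg, mul_assoc]
    rw [e3]
    abel

end minors

/-! ### The explicit formula for the quantum determinant. -/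

section capelli
variable {N : ℕ} {A : Type*} [Ring A] [Algebra ℂ A]

theorem inc_mul_prod_fe (x : A) {k : ℕ} (f : Fin k → Fin N) :
    inc N x * (List.ofFn fun q => fe A (f q)).prod =
      (List.ofFn fun q => fe A (f q)).prod * inc N x := by
  induction k with
  | zero => simp
  | succ k ih =>
    rw [List.ofFn_succ, List.prod_cons, ← mul_assoc, inc_mul_fe, mul_assoc, ih, mul_assoc]

theorem word_inl {C : Type*} [DecidableEq C] {M : Fin N → C → A} {c : C → Fin N} {k : ℕ}
    (g : Fin k → C) (u : ℂ) : word M c k (fun q => Sum.inl (g q)) u =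
      ∑ f : Fin k → Fin N, (List.ofFn fun q => fe A (f q)).prod *
        inc N (List.ofFn fun q => entry M c (f q) (g q) (u + (q.rev.val : ℂ))).prod := by
  induction k with
  | zero => simp [word]
  | succ k ih =>
    have n : ncol (Fin.tail fun q : Fin (k + 1) => (Sum.inl (g q) : C ⊕ Fin N)) = k := by
      simp [ncol, isCol, Fin.tail]
    rw [word, n]
    change letter M c (Sum.inl (g 0)) _ * word M c k (fun q => Sum.inl (g q.succ)) u = _
    rw [ih, letter_inl, Finset.sum_mul_sum, ← (Fin.consEquiv fun _ => Fin N).sum_comp,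
      Fintype.sum_prod_type]
    refine Finset.sum_congr rfl fun i _ => Finset.sum_congr rfl fun f _ => ?_
    simp only [Fin.consEquiv_apply, List.ofFn_succ, Fin.cons_zero, Fin.cons_succ, List.prod_cons,
      map_mul, Fin.rev_zero, Fin.rev_succ, Fin.val_last, Fin.val_castSucc]
    rw [inc_mul_fe, mul_assoc, mul_assoc, ← mul_assoc (inc N _), inc_mul_prod_fe, mul_assoc]

/-- Multiplying out the columns gives a sum over all choices of rows. A repeated row has top
coefficient zero, and a permutation contributes its sign. -/
theorem qdet_inl (M : Fin N → Fin N → A) (u : ℂ) : qdet M id (fun q => Sum.inl q) u =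
    ∑ σ : Equiv.Perm (Fin N), (Equiv.Perm.sign σ : ℤ) • (List.ofFn fun q : Fin N =>
      entry M id (σ q.rev) q.rev (u + (q.rev.val : ℂ))).prod := by
  change tau N A (word M id N (fun q => Sum.inl q.rev) u) = _
  rw [word_inl, map_sum]
  symm
  refine Finset.sum_of_injOn (fun σ : Equiv.Perm (Fin N) => (σ ∘ Fin.rev : Fin N → Fin N)) ?_ ?_ ?_ ?_
  · intro σ _ τ _ h
    ext q
    have := congrFun h q.rev
    simp only [Function.comp_apply, Fin.rev_rev] at this
    rw [this]
  · intro σ _; simp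
  · intro f _ hf
    rw [tau_mul_inc, tau_prod_fe, topCoeff_prod_cre_of_not_injective, map_zero, zero_mul]
    intro hi
    refine hf ⟨Fin.revPerm.trans (Equiv.ofBijective f (Finite.injective_iff_bijective.1 hi)), by simp, ?_⟩
    funext q
    simp
  · intro σ _
    rw [tau_mul_inc, tau_prod_fe]
    simp only [Function.comp_apply]
    rw [topCoeff_prod_cre_perm]
    simp [zsmul_eq_mul]

end capelli
end
end ShiftOps

namespace ShiftOps
noncomputable section

/-! ### Quantum minor and cofactors of the upper left block. -/

section minors
variable {k : ℕ} {A B : Type*} [Ring A] [Algebra ℂ A] [Ring B] [Algebra ℂ B]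

/-- The columns `0, …, k - 1`, completed by the last basis vector. -/
def baseWord (k : ℕ) : Fin (k + 1) → Fin k ⊕ Fin (k + 1) :=
  Fin.snoc (fun j => Sum.inl j) (Sum.inr (Fin.last k))

@[simp] theorem baseWord_castSucc (j : Fin k) : baseWord k j.castSucc = Sum.inl j :=
  Fin.snoc_castSucc ..
@[simp] theorem baseWord_last : baseWord k (Fin.last k) = Sum.inr (Fin.last k) := Fin.snoc_last ..

/-- The quantum determinant of the upper left block of size `k`. -/
def minor (M : Fin (k + 1) → Fin k → A) (u : ℂ) : A := qdet M Fin.castSucc (baseWord k) u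

/-- The quantum cofactor of the entry `(i, j)` of the upper left block of size `k`. -/
def cof (M : Fin (k + 1) → Fin k → A) (i j : Fin k) (u : ℂ) : A :=
  qdet M Fin.castSucc (Function.update (baseWord k) j.castSucc (Sum.inr i.castSucc)) (u + 1)

variable {M : Fin (k + 1) → Fin k → A} (h : GlRel M Fin.castSucc)
include h

theorem qdet_update_inl (j b : Fin k) (u : ℂ) :
    qdet M Fin.castSucc (Function.update (baseWord k) j.castSucc (Sum.inl b)) u =
      if b = j then minor M u else 0 := by
  split_ifs with hb
  · subst hb
    rw [← baseWord_castSucc b, Function.update_eq_self]; rfl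
  · refine qdet_eq_zero h (p := b.castSucc) (q := j.castSucc) (by simpa using hb) ?_ u
    rw [Function.update_self, Function.update_of_ne (by simpa using hb), baseWord_castSucc]

theorem qdet_update_inr_last (j : Fin k) (u : ℂ) :
    qdet M Fin.castSucc (Function.update (baseWord k) j.castSucc (Sum.inr (Fin.last k))) u = 0 := by
  refine qdet_eq_zero h (p := Fin.last k) (q := j.castSucc) (Fin.castSucc_lt_last j).ne' ?_ u
  rw [Function.update_self, Function.update_of_ne (Fin.castSucc_lt_last j).ne', baseWord_last]

theorem entry_castSucc (i b : Fin k) (v : ℂ) : entry M Fin.castSucc i.castSucc b v =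
    M i.castSucc b + algebraMap ℂ A (if i = b then v else 0) := by
  simp [entry]

/-- Both sides are the minor with column `j` replaced by column `b`, evaluated at `u + 1`; the sum
is the left expansion. The replaced column stands before k - 1 others, which makes its shift (u + 1)
+ (k - 1) = u + k. -/
theorem sum_cof_left (j b : Fin k) (u : ℂ) :
    ∑ i : Fin k, (M i.castSucc b + algebraMap ℂ A (if i = b then u + k else 0)) * cof M i j u =
      if b = j then minor M (u + 1) else 0 := by
  have n : ((∑ p ∈ Finset.univ.erase j.castSucc, isCol (baseWord k p) : ℕ) : ℂ) + 1 = k := by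
    have h1 := Finset.add_sum_erase Finset.univ (fun r => isCol (baseWord k r))
      (Finset.mem_univ j.castSucc)
    rw [Fin.sum_univ_castSucc] at h1
    simp [isCol] at h1
    rw [add_comm]
    exact_mod_cast h1
  have e := qdet_expand_left h (baseWord k) j.castSucc b (u + 1)
  rw [qdet_update_inl h, Fin.sum_univ_castSucc, qdet_update_inr_last h, mul_zero, add_zero] at e
  rw [e]
  refine Finset.sum_congr rfl fun i _ => ?_
  rw [entry_castSucc h, add_assoc u 1, add_comm (1 : ℂ), n]
  rfl

/-- The right expansion at `u`. It raises the cofactor's parameter to `u + 1`, which is the reason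
for the shift built into `cof`. -/
theorem sum_cof_right (j b : Fin k) (u : ℂ) :
    ∑ i : Fin k, cof M i j u * (M i.castSucc b + algebraMap ℂ A (if i = b then u else 0)) =
      if b = j then minor M u else 0 := by
  have e := qdet_expand_right h (baseWord k) j.castSucc b u
  rw [qdet_update_inl h, Fin.sum_univ_castSucc, qdet_update_inr_last h, zero_mul, add_zero] at e
  rw [e]
  refine Finset.sum_congr rfl fun i _ => ?_
  rw [entry_castSucc h]
  rfl

/-- In `qdet_comm` only column `a` is replaced. For a = b this cancels the diagonal term, and
otherwise column `b` appears twice. -/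
theorem minor_comm (a b : Fin k) (u : ℂ) :
    M a.castSucc b * minor M u = minor M u * M a.castSucc b := by
  have e := qdet_comm h a.castSucc b (baseWord k) u
  rw [← sub_eq_zero]
  refine e.trans ?_
  rw [Fin.sum_univ_castSucc]
  simp only [baseWord_castSucc, baseWord_last, idx, reindex, Sum.elim_inl, Sum.elim_inr, id,
    if_neg (Fin.castSucc_lt_last a).ne, qdet_update_inl h, Fin.castSucc_inj]
  rw [Finset.sum_ite_eq]
  by_cases hab : a = b
  · simp [hab, minor]
  · simp [hab, Ne.symm hab]

/-- The cofactors form a tensor under gl_k: the commutator changes either the missing row `i` or the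
missing column `j`. -/
theorem cof_comm (a b i j : Fin k) (u : ℂ) :
    M a.castSucc b * cof M i j u - cof M i j u * M a.castSucc b =
      (if j = b then cof M i a u else 0) - (if a = i then cof M b j u else 0) := by
  set W := Function.update (baseWord k) j.castSucc (Sum.inr i.castSucc) with hW
  have e := qdet_comm h a.castSucc b W (u + 1)
  refine e.trans ?_
  have Wj : W j.castSucc = Sum.inr i.castSucc := Function.update_self ..
  have Wp : ∀ p, p ≠ j → W p.castSucc = Sum.inl p := fun p hp => by
    rw [hW, Function.update_of_ne (by simpa using hp), baseWord_castSucc]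
  have Wl : W (Fin.last k) = Sum.inr (Fin.last k) := by
    rw [hW, Function.update_of_ne (Fin.castSucc_lt_last j).ne', baseWord_last]
  -- With column `a` overwritten by column `b`: nothing changes if b = a, a transposition restores a
  -- cofactor if b = j, and otherwise a column is repeated.
  have Z : a ≠ j → qdet M Fin.castSucc (Function.update W a.castSucc (Sum.inl b)) (u + 1) =
      if b = a then cof M i j u else if b = j then -cof M i a u else 0 := by
    intro haj
    split_ifs with h1 h2
    · subst h1
      rw [← Wp b haj, Function.update_eq_self]; rfl
    · subst h2
      rw [cof, ← qdet_swap h _ (p := b.castSucc) (q := a.castSucc) (by simpa using h1)]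
      congr 1
      funext p
      rw [Function.comp_apply]
      by_cases hp1 : p = b.castSucc
      · subst hp1
        rw [Equiv.swap_apply_left, Function.update_self, Function.update_of_ne (by simpa using h1), Wj]
      · by_cases hp2 : p = a.castSucc
        · subst hp2
          rw [Equiv.swap_apply_right, Function.update_self, Function.update_of_ne (by simpa using h1),
            baseWord_castSucc]
        · rw [Equiv.swap_apply_of_ne_of_ne hp1 hp2, Function.update_of_ne hp2,
            Function.update_of_ne hp2, hW, Function.update_of_ne hp1]
    · refine qdet_eq_zero h (p := b.castSucc) (q := a.castSucc) (by simpa using h1) ?_ _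
      rw [Function.update_self, Function.update_of_ne (by simpa using h1), Wp b h2]
  rw [Fin.sum_univ_castSucc, Wl]
  have t : ∀ p : Fin k, (if a.castSucc = idx Fin.castSucc (W p.castSucc) then
      qdet M Fin.castSucc (Function.update W p.castSucc (reindex Fin.castSucc b (W p.castSucc)))
        (u + 1) else 0) =
      (if p = j then (if a = i then cof M b j u else 0) else 0) + (if p = a then (if a = j then 0 else
        qdet M Fin.castSucc (Function.update W a.castSucc (Sum.inl b)) (u + 1)) else 0) := by
    intro p
    by_cases hp : p = j
    · subst hp
      rw [Wj, if_pos rfl]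
      simp only [idx, Sum.elim_inr, id, Fin.castSucc_inj, reindex, hW, Function.update_idem]
      have : (if p = a then (if a = p then (0 : A) else
        qdet M Fin.castSucc (Function.update W a.castSucc (Sum.inl b)) (u + 1)) else 0) = 0 := by
        split_ifs with h1 h2
        · rfl
        · exact absurd h1.symm h2
        · rfl
      rw [← hW, this, add_zero]
      rfl
    · rw [Wp p hp, if_neg hp, zero_add]
      simp only [idx, Sum.elim_inl, Fin.castSucc_inj, reindex]
      by_cases hpa : a = p
      · subst hpa; rw [if_pos rfl, if_pos rfl, if_neg hp]
      · rw [if_neg hpa, if_neg (Ne.symm hpa)]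
  simp only [t, Finset.sum_add_distrib, Finset.sum_ite_eq', Finset.mem_univ, if_true]
  have hlast : ¬a.castSucc = idx Fin.castSucc (Sum.inr (Fin.last k) : Fin k ⊕ Fin (k + 1)) :=
    (Fin.castSucc_lt_last a).ne
  rw [if_neg hlast, add_zero]
  simp only [Fin.castSucc_inj]
  by_cases haj : a = j
  · subst haj
    simp [cof, hW]
  · rw [if_neg haj, Z haj]
    by_cases hab : a = b
    · subst hab
      simp [Ne.symm haj, cof, hW]
    · by_cases hbj : b = j
      · subst hbj
        simp [Ne.symm hab, hab, sub_eq_add_neg]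
      · simp [hab, Ne.symm hab, hbj, Ne.symm hbj]

/-- Take traces in the two cofactor identities. Their difference is the sum of the commutators of
M_ij with cof_ij, which is zero by `cof_comm`; what remains is `k` times the claim, hence the
assumption k ≠ 0. -/
theorem minor_add_one (hk : k ≠ 0) (u : ℂ) : minor M (u + 1) = minor M u + ∑ i, cof M i i u := by
  have l : ∀ j, ∑ i : Fin k, M i.castSucc j * cof M i j u = minor M (u + 1) - (u + k) • cof M j j u := by
    intro j
    have e := sum_cof_left h j j u
    simp only [add_mul, Finset.sum_add_distrib, if_true] at e
    rw [← e, Finset.sum_eq_single (f := fun i => algebraMap ℂ A (if i = j then u + k else 0) * _) j]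
    · rw [if_pos rfl, Algebra.smul_def]; abel
    · intro i _ hi; rw [if_neg hi, map_zero, zero_mul]
    · simp
  have r : ∀ j, ∑ i : Fin k, cof M i j u * M i.castSucc j = minor M u - u • cof M j j u := by
    intro j
    have e := sum_cof_right h j j u
    simp only [mul_add, Finset.sum_add_distrib, if_true] at e
    rw [← e, Finset.sum_eq_single (f := fun i => _ * algebraMap ℂ A (if i = j then u else 0)) j]
    · rw [if_pos rfl, ← Algebra.commutes, Algebra.smul_def]; abel
    · intro i _ hi; rw [if_neg hi, map_zero, mul_zero]
    · simp
  have d : ∑ j : Fin k, ∑ i : Fin k, (M i.castSucc j * cof M i j u - cof M i j u * M i.castSucc j) = 0 := by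
    simp only [cof_comm h, if_true, Finset.sum_sub_distrib]
    rw [Finset.sum_comm, sub_self]
  simp only [Finset.sum_sub_distrib, l, r, Finset.sum_const, Finset.card_univ, Fintype.card_fin,
    ← Finset.smul_sum] at d
  have : (k : ℂ) • (minor M (u + 1) - (minor M u + ∑ i, cof M i i u)) = 0 := by
    rw [← d, ← Nat.cast_smul_eq_nsmul ℂ, ← Nat.cast_smul_eq_nsmul ℂ]; module
  exact sub_eq_zero.1 ((smul_eq_zero.1 this).resolve_left (Nat.cast_ne_zero.2 hk))

/-- The extra basis vector is e_i instead of the last one, so the last basis vector has to come from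
the last row of some column. `fe_fd_mul_word` extracts the entries of that row and puts e_i in place
of the column. -/
theorem qdet_snoc_inr (i : Fin k) (u : ℂ) :
    qdet M Fin.castSucc (Fin.snoc (fun j => Sum.inl j) (Sum.inr i.castSucc)) u =
      -∑ j : Fin k, M (Fin.last k) j * cof M i j u := by
  have t : ∀ (f : Fin k → Fin k ⊕ Fin (k + 1)) (x : Fin k ⊕ Fin (k + 1)) (u : ℂ),
      word M Fin.castSucc (k + 1) ((Fin.snoc f x : Fin (k + 1) → Fin k ⊕ Fin (k + 1)) ∘ Fin.rev) u =
        letter M Fin.castSucc x (u + ncol (f ∘ Fin.rev)) * word M Fin.castSucc k (f ∘ Fin.rev) u := by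
    intro f x u
    have t0 : ((Fin.snoc f x : Fin (k + 1) → Fin k ⊕ Fin (k + 1)) ∘ Fin.rev) 0 = x := by simp
    have t1 : Fin.tail ((Fin.snoc f x : Fin (k + 1) → Fin k ⊕ Fin (k + 1)) ∘ Fin.rev) =
        f ∘ Fin.rev := by
      funext p
      simp [Fin.tail, Fin.rev_succ]
    rw [word, t0, t1]
  have hl : ∀ j : Fin k, j.castSucc ≠ Fin.last k := fun j => (Fin.castSucc_lt_last j).ne
  rw [qdet, t]
  change tau (k + 1) A (fe A i.castSucc * word M Fin.castSucc k (fun q : Fin k => Sum.inl q.rev) u) = _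
  -- The top coefficient is unchanged under the projection e d for the last index, since e d + d e =
  -- 1 and d dies on the left.
  have e : ∀ X : Fock (k + 1) A, tau (k + 1) A X =
      tau (k + 1) A (fe A (Fin.last k) * fd A (Fin.last k) * X) := by
    intro X
    have := tau_fd_mul (Fin.last k) (fe A (Fin.last k) * X)
    rw [← mul_assoc, fd_mul_fe, if_pos rfl, sub_mul, map_sub, one_mul, sub_eq_zero] at this
    exact this
  rw [e, ← mul_assoc, mul_assoc _ (fd A _), fd_mul_fe, if_neg (hl i).symm, zero_sub, mul_neg, neg_mul,
    mul_assoc, fe_fd_mul_word h hl, mul_add, map_neg, map_add, ← mul_assoc, ← mul_assoc, tau_mul_fd,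
    add_zero, Finset.mul_sum, map_sum]
  congr 1
  rw [← Equiv.sum_comp (Fin.revPerm (n := k))]
  refine Finset.sum_congr rfl fun q _ => ?_
  rw [← mul_assoc, ← inc_mul_fe, mul_assoc, tau_inc_mul, Fin.revPerm_apply, Fin.rev_rev, cof, qdet,
    baseWord, ← Fin.snoc_update, t]
  congr 3
  have := Function.update_comp_equiv (fun j => (Sum.inl j : Fin k ⊕ Fin (k + 1)))
    (Fin.revPerm (n := k)) q (Sum.inr i.castSucc)
  simp only [Fin.revPerm_symm, Fin.revPerm_apply] at this
  have e2 := congrArg (fun w => word M Fin.castSucc k w (u + 1)) this.symm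
  exact e2

end minors

/-! ### Values of minors and cofactors on a highest weight vector. -/

section highest
variable {k : ℕ} {A : Type*} [Ring A] [Algebra ℂ A]
  {M : Fin (k + 1) → Fin k → A} (h : GlRel M Fin.castSucc)

/-- The columns in `S`, completed by basis vectors. -/
def colWord (S : Finset (Fin k)) : Fin (k + 1) → Fin k ⊕ Fin (k + 1) :=
  Fin.snoc (fun j => if j ∈ S then Sum.inl j else Sum.inr j.castSucc) (Sum.inr (Fin.last k))

theorem colWord_castSucc (S : Finset (Fin k)) (j : Fin k) :
    colWord S j.castSucc = if j ∈ S then Sum.inl j else Sum.inr j.castSucc := by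
  rw [colWord, Fin.snoc_castSucc]

theorem colWord_last (S : Finset (Fin k)) : colWord S (Fin.last k) = Sum.inr (Fin.last k) := by
  rw [colWord, Fin.snoc_last]

include h in
/-- The value of a minor on a highest weight vector. -/
theorem qdet_highest {V : Type*} [AddCommGroup V] [Module ℂ V] (φ : A →ₐ[ℂ] Module.End ℂ V) (v : V)
    (lam : Fin k → ℂ) (hup : ∀ i b : Fin k, i < b → φ (M i.castSucc b) v = 0)
    (hd : ∀ b : Fin k, φ (M b.castSucc b) v = lam b • v) (S : Finset (Fin k)) (u : ℂ) :
    φ (qdet M Fin.castSucc (colWord S) u) v =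
      (∏ b ∈ S, (lam b + u + ((S.filter fun p => b < p).card : ℂ))) • v := by
  induction S using Finset.induction_on_max generalizing u with
  | empty =>
    have : colWord (∅ : Finset (Fin k)) = fun q => Sum.inr q := by
      funext q
      induction q using Fin.lastCases with
      | last => exact colWord_last _
      | cast j => rw [colWord_castSucc]; simp
    rw [this, qdet_inr]; simp
  | insert s S hs ih =>
    have hsS : s ∉ S := fun h => (hs s h).false
    have e1 : colWord (insert s S) = Function.update (colWord S) s.castSucc (Sum.inl s) := by
      funext q
      induction q using Fin.lastCases with
      | last => rw [Function.update_of_ne (Fin.castSucc_lt_last s).ne', colWord_last, colWord_last]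
      | cast j =>
        by_cases hj : j = s
        · subst hj; rw [Function.update_self, colWord_castSucc]; simp
        · rw [Function.update_of_ne (by simpa using hj), colWord_castSucc, colWord_castSucc]
          simp [hj]
    have e2 : Function.update (colWord S) s.castSucc (Sum.inr s.castSucc) = colWord S := by
      rw [Function.update_eq_self_iff, colWord_castSucc, if_neg hsS]
    -- The largest column is expanded on the right, next to `v`. Entries above the diagonal kill
    -- `v`, those below come with a repeated basis vector, and the diagonal one gives a scalar. The
    -- remaining columns are taken at `u + 1`, which accounts for the new larger element in their
    -- counts.
    rw [e1, qdet_expand_right h, map_sum, LinearMap.sum_apply, Finset.sum_eq_single s.castSucc]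
    · rw [e2, map_mul, Module.End.mul_apply, entry, if_pos rfl, map_add, AlgHom.commutes,
        LinearMap.add_apply, hd, Module.algebraMap_end_apply, ← add_smul, map_smul, ih, smul_smul,
        Finset.prod_insert hsS]
      congr 1
      have c0 : ((insert s S).filter fun p => s < p) = ∅ := by
        ext p
        simp only [Finset.mem_filter, Finset.mem_insert, Finset.notMem_empty, iff_false, not_and]
        rintro (rfl | hp)
        · exact lt_irrefl _
        · exact (hs p hp).not_gt
      rw [c0]
      congr 1
      · simp
      · refine Finset.prod_congr rfl fun b hb => ?_
        rw [Finset.filter_insert, if_pos (hs b hb), Finset.card_insert_of_notMem]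
        · push_cast; ring
        · simp [hsS]
    · intro i _ hi
      rw [map_mul, Module.End.mul_apply]
      induction i using Fin.lastCases with
      | last =>
        rw [qdet_eq_zero h (p := Fin.last k) (q := s.castSucc) (Fin.castSucc_lt_last s).ne']
        · simp
        · rw [Function.update_self, Function.update_of_ne (Fin.castSucc_lt_last s).ne', colWord_last]
      | cast i =>
        have his : i ≠ s := by simpa using hi
        rcases lt_or_gt_of_ne his with hlt | hgt
        · rw [entry, if_neg hi, map_zero, add_zero, hup i s hlt, map_zero]
        · rw [qdet_eq_zero h (p := i.castSucc) (q := s.castSucc) hi]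
          · simp
          · rw [Function.update_self, Function.update_of_ne hi, colWord_castSucc,
              if_neg fun h' => (hs i h').not_gt hgt]
    · simp

include h in
theorem minor_highest {V : Type*} [AddCommGroup V] [Module ℂ V] (φ : A →ₐ[ℂ] Module.End ℂ V) (v : V)
    (lam : Fin k → ℂ) (hup : ∀ i b : Fin k, i < b → φ (M i.castSucc b) v = 0)
    (hd : ∀ b : Fin k, φ (M b.castSucc b) v = lam b • v) (u : ℂ) :
    φ (minor M u) v = (∏ b : Fin k, (lam b + u + (b.rev.val : ℂ))) • v := by
  have e : baseWord k = colWord Finset.univ := by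
    funext q
    induction q using Fin.lastCases with
    | last => rw [colWord_last, baseWord_last]
    | cast j => rw [colWord_castSucc]; simp
  rw [minor, e, qdet_highest h φ v lam hup hd]
  congr 1
  refine Finset.prod_congr rfl fun b _ => ?_
  have : (Finset.univ.filter fun p => b < p) = Finset.Ioi b := by ext; simp
  rw [this, Fin.card_Ioi, Fin.val_rev]
  congr 2
  omega

include h in
-- Leaving out column `r` lowers the count by one for b < r only, and this cancels the `u + 1` in
-- `cof`.
theorem cof_highest {V : Type*} [AddCommGroup V] [Module ℂ V] (φ : A →ₐ[ℂ] Module.End ℂ V) (v : V)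
    (lam : Fin k → ℂ) (hup : ∀ i b : Fin k, i < b → φ (M i.castSucc b) v = 0)
    (hd : ∀ b : Fin k, φ (M b.castSucc b) v = lam b • v) (r : Fin k) (u : ℂ) :
    φ (cof M r r u) v = (∏ b ∈ Finset.univ.erase r,
      (lam b + u + (b.rev.val : ℂ) + if b < r then 0 else 1)) • v := by
  have e : Function.update (baseWord k) r.castSucc (Sum.inr r.castSucc) =
      colWord (Finset.univ.erase r) := by
    funext q
    induction q using Fin.lastCases with
    | last => rw [colWord_last, Function.update_of_ne (Fin.castSucc_lt_last r).ne', baseWord_last]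
    | cast j =>
      rw [colWord_castSucc]
      by_cases hj : j = r
      · subst hj; simp
      · rw [Function.update_of_ne (by simpa using hj)]; simp [hj]
  rw [cof, e, qdet_highest h φ v lam hup hd]
  congr 1
  refine Finset.prod_congr rfl fun b hb => ?_
  have c : (Finset.univ.erase r).filter (fun p => b < p) = (Finset.Ioi b).erase r := by
    ext; simp
  have hbr := Finset.ne_of_mem_erase hb
  rw [c]
  by_cases hlt : b < r
  · rw [if_pos hlt, Finset.card_erase_of_mem (by simpa using hlt), Fin.card_Ioi]
    have : (k - 1 - (b : ℕ) - 1) + 1 = b.rev.val := by rw [Fin.val_rev]; omega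
    rw [← this]; push_cast; ring
  · rw [if_neg hlt, Finset.erase_eq_of_notMem (by simpa using le_of_not_gt hlt), Fin.card_Ioi]
    have : (k - 1 - (b : ℕ)) = b.rev.val := by rw [Fin.val_rev]; omega
    rw [this]; ring

end highest

/-! ### Centrality, and expansions along the last row and column. -/

section capelli
variable {k : ℕ} {A : Type*} [Ring A] [Algebra ℂ A]

theorem word_map {N k : ℕ} {C C' : Type*} [DecidableEq C] [DecidableEq C'] (M : Fin N → C → A)
    (c : C → Fin N) (κ : C' → C) (w : Fin k → C' ⊕ Fin N) (u : ℂ) :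
    word M c k (Sum.map κ id ∘ w) u = word (fun i j => M i (κ j)) (c ∘ κ) k w u := by
  induction k with
  | zero => rfl
  | succ k ih =>
    rw [word, word]
    have n : ncol (Fin.tail (Sum.map κ id ∘ w)) = ncol (Fin.tail w) := by
      refine Finset.sum_congr rfl fun p _ => ?_
      change isCol (Sum.map κ id (Fin.tail w p)) = _
      cases Fin.tail w p <;> rfl
    rw [n]
    change _ * word M c k (Sum.map κ id ∘ Fin.tail w) u = _
    rw [ih]
    congr 1
    rw [Function.comp_apply]
    cases w 0 <;> rfl

theorem qdet_map {N : ℕ} {C C' : Type*} [DecidableEq C] [DecidableEq C'] (M : Fin N → C → A)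
    (c : C → Fin N) (κ : C' → C) (W : Fin N → C' ⊕ Fin N) (u : ℂ) :
    qdet M c (Sum.map κ id ∘ W) u = qdet (fun i j => M i (κ j)) (c ∘ κ) W u := by
  rw [qdet, qdet, Function.comp_assoc, word_map]

variable {M : Fin (k + 1) → Fin (k + 1) → A} (h : GlRel M id)
include h

theorem GlRel.castSucc : GlRel (fun i j => M i j.castSucc : Fin (k + 1) → Fin k → A) Fin.castSucc :=
  fun i j a b => h i j.castSucc a b.castSucc

/-- The argument of `minor_comm`, now with every column of the square matrix present. -/
theorem qdet_inl_comm (a b : Fin (k + 1)) (u : ℂ) :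
    M a b * qdet M id (fun q => Sum.inl q) u = qdet M id (fun q => Sum.inl q) u * M a b := by
  have e : ∀ q : Fin (k + 1), (if a = idx id (Sum.inl q : Fin (k + 1) ⊕ Fin (k + 1)) then
      qdet M id (Function.update (fun q => Sum.inl q) q (reindex id b (Sum.inl q))) u else 0) =
      if a = q then qdet M id (Function.update (fun q => Sum.inl q) q (Sum.inl b)) u else 0 :=
    fun q => rfl
  rw [← sub_eq_zero, qdet_comm h]
  simp only [e]
  rw [Finset.sum_ite_eq, if_pos (Finset.mem_univ a)]
  by_cases hab : a = b
  · subst hab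
    rw [Function.update_eq_self]
    have haa : a = id a := rfl
    rw [if_pos haa, sub_self]
  · have hab' : ¬a = id b := hab
    rw [if_neg hab', qdet_eq_zero h (p := b) (q := a) (Ne.symm hab), sub_zero]
    rw [Function.update_self, Function.update_of_ne (Ne.symm hab)]

/-- Expansion of the quantum determinant along its last row and column. -/
theorem qdet_inl_expand (u : ℂ) : qdet M id (fun q => Sum.inl q) u =
    (M (Fin.last k) (Fin.last k) + algebraMap ℂ A (u + k)) *
      minor (fun i j => M i j.castSucc) u -
    ∑ i : Fin k, ∑ j : Fin k, M i.castSucc (Fin.last k) * M (Fin.last k) j.castSucc *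
      cof (fun i j => M i j.castSucc) i j u := by
  have e0 : (fun q => Sum.inl q : Fin (k + 1) → Fin (k + 1) ⊕ Fin (k + 1)) =
      Function.update (fun q => Sum.inl q) (Fin.last k) (Sum.inl (Fin.last k)) := by
    rw [Function.update_eq_self]
  have e1 : ∀ i : Fin (k + 1), (Function.update (fun q => Sum.inl q) (Fin.last k) (Sum.inr i) :
      Fin (k + 1) → Fin (k + 1) ⊕ Fin (k + 1)) = Sum.map Fin.castSucc id ∘
        (Fin.snoc (fun j => Sum.inl j) (Sum.inr i) : Fin (k + 1) → Fin k ⊕ Fin (k + 1)) := by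
    intro i
    funext q
    induction q using Fin.lastCases with
    | last => simp
    | cast j => rw [Function.update_of_ne (Fin.castSucc_lt_last j).ne]; simp
  rw [e0, qdet_expand_left h]
  simp only [e1, qdet_map]
  rw [Fin.sum_univ_castSucc]
  have n : (∑ p ∈ Finset.univ.erase (Fin.last k),
      isCol (Sum.inl p : Fin (k + 1) ⊕ Fin (k + 1)) : ℕ) = k := by
    simp [isCol]
  rw [n, add_comm, sub_eq_add_neg, ← Finset.sum_neg_distrib]
  congr 1
  · simp only [entry, id, if_true]; rfl
  · refine Finset.sum_congr rfl fun i _ => ?_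
    -- The last column has contributed e_i with i in the block, so the last row still has to be
    -- expanded.
    have := qdet_snoc_inr h.castSucc i u
    change _ * qdet _ Fin.castSucc _ u = _
    rw [this]
    simp only [entry, id, if_neg (Fin.castSucc_lt_last i).ne, map_zero, add_zero, mul_neg,
      Finset.mul_sum, mul_assoc]

/-- Reordering E_iL E_Lj produces E_ij - δ_ij E_LL. The E_ij terms sum to minors and diagonal
cofactors by `sum_cof_left`, and the trace of the cofactors is a difference of minors by
`minor_add_one`. Together they turn M(u) into M(u+1) and shift u + k to u. -/
theorem qdet_inl_expand' (hk : k ≠ 0) (u : ℂ) : qdet M id (fun q => Sum.inl q) u =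
    (M (Fin.last k) (Fin.last k) + algebraMap ℂ A u) *
      minor (fun i j => M i j.castSucc) (u + 1) -
    ∑ i : Fin k, ∑ j : Fin k, M (Fin.last k) j.castSucc * M i.castSucc (Fin.last k) *
      cof (fun i j => M i j.castSucc) i j u := by
  have e0 := qdet_inl_expand h u
  set M' : Fin (k + 1) → Fin k → A := fun i j => M i j.castSucc with hM'
  have hM := h.castSucc
  have t : ∀ i j : Fin k, M i.castSucc (Fin.last k) * M (Fin.last k) j.castSucc * cof M' i j u =
      M (Fin.last k) j.castSucc * M i.castSucc (Fin.last k) * cof M' i j u +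
      (M' i.castSucc j * cof M' i j u -
        if i = j then M (Fin.last k) (Fin.last k) * cof M' i j u else 0) := by
    intro i j
    have e := h i.castSucc (Fin.last k) (Fin.last k) j.castSucc
    simp only [id, if_true, Fin.castSucc_inj] at e
    rw [sub_eq_iff_eq_add] at e
    rw [e, add_mul, sub_mul]
    by_cases hij : i = j
    · subst hij; simp only [if_true]; abel
    · rw [if_neg hij, if_neg (Ne.symm hij)]; simp only [zero_mul]; abel
  have l : ∀ j, ∑ i : Fin k, M' i.castSucc j * cof M' i j u =
      minor M' (u + 1) - (u + k) • cof M' j j u := by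
    intro j
    have e := sum_cof_left hM j j u
    simp only [add_mul, Finset.sum_add_distrib, if_true] at e
    rw [← e, Finset.sum_eq_single (f := fun i => algebraMap ℂ A (if i = j then u + k else 0) * _) j]
    · rw [if_pos rfl, Algebra.smul_def]; abel
    · intro i _ hi; rw [if_neg hi, map_zero, zero_mul]
    · simp
  have hm := minor_add_one hM hk u
  rw [e0]
  simp only [t, Finset.sum_add_distrib, Finset.sum_sub_distrib]
  rw [Finset.sum_comm (f := fun i j => M' i.castSucc j * cof M' i j u)]
  simp only [l, Finset.sum_sub_distrib, Finset.sum_ite_eq, Finset.mem_univ, if_true, Finset.sum_const,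
    Finset.card_univ, Fintype.card_fin, ← Finset.smul_sum, ← Finset.mul_sum]
  change (_ + _) * minor M' u - _ = _
  have hs : ∑ i, cof M' i i u = minor M' (u + 1) - minor M' u := by rw [hm]; abel
  rw [hs]
  simp only [Algebra.algebraMap_eq_smul_one, add_mul, smul_mul_assoc, one_mul, mul_sub,
    ← Nat.cast_smul_eq_nsmul ℂ]
  module

end capelli
end
end ShiftOps

namespace ShiftOps
noncomputable section

/-! ### The Capelli element in U(g) acting on φ; factors from U(k) act on V. -/

section env
variable {m : ℕ}

theorem E_apply (i j a b : Fin (m + 3)) : (E i j : Gl m) a b = if i = a ∧ j = b then 1 else 0 := by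
  rw [E, Matrix.single_apply]

theorem E_mul (i j k l : Fin (m + 3)) : (E i j : Gl m) * E k l = if j = k then E i l else 0 := by
  split_ifs with h
  · subst h; simp [E]
  · exact Matrix.single_mul_single_of_ne _ _ _ _ h _

theorem E_lie (i j k l : Fin (m + 3)) : (⁅(E i j : Gl m), E k l⁆ : Gl m) =
    (if j = k then E i l else 0) - (if l = i then E k j else 0) := by
  rw [LieRing.of_associative_ring_bracket, E_mul, E_mul]

theorem sum_E (X : Gl m) : X = ∑ i, ∑ j, X i j • (E i j : Gl m) := by
  conv_lhs => rw [Matrix.matrix_eq_sum_single X]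
  simp [E]

variable (m) in
/-- The enveloping algebra of `gl_{n+1}`. -/
abbrev UG : Type := UniversalEnvelopingAlgebra ℂ (Gl m)
variable (m) in
/-- The enveloping algebra of `k`. -/
abbrev UK : Type := UniversalEnvelopingAlgebra ℂ (kAlg m)

/-- The matrix units in `U(g)`. -/
def gU (i j : Fin (m + 3)) : UG m := UniversalEnvelopingAlgebra.ι ℂ (E i j)

theorem glRel_gU : GlRel (gU (m := m)) id := by
  intro i j k l
  have h := LieHom.map_lie (UniversalEnvelopingAlgebra.ι ℂ) (E i j : Gl m) (E k l)
  rw [E_lie, LieRing.of_associative_ring_bracket] at h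
  rw [gU, gU, ← h, map_sub]
  simp only [id]
  congr 1 <;> split_ifs <;> simp [gU]

theorem capelli_eq (u : ℂ) : capelli m u = qdet (gU (m := m)) id (fun q => Sum.inl q) u := by
  rw [qdet_inl]; rfl

theorem mem_center_of_comm {g : Type*} [LieRing g] [LieAlgebra ℂ g]
    {z : UniversalEnvelopingAlgebra ℂ g}
    (hz : ∀ X, UniversalEnvelopingAlgebra.ι ℂ X * z = z * UniversalEnvelopingAlgebra.ι ℂ X) :
    z ∈ Subalgebra.center ℂ (UniversalEnvelopingAlgebra ℂ g) := by
  have h : Algebra.adjoin ℂ (Set.range (UniversalEnvelopingAlgebra.ι ℂ : g → _)) ≤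
      Subalgebra.centralizer ℂ {z} := by
    refine Algebra.adjoin_le ?_
    rintro _ ⟨X, rfl⟩
    rw [SetLike.mem_coe, Subalgebra.mem_centralizer_iff]
    rintro _ rfl
    exact (hz X).symm
  rw [adjoin_range_ι] at h
  rw [Subalgebra.mem_center_iff]
  intro b
  have := h (Algebra.mem_top (x := b))
  rw [Subalgebra.mem_centralizer_iff] at this
  exact (this z rfl).symm

theorem capelli_mem_center (u : ℂ) : capelli m u ∈ Subalgebra.center ℂ (UG m) := by
  refine mem_center_of_comm fun X => ?_
  rw [sum_E X, capelli_eq]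
  simp only [map_sum, map_smul, Finset.sum_mul, Finset.mul_sum, smul_mul_assoc, mul_smul_comm]
  refine Finset.sum_congr rfl fun i _ => Finset.sum_congr rfl fun j _ => ?_
  congr 1
  exact qdet_inl_comm glRel_gU i j u

/-- The matrix units of `k`, and `0` outside the diagonal blocks. -/
def kE (i j : Fin (m + 3)) : kAlg m :=
  if h : (i = iL m ↔ j = iL m) then ⟨E i j, fun a b hab => by
    rw [E_apply, if_neg]
    rintro ⟨rfl, rfl⟩
    exact hab h⟩ else 0

theorem coe_kE (i j : Fin (m + 3)) :
    ((kE i j : kAlg m) : Gl m) = if (i = iL m ↔ j = iL m) then E i j else 0 := by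
  by_cases h : (i = iL m ↔ j = iL m)
  · rw [if_pos h, kE, dif_pos h]
  · rw [if_neg h, kE, dif_neg h]; rfl

theorem castSucc_ne_iL (j : Fin (m + 2)) : j.castSucc ≠ iL m := (Fin.castSucc_lt_last j).ne

theorem coe_kE_castSucc (i j : Fin (m + 2)) :
    ((kE i.castSucc j.castSucc : kAlg m) : Gl m) = E i.castSucc j.castSucc := by
  rw [coe_kE, if_pos (by simp [castSucc_ne_iL])]

theorem coe_kE_last : ((kE (iL m) (iL m) : kAlg m) : Gl m) = E (iL m) (iL m) := by
  rw [coe_kE, if_pos (by simp)]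

theorem kE_last_castSucc (j : Fin (m + 2)) : (kE (iL m) j.castSucc : kAlg m) = 0 := by
  rw [kE, dif_neg (by simp [castSucc_ne_iL])]

theorem kE_castSucc_last (j : Fin (m + 2)) : (kE j.castSucc (iL m) : kAlg m) = 0 := by
  rw [kE, dif_neg (by simp [castSucc_ne_iL])]

theorem kE_lie (i j k l : Fin (m + 2)) :
    (⁅(kE i.castSucc j.castSucc : kAlg m), kE k.castSucc l.castSucc⁆ : kAlg m) =
    (if j = k then kE i.castSucc l.castSucc else 0) -
      (if l = i then kE k.castSucc j.castSucc else 0) := by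
  apply Subtype.ext
  rw [LieSubalgebra.coe_bracket, coe_kE_castSucc, coe_kE_castSucc, E_lie]
  simp only [Fin.castSucc_inj]
  by_cases h1 : j = k <;> by_cases h2 : l = i <;> simp [h1, h2, coe_kE_castSucc]

theorem kE_lie_last (i j : Fin (m + 2)) :
    (⁅(kE (iL m) (iL m) : kAlg m), kE i.castSucc j.castSucc⁆ : kAlg m) = 0 := by
  apply Subtype.ext
  rw [LieSubalgebra.coe_bracket, coe_kE_castSucc, coe_kE_last, E_lie]
  simp [castSucc_ne_iL, (castSucc_ne_iL _).symm]

theorem sum_kE (X : kAlg m) : X = ∑ i, ∑ j, (X : Gl m) i j • (kE i j : kAlg m) := by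
  apply Subtype.ext
  change (X : Gl m) = (kAlg m).incl _
  conv_lhs => rw [sum_E (X : Gl m)]
  simp only [map_sum, map_smul]
  refine Finset.sum_congr rfl fun i _ => Finset.sum_congr rfl fun j _ => ?_
  change _ = _ • ((kE i j : kAlg m) : Gl m)
  rw [coe_kE]
  split_ifs with h
  · rfl
  · rw [X.2 i j h, zero_smul, zero_smul]

/-- The matrix units in `U(k)`, in the first `n` columns. -/
def kU (i : Fin (m + 3)) (j : Fin (m + 2)) : UK m := UniversalEnvelopingAlgebra.ι ℂ (kE i j.castSucc)

/-- The matrix units in row n+1 of the first n columns are zero in `kE`. The relations survive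
because neither side can then contribute. -/
theorem glRel_kU : GlRel (kU (m := m)) Fin.castSucc := by
  intro i j k l
  have h := LieHom.map_lie (UniversalEnvelopingAlgebra.ι ℂ) (kE i j.castSucc : kAlg m)
    (kE k l.castSucc)
  rw [LieRing.of_associative_ring_bracket] at h
  rw [kU, kU, ← h]
  induction i using Fin.lastCases with
  | last =>
    have e : (kE (Fin.last (m + 2)) j.castSucc : kAlg m) = 0 := kE_last_castSucc j
    have e' : (kE (Fin.last (m + 2)) l.castSucc : kAlg m) = 0 := kE_last_castSucc l
    rw [if_neg (castSucc_ne_iL l), kU, e, e', zero_lie]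
    simp
  | cast i =>
    induction k using Fin.lastCases with
    | last =>
      have e : (kE (Fin.last (m + 2)) j.castSucc : kAlg m) = 0 := kE_last_castSucc j
      have e' : (kE (Fin.last (m + 2)) l.castSucc : kAlg m) = 0 := kE_last_castSucc l
      rw [if_neg (castSucc_ne_iL j), kU, e, e', lie_zero]
      simp
    | cast k =>
      rw [kE_lie, map_sub]
      simp only [Fin.castSucc_inj]
      congr 1 <;> split_ifs <;> simp [kU]

variable (m) in
/-- The homomorphism `U(k) → U(g)`. -/
def kToG : UK m →ₐ[ℂ] UG m :=
  UniversalEnvelopingAlgebra.lift ℂ ((UniversalEnvelopingAlgebra.ι ℂ).comp (kAlg m).incl)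

theorem kToG_ι (X : kAlg m) : kToG m (UniversalEnvelopingAlgebra.ι ℂ X) =
    UniversalEnvelopingAlgebra.ι ℂ (X : Gl m) := UniversalEnvelopingAlgebra.lift_ι_apply ℂ _ X

theorem GlRel.map {N : ℕ} {C A B : Type*} [DecidableEq C] [Ring A] [Algebra ℂ A] [Ring B] [Algebra ℂ B]
    {M : Fin N → C → A} {c : C → Fin N} (h : GlRel M c) (f : A →ₐ[ℂ] B) :
    GlRel (fun i j => f (M i j)) c := by
  intro i j k l
  rw [← map_mul, ← map_mul, ← map_sub, h, map_sub]
  congr 1 <;> split_ifs <;> simp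

/-- Row n+1 is zero on one side and E_{n+1,j} on the other, but the basis vector with that index
makes the row irrelevant. -/
theorem kToG_qdet (W : Fin (m + 3) → Fin (m + 2) ⊕ Fin (m + 3)) (hW : W (iL m) = Sum.inr (iL m))
    (u : ℂ) : kToG m (qdet kU Fin.castSucc W u) =
      qdet (fun i j => gU i j.castSucc) Fin.castSucc W u := by
  rw [map_qdet]
  have e : W = Function.update W (iL m) (Sum.inr (iL m)) := by rw [← hW, Function.update_eq_self]
  rw [e]
  refine qdet_congr (glRel_kU.map _) glRel_gU.castSucc (i := iL m) (fun a j ha => ?_) W (iL m) u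
  obtain ⟨a, rfl⟩ := Fin.exists_castSucc_eq.2 ha
  rw [kU, kToG_ι, coe_kE_castSucc]
  rfl

theorem kToG_minor (u : ℂ) : kToG m (minor kU u) = minor (fun i j => gU i j.castSucc) u :=
  kToG_qdet _ baseWord_last u

theorem kToG_cof (i j : Fin (m + 2)) (u : ℂ) :
    kToG m (cof kU i j u) = cof (fun i j => gU i j.castSucc) i j u := by
  refine kToG_qdet _ ?_ _
  rw [Function.update_of_ne (castSucc_ne_iL j).symm]
  exact baseWord_last

variable {V : Type*} [AddCommGroup V] [Module ℂ V] [LieRingModule (kAlg m) V]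
  [LieModule ℂ (kAlg m) V] {W : Type*} [NormedAddCommGroup W] [NormedSpace ℂ W]

variable (V) in
/-- The action of `U(k)`. -/
def actK : UK m →ₐ[ℂ] Module.End ℂ V :=
  UniversalEnvelopingAlgebra.lift ℂ (LieModule.toEnd ℂ (kAlg m) V)

theorem actK_ι (X : kAlg m) (v : V) : actK V (UniversalEnvelopingAlgebra.ι ℂ X) v = ⁅X, v⁆ := by
  rw [actK, UniversalEnvelopingAlgebra.lift_ι_apply]
  rfl

/-- `(v, z) ↦ (z · φ)(v)`. -/
def evAct (φ : SmoothHom V W) : V →ₗ[ℂ] UG m →ₗ[ℂ] SmoothA W :=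
  LinearMap.mk₂ ℂ (fun v z => envAct m V W z φ v) (fun v v' z => map_add _ v v')
    (fun c v z => map_smul _ c v)
    (fun v z z' => by rw [map_add, LinearMap.add_apply, LinearMap.add_apply])
    (fun c v z => by rw [map_smul, LinearMap.smul_apply, LinearMap.smul_apply])

theorem evAct_apply (φ : SmoothHom V W) (v : V) (z : UG m) :
    evAct φ v z = envAct m V W z φ v := rfl

theorem evAct_mul_ι (X : kAlg m) (z : UG m) (φ : SmoothHom V W) (v : V) :
    evAct φ v (z * UniversalEnvelopingAlgebra.ι ℂ (X : Gl m)) = evAct φ ⁅X, v⁆ z := by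
  rw [evAct_apply, isAct_envAct.mul_k]
  rfl

/-- Turns the minors and cofactors, which stand on the right in the expansions of the Capelli
element, into operators on `V`. -/
theorem evAct_mul_kToG (x : UK m) (z : UG m) (φ : SmoothHom V W) (v : V) :
    evAct φ v (z * kToG m x) = evAct φ (actK V x v) z := by
  have hx : x ∈ Algebra.adjoin ℂ (Set.range (UniversalEnvelopingAlgebra.ι ℂ : kAlg m → _)) := by
    rw [adjoin_range_ι]; exact Algebra.mem_top
  induction hx using Algebra.adjoin_induction generalizing z v with
  | mem x hx =>
    obtain ⟨X, rfl⟩ := hx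
    rw [kToG_ι, evAct_mul_ι, actK_ι]
  | algebraMap r =>
    rw [AlgHom.commutes, AlgHom.commutes, ← Algebra.commutes, ← Algebra.smul_def, map_smul,
      Module.algebraMap_end_apply, map_smul]
    rfl
  | add x y _ _ hx hy =>
    rw [map_add, map_add, mul_add, map_add, hx, hy, LinearMap.add_apply, map_add]
    rfl
  | mul x y _ _ hx hy =>
    rw [map_mul (kToG m), ← mul_assoc, hy, hx, map_mul (actK V)]
    rfl

theorem evAct_capelli (u : ℂ) (φ : SmoothHom V W) (v : V) : evAct φ v (capelli m u) =
    evAct φ (actK V (minor (kU (m := m)) u) v)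
      (gU (iL m) (iL m) + algebraMap ℂ _ (u + (m + 2 : ℕ))) -
    ∑ i : Fin (m + 2), ∑ j : Fin (m + 2),
      evAct φ (actK V (cof (kU (m := m)) i j u) v)
        (gU i.castSucc (iL m) * gU (iL m) j.castSucc) := by
  rw [← evAct_mul_kToG, kToG_minor, capelli_eq, qdet_inl_expand glRel_gU, map_sub]
  simp only [map_sum]
  congr 1
  refine Finset.sum_congr rfl fun i _ => Finset.sum_congr rfl fun j _ => ?_
  rw [← evAct_mul_kToG, kToG_cof]

/-- The order E_{n+1,j} E_{i,n+1} is the one produced by P⁻ ∘ P⁺; the order in `evAct_capelli` is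
the one produced by P⁺ ∘ P⁻. -/
theorem evAct_capelli' (u : ℂ) (φ : SmoothHom V W) (v : V) : evAct φ v (capelli m u) =
    evAct φ (actK V (minor (kU (m := m)) (u + 1)) v) (gU (iL m) (iL m) + algebraMap ℂ _ u) -
    ∑ i : Fin (m + 2), ∑ j : Fin (m + 2),
      evAct φ (actK V (cof (kU (m := m)) i j u) v)
        (gU (iL m) j.castSucc * gU i.castSucc (iL m)) := by
  rw [← evAct_mul_kToG, kToG_minor, capelli_eq, qdet_inl_expand' glRel_gU (by omega), map_sub]
  simp only [map_sum]
  congr 1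
  refine Finset.sum_congr rfl fun i _ => Finset.sum_congr rfl fun j _ => ?_
  rw [← evAct_mul_kToG, kToG_cof]

end env
end
end ShiftOps

namespace ShiftOps
noncomputable section

/-! ### Highest weight vectors, and vanishing of stable spaces of operators. -/

section highest
variable {m : ℕ} {V : Type*} [AddCommGroup V] [Module ℂ V] [LieRingModule (kAlg m) V]
  [LieModule ℂ (kAlg m) V]

/-- An irreducible representation of `k` with a highest weight vector `v` of weight `lam`, and the
functional `f` that projects to the highest weight space. -/
structure HighestWeight (lam : Weight m) (v : V) (f : V →ₗ[ℂ] ℂ) : Prop where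
  irr : LieModule.IsIrreducible ℂ (kAlg m) V
  up : ∀ i j : Fin (m + 2), i < j → ⁅(kE i.castSucc j.castSucc : kAlg m), v⁆ = 0
  diag : ∀ i : Fin (m + 3), ⁅(kE i i : kAlg m), v⁆ = (lam i : ℂ) • v
  apply_self : f v = 1
  apply_low : ∀ i j : Fin (m + 2), j < i → ∀ x, f ⁅(kE i.castSucc j.castSucc : kAlg m), x⁆ = 0
  apply_diag : ∀ i x, f ⁅(kE i i : kAlg m), x⁆ = (lam i : ℂ) * f x
  eq_smul : ∀ x, (∀ i, ⁅(kE i i : kAlg m), x⁆ = (lam i : ℂ) • x) → x = f x • v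

/-- The upper triangular part of an element of `k`. -/
def upperPart (m : ℕ) : kAlg m →ₗ[ℂ] kAlg m where
  toFun X := ⟨Matrix.of fun i j => if j < i then 0 else (X : Gl m) i j, fun i j h => by
    rw [Matrix.of_apply, X.2 i j h, ite_self]⟩
  map_add' X Y := by
    apply Subtype.ext
    ext i j
    change (if j < i then (0 : ℂ) else (X : Gl m) i j + (Y : Gl m) i j) =
      (if j < i then (0 : ℂ) else (X : Gl m) i j) + if j < i then (0 : ℂ) else (Y : Gl m) i j
    split_ifs <;> simp
  map_smul' c X := by
    apply Subtype.ext
    ext i j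
    change (if j < i then (0 : ℂ) else c * (X : Gl m) i j) =
      c * if j < i then (0 : ℂ) else (X : Gl m) i j
    split_ifs <;> simp

theorem upperPart_apply (X : kAlg m) (i j : Fin (m + 3)) :
    (upperPart m X : Gl m) i j = if j < i then 0 else (X : Gl m) i j := rfl

theorem upperPart_upperPart (X : kAlg m) : upperPart m (upperPart m X) = upperPart m X := by
  apply Subtype.ext
  ext i j
  simp only [upperPart_apply]
  split_ifs <;> rfl

theorem kE_self (i : Fin (m + 3)) : ((kE i i : kAlg m) : Gl m) = E i i := by
  rw [coe_kE, if_pos Iff.rfl]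

/-- The element of `k` whose eigenvalues grade `k` by height. -/
def grading (m : ℕ) : kAlg m := ⟨Matrix.diagonal fun i => -(i.val : ℂ), fun i j h =>
  Matrix.diagonal_apply_ne _ fun e => h (by rw [e])⟩

theorem grading_lie (i j : Fin (m + 3)) :
    (⁅grading m, kE i j⁆ : kAlg m) = ((j.val : ℂ) - i.val) • kE i j := by
  apply Subtype.ext
  change (⁅(grading m : Gl m), ((kE i j : kAlg m) : Gl m)⁆ : Gl m) =
    ((j.val : ℂ) - i.val) • ((kE i j : kAlg m) : Gl m)
  rw [coe_kE]
  split_ifs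
  · rw [LieRing.of_associative_ring_bracket]
    change Matrix.diagonal _ * _ - _ * Matrix.diagonal _ = _
    ext a b
    rw [Matrix.sub_apply, Matrix.diagonal_mul, Matrix.mul_diagonal, Matrix.smul_apply, E_apply]
    split_ifs with h
    · rw [← h.1, ← h.2, smul_eq_mul]; ring
    · simp
  · simp

theorem exists_actK_eq (hV : LieModule.IsIrreducible ℂ (kAlg m) V) {v : V} (hv : v ≠ 0) (w : V) :
    ∃ u : UK m, actK V u v = w := by
  let R : LieSubmodule ℂ (kAlg m) V :=
    { LinearMap.range ((LinearMap.applyₗ v) ∘ₗ (actK (m := m) V).toLinearMap) with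
      lie_mem := by
        rintro X _ ⟨u, rfl⟩
        refine ⟨UniversalEnvelopingAlgebra.ι ℂ X * u, ?_⟩
        change actK V (UniversalEnvelopingAlgebra.ι ℂ X * u) v = ⁅X, actK V u v⁆
        rw [map_mul, Module.End.mul_apply, actK_ι] }
  have hvR : v ∈ R := ⟨1, by
    change actK V (1 : UK m) v = v
    rw [map_one]; rfl⟩
  have hR : R = ⊤ := by
    refine (eq_bot_or_eq_top R).resolve_left fun e => hv ?_
    rw [e] at hvR
    exact (LieSubmodule.mem_bot v).1 hvR
  have hw : w ∈ R := hR ▸ LieSubmodule.mem_top w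
  exact hw

/-- V is the direct sum of ℂv and a space L of vectors of lower degree for the element `grading`,
and `f` is the projection along L. Neither finite dimension nor complete reducibility is needed. -/
theorem exists_functional (hV : LieModule.IsIrreducible ℂ (kAlg m) V) (lam : Weight m) {v : V}
    (hv : v ≠ 0) (h : ∀ X : kAlg m, (∀ i j, j < i → (X : Gl m) i j = 0) →
      ⁅X, v⁆ = (∑ i, (lam i : ℂ) * (X : Gl m) i i) • v) : ∃ f, HighestWeight lam v f := by
  have hdiag : ∀ i : Fin (m + 3), ⁅(kE i i : kAlg m), v⁆ = (lam i : ℂ) • v := by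
    intro i
    rw [h, Finset.sum_eq_single i]
    · rw [kE_self, E_apply]; simp
    · intro j _ hj
      rw [kE_self, E_apply, if_neg (fun e => hj e.1.symm), mul_zero]
    · simp
    · intro a b hab
      rw [kE_self, E_apply, if_neg]
      rintro ⟨rfl, rfl⟩
      exact lt_irrefl _ hab
  have hup : ∀ i j : Fin (m + 2), i < j → ⁅(kE i.castSucc j.castSucc : kAlg m), v⁆ = 0 := by
    intro i j hij
    rw [h, Finset.sum_eq_zero, zero_smul]
    · intro a _
      rw [coe_kE_castSucc, E_apply, if_neg, mul_zero]
      rintro ⟨rfl, e⟩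
      exact hij.ne' (Fin.castSucc_injective _ e)
    · intro a b hab
      rw [coe_kE_castSucc, E_apply, if_neg]
      rintro ⟨rfl, rfl⟩
      exact lt_asymm hij (by simpa using hab)
  let T : Module.End ℂ V := LieModule.toEnd ℂ (kAlg m) V (grading m)
  obtain ⟨c, hc⟩ : ∃ c : ℂ, ⁅grading m, v⁆ = c • v :=
    ⟨_, h _ fun i j hij => Matrix.diagonal_apply_ne _ hij.ne'⟩
  have hT : ∀ μ x, x ∈ T.eigenspace μ ↔ ⁅grading m, x⁆ = μ • x := fun μ x =>
    Module.End.mem_eigenspace_iff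
  -- A lower triangular matrix unit lowers the eigenvalue of `grading` by a positive integer.
  let L : Submodule ℂ V := ⨆ d : ℕ, T.eigenspace (c - (d + 1))
  have shift : ∀ i j μ x, x ∈ T.eigenspace μ →
      ⁅(kE i j : kAlg m), x⁆ ∈ T.eigenspace (μ + ((j.val : ℂ) - i.val)) := by
    intro i j μ x hx
    rw [hT] at hx ⊢
    rw [leibniz_lie, grading_lie, hx, smul_lie, lie_smul, ← add_smul, add_comm]
  have hvL : v ∈ T.eigenspace c := (hT _ _).2 hc
  have dis : Disjoint (T.eigenspace c) L := by
    refine (Module.End.eigenspaces_iSupIndep T c).mono_right (iSup_le fun d => ?_)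
    refine le_iSup₂_of_le (c - (d + 1)) ?_ le_rfl
    intro e
    have : ((d : ℂ) + 1) = 0 := by linear_combination -e
    exact Nat.cast_add_one_ne_zero d this
  have low1 : ∀ (i j : Fin (m + 3)) (hij : j < i) (d : ℕ) (x : V), x ∈ T.eigenspace (c - d) →
      ⁅(kE i j : kAlg m), x⁆ ∈ L := by
    intro i j hij d x hx
    obtain ⟨e, he⟩ : ∃ e : ℕ, i.val = j.val + (e + 1) := ⟨i.val - j.val - 1, by
      have : j.val < i.val := hij
      omega⟩
    have := shift i j _ x hx
    refine Submodule.mem_iSup_of_mem (d + e) ?_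
    convert this using 2
    rw [he]; push_cast; ring
  have lowL : ∀ (i j : Fin (m + 3)) (hij : j < i) (x : V), x ∈ L → ⁅(kE i j : kAlg m), x⁆ ∈ L := by
    intro i j hij x hx
    have hle : L ≤ L.comap (LieModule.toEnd ℂ (kAlg m) V (kE i j)) := by
      refine iSup_le fun d x hx => ?_
      exact low1 i j hij (d + 1) x (by simpa using hx)
    exact hle hx
  have lowv : ∀ (i j : Fin (m + 3)) (hij : j < i), ⁅(kE i j : kAlg m), v⁆ ∈ L := fun i j hij =>
    low1 i j hij 0 v (by simpa using hvL)
  have diagL : ∀ (i : Fin (m + 3)) (x : V), x ∈ L → ⁅(kE i i : kAlg m), x⁆ ∈ L := by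
    intro i x hx
    have hle : L ≤ L.comap (LieModule.toEnd ℂ (kAlg m) V (kE i i)) := by
      refine iSup_le fun d x hx => ?_
      refine Submodule.mem_iSup_of_mem d ?_
      have := shift i i _ x hx
      rwa [sub_self, add_zero] at this
    exact hle hx
  let P : Submodule ℂ V := ℂ ∙ v ⊔ L
  have lowP : ∀ (i j : Fin (m + 3)) (hij : j < i) (x : V), x ∈ P → ⁅(kE i j : kAlg m), x⁆ ∈ L := by
    intro i j hij x hx
    obtain ⟨y, hy, z, hz, rfl⟩ := Submodule.mem_sup.1 hx
    obtain ⟨a, rfl⟩ := Submodule.mem_span_singleton.1 hy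
    rw [lie_add, lie_smul]
    exact L.add_mem (L.smul_mem _ (lowv i j hij)) (lowL i j hij z hz)
  -- U(k) is generated from 1 by strictly lower triangular factors on the left, which map P to L,
  -- and upper triangular factors on the right, which act on `v` by scalars.
  have hS : (P.comap ((LinearMap.applyₗ v) ∘ₗ (actK (m := m) V).toLinearMap)) = ⊤ := by
    refine submodule_eq_top _ (upperPart m) upperPart_upperPart ?_ ?_ ?_
    · change actK V 1 v ∈ P
      rw [map_one]
      exact Submodule.mem_sup_left (Submodule.mem_span_singleton_self v)
    · intro X u hX (hu : actK V u v ∈ P)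
      change actK V (UniversalEnvelopingAlgebra.ι ℂ X * u) v ∈ P
      rw [map_mul, Module.End.mul_apply, actK_ι, sum_kE X]
      simp only [sum_lie, smul_lie]
      refine Submodule.mem_sup_right (L.sum_mem fun i _ => L.sum_mem fun j _ => ?_)
      by_cases hij : j < i
      · exact L.smul_mem _ (lowP i j hij _ hu)
      · have := upperPart_apply X i j
        rw [if_neg hij, hX] at this
        rw [← this]
        change (0 : ℂ) • _ ∈ L
        rw [zero_smul]
        exact L.zero_mem
    · intro X u hX (hu : actK V u v ∈ P)
      change actK V (u * UniversalEnvelopingAlgebra.ι ℂ X) v ∈ P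
      rw [map_mul, Module.End.mul_apply, actK_ι, h X, map_smul]
      · exact P.smul_mem _ hu
      · intro i j hij
        rw [← hX, upperPart_apply, if_pos hij]
  have hP : P = ⊤ := by
    rw [eq_top_iff]
    intro x _
    obtain ⟨u, rfl⟩ := exists_actK_eq hV hv x
    exact (hS ▸ Submodule.mem_top : u ∈ P.comap ((LinearMap.applyₗ v) ∘ₗ (actK (m := m) V).toLinearMap))
  have hvnL : v ∉ L := fun e => hv (Submodule.disjoint_def.1 dis v hvL e)
  obtain ⟨g, hg, hgL⟩ := Submodule.exists_le_ker_of_notMem hvnL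
  have hgL' : ∀ x ∈ L, g x = 0 := fun x hx => hgL hx
  have dec : ∀ x : V, ∃ a : ℂ, ∃ y ∈ L, x = a • v + y := by
    intro x
    have hx : x ∈ P := hP ▸ Submodule.mem_top
    obtain ⟨y, hy, z, hz, rfl⟩ := Submodule.mem_sup.1 hx
    obtain ⟨a, rfl⟩ := Submodule.mem_span_singleton.1 hy
    exact ⟨a, z, hz, rfl⟩
  have hf : ∀ (a : ℂ) (y : V), y ∈ L → ((g v)⁻¹ • g) (a • v + y) = a := by
    intro a y hy
    rw [LinearMap.smul_apply, map_add, hgL' y hy, map_smul, smul_eq_mul, smul_eq_mul]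
    field_simp
    ring
  refine ⟨(g v)⁻¹ • g, hV, hup, hdiag, ?_, ?_, ?_, ?_⟩
  · simpa using hf 1 0 L.zero_mem
  · intro i j hij x
    have := hf 0 _ (lowP i.castSucc j.castSucc (by simpa using hij) x (hP ▸ Submodule.mem_top))
    simpa using this
  · intro i x
    obtain ⟨a, y, hy, rfl⟩ := dec x
    rw [hf a y hy, lie_add, lie_smul, hdiag, smul_smul, hf _ _ (diagL i y hy), mul_comm]
  · intro x hx
    obtain ⟨a, y, hy, rfl⟩ := dec x
    rw [hf a y hy]
    have ey : ∀ i, ⁅(kE i i : kAlg m), y⁆ = (lam i : ℂ) • y := by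
      intro i
      have := hx i
      rw [lie_add, lie_smul, hdiag, smul_add, smul_comm a] at this
      exact add_left_cancel this
    have eg : grading m = ∑ i : Fin (m + 3), (-(i.val : ℂ)) • kE i i := by
      conv_lhs => rw [sum_kE (grading m)]
      refine Finset.sum_congr rfl fun i _ => ?_
      rw [Finset.sum_eq_single i]
      · congr 1
        exact Matrix.diagonal_apply_eq _ i
      · intro j _ hj
        have : (grading m : Gl m) i j = 0 := Matrix.diagonal_apply_ne _ hj.symm
        rw [this, zero_smul]
      · simp
    -- `grading` is a combination of the diagonal units, so `y` has the same degree as `v`; but it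
    -- lies in L, whose degrees are strictly lower.
    have hy' : ⁅grading m, y⁆ = c • y := by
      have e1 : ∀ z : V, (∀ i, ⁅(kE i i : kAlg m), z⁆ = (lam i : ℂ) • z) → ⁅grading m, z⁆ =
          (∑ i : Fin (m + 3), (-(i.val : ℂ)) * lam i) • z := by
        intro z hz
        rw [eg, sum_lie, Finset.sum_smul]
        refine Finset.sum_congr rfl fun i _ => ?_
        rw [smul_lie, hz, smul_smul]
      have e2 := e1 v hdiag
      rw [hc] at e2
      rw [e1 y ey, smul_left_injective ℂ hv e2]
    have : y = 0 := Submodule.disjoint_def.1 dis y ((hT _ _).2 hy') hy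
    rw [this, add_zero]

variable {V' : Type*} [AddCommGroup V'] [Module ℂ V'] [LieRingModule (kAlg m) V']
  [LieModule ℂ (kAlg m) V']

theorem mem_of_kE {P : Submodule ℂ (kAlg m)}
    (h : ∀ a b : Fin (m + 2), kE a.castSucc b.castSucc ∈ P) (hL : kE (iL m) (iL m) ∈ P)
    (X : kAlg m) : X ∈ P := by
  rw [sum_kE X]
  refine P.sum_mem fun i _ => P.sum_mem fun j _ => P.smul_mem _ ?_
  induction i using Fin.lastCases with
  | last =>
    induction j using Fin.lastCases with
    | last => exact hL
    | cast j => rw [kE_last_castSucc]; exact P.zero_mem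
  | cast i =>
    induction j using Fin.lastCases with
    | last => rw [kE_castSucc_last]; exact P.zero_mem
    | cast j => exact h i j

namespace HighestWeight
variable {lam lam' : Weight m} {v : V} {f : V →ₗ[ℂ] ℂ} {v' : V'} {f' : V' →ₗ[ℂ] ℂ}

theorem ne_zero (H : HighestWeight lam v f) : v ≠ 0 := fun e => by
  have := H.apply_self
  rw [e, map_zero] at this
  exact zero_ne_one this

theorem eq_top (H : HighestWeight lam v f) (N : LieSubmodule ℂ (kAlg m) V) (hN : N ≠ ⊥) (x : V) :
    x ∈ N := by
  have := H.irr
  rw [(eq_bot_or_eq_top N).resolve_left hN]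
  exact LieSubmodule.mem_top x

/-- Schur's lemma for operators with a known value on the highest weight vector. -/
theorem schur (H : HighestWeight lam v f) (T : Module.End ℂ V) (c : ℂ)
    (hT : ∀ (X : kAlg m) x, T ⁅X, x⁆ = ⁅X, T x⁆) (hc : T v = c • v) (x : V) : T x = c • x := by
  let N : LieSubmodule ℂ (kAlg m) V :=
    { LinearMap.eqLocus T (c • LinearMap.id) with
      lie_mem := by
        intro X x hx
        change T x = c • x at hx
        change T ⁅X, x⁆ = c • ⁅X, x⁆
        rw [hT, hx, lie_smul] }
  refine H.eq_top N (fun e => H.ne_zero ?_) x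
  rw [← LieSubmodule.mem_bot (R := ℂ) (L := kAlg m), ← e]
  exact hc

/-- E_{n+1,n+1} is central in k, so Schur's lemma applies. -/
theorem last_smul (H : HighestWeight lam v f) (x : V) :
    ⁅(kE (iL m) (iL m) : kAlg m), x⁆ = (lam (iL m) : ℂ) • x := by
  refine H.schur (LieModule.toEnd ℂ (kAlg m) V (kE (iL m) (iL m))) _ ?_ (H.diag _) x
  intro X x
  have : (⁅(kE (iL m) (iL m) : kAlg m), X⁆ : kAlg m) = 0 := by
    have := mem_of_kE (P := LinearMap.ker (LieModule.toEnd ℂ (kAlg m) (kAlg m) (kE (iL m) (iL m))))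
      (fun a b => kE_lie_last a b) (lie_self _) X
    exact this
  change ⁅_, ⁅X, x⁆⁆ = ⁅X, ⁅_, x⁆⁆
  rw [leibniz_lie, this, zero_lie, zero_add]

/-- A `k`-stable space of operators vanishes if it has no component from highest weight vector to
highest weight vector. -/
theorem eq_zero_of_stable (H : HighestWeight lam v f) (H' : HighestWeight lam' v' f')
    (P : Submodule ℂ (V →ₗ[ℂ] V'))
    (hP : ∀ T ∈ P, ∀ X : kAlg m, ∃ T' ∈ P, ∀ x, T ⁅X, x⁆ = ⁅X, T x⁆ + T' x)
    (h0 : ∀ T ∈ P, f' (T v) = 0) {T : V →ₗ[ℂ] V'} (hT : T ∈ P) : T = 0 := by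
  -- Strictly lower triangular factors on the left move through `T`, at the cost of another element
  -- of P, and are then killed by `f'`. Upper triangular ones on the right multiply `v` by a scalar.
  have hv : ∀ u : UK m, ∀ T ∈ P, f' (T (actK V u v)) = 0 := by
    let S : Submodule ℂ (UK m) :=
      { carrier := {u | ∀ T ∈ P, f' (T (actK V u v)) = 0}
        add_mem' := fun {a b} ha hb T hT => by
          rw [map_add, LinearMap.add_apply, map_add, map_add, ha T hT, hb T hT, add_zero]
        zero_mem' := fun T _ => by simp
        smul_mem' := fun c a ha T hT => by
          rw [map_smul, LinearMap.smul_apply, map_smul, map_smul, ha T hT, smul_zero] }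
    have hS : S = ⊤ := by
      refine submodule_eq_top _ (upperPart m) upperPart_upperPart ?_ ?_ ?_
      · intro T hT
        rw [map_one]
        exact h0 T hT
      · intro X u hX hu T hT
        obtain ⟨T', hT', e⟩ := hP T hT X
        rw [map_mul, Module.End.mul_apply, actK_ι, e, map_add, hu T' hT', add_zero, sum_kE X]
        simp only [sum_lie, smul_lie, map_sum, map_smul]
        refine Finset.sum_eq_zero fun i _ => Finset.sum_eq_zero fun j _ => ?_
        by_cases hij : j < i
        · induction i using Fin.lastCases with
          | last =>
            rcases Fin.eq_castSucc_or_eq_last j with ⟨j, rfl⟩ | rfl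
            · rw [kE_last_castSucc]; simp
            · exact absurd hij (lt_irrefl _)
          | cast i =>
            rcases Fin.eq_castSucc_or_eq_last j with ⟨j, rfl⟩ | rfl
            · rw [H'.apply_low i j (by simpa using hij), smul_zero]
            · rw [kE_castSucc_last]; simp
        · have := upperPart_apply X i j
          rw [if_neg hij, hX] at this
          rw [← this]
          exact zero_mul _
      · intro X u hX hu T hT
        have hXv : ∃ c : ℂ, ⁅X, v⁆ = c • v := by
          refine ⟨∑ i, (X : Gl m) i i * lam i, ?_⟩
          conv_lhs => rw [sum_kE X]
          rw [sum_lie, Finset.sum_smul]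
          refine Finset.sum_congr rfl fun i _ => ?_
          rw [sum_lie, Finset.sum_eq_single i]
          · rw [smul_lie, H.diag, smul_smul]
          · intro j _ hj
            rw [smul_lie]
            rcases lt_or_gt_of_ne hj with hj | hj
            · rw [← hX, upperPart_apply, if_pos hj, zero_smul]
            · induction i using Fin.lastCases with
              | last =>
                rcases Fin.eq_castSucc_or_eq_last j with ⟨j, rfl⟩ | rfl
                · rw [kE_last_castSucc]; simp
                · exact absurd hj (lt_irrefl _)
              | cast i =>
                rcases Fin.eq_castSucc_or_eq_last j with ⟨j, rfl⟩ | rfl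
                · rw [H.up i j (by simpa using hj), smul_zero]
                · rw [kE_castSucc_last]; simp
          · simp
        obtain ⟨c, hc⟩ := hXv
        rw [map_mul, Module.End.mul_apply, actK_ι, hc, map_smul, map_smul, map_smul, hu T hT,
          smul_zero]
    intro u
    exact (hS ▸ Submodule.mem_top : u ∈ S)
  -- The largest submodule inside the kernel of `f'`. It is zero, since `v'` is not in it.
  let N : LieSubmodule ℂ (kAlg m) V' :=
    { carrier := {y | ∀ u : UK m, f' (actK V' u y) = 0}
      add_mem' := fun {a b} ha hb u => by rw [map_add, map_add, ha, hb, add_zero]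
      zero_mem' := fun u => by rw [map_zero, map_zero]
      smul_mem' := fun c a ha u => by rw [map_smul, map_smul, ha, smul_zero]
      lie_mem := fun {X y} hy u => by
        have := hy (u * UniversalEnvelopingAlgebra.ι ℂ X)
        rwa [map_mul, Module.End.mul_apply, actK_ι] at this }
  have hN : N = ⊥ := by
    by_contra hN
    have := H'.eq_top N hN v' (1 : UK m)
    rw [map_one] at this
    exact one_ne_zero (H'.apply_self.symm.trans this)
  -- Here a factor of `u` moves through `T` in the other direction, so that every `T w` lands in N.
  have hTw : ∀ u : UK m, ∀ T ∈ P, ∀ w, f' (actK V' u (T w)) = 0 := by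
    let S : Submodule ℂ (UK m) :=
      { carrier := {u | ∀ T ∈ P, ∀ w, f' (actK V' u (T w)) = 0}
        add_mem' := fun {a b} ha hb T hT w => by
          rw [map_add, LinearMap.add_apply, map_add, ha T hT, hb T hT, add_zero]
        zero_mem' := fun T _ => by simp
        smul_mem' := fun c a ha T hT w => by
          rw [map_smul, LinearMap.smul_apply, map_smul, ha T hT, smul_zero] }
    have hS : S = ⊤ := by
      refine submodule_eq_top _ LinearMap.id (fun _ => rfl) ?_ ?_ ?_
      · intro T hT w
        obtain ⟨u, rfl⟩ := exists_actK_eq H.irr H.ne_zero w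
        rw [map_one]
        exact hv u T hT
      · intro X u (hX : X = 0) hu
        rw [hX, map_zero, zero_mul]
        exact S.zero_mem
      · intro X u _ hu T hT w
        obtain ⟨T', hT', e⟩ := hP T hT X
        rw [map_mul, Module.End.mul_apply, actK_ι, eq_sub_of_add_eq (e w).symm, map_sub, map_sub,
          hu T hT, hu T' hT', sub_zero]
    intro u
    exact (hS ▸ Submodule.mem_top : u ∈ S)
  ext w
  have hw : T w ∈ N := fun u => hTw u T hT w
  rw [hN] at hw
  exact (LieSubmodule.mem_bot _).1 hw

end HighestWeight
end highest
end
end ShiftOps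

namespace ShiftOps
noncomputable section

/-! ### Vector, covector and tensor operators between K-types. -/

section tensors
variable {m : ℕ} {V : Type*} [AddCommGroup V] [Module ℂ V] [LieRingModule (kAlg m) V]
  [LieModule ℂ (kAlg m) V]
  {V' : Type*} [AddCommGroup V'] [Module ℂ V'] [LieRingModule (kAlg m) V']
  [LieModule ℂ (kAlg m) V']
  {V'' : Type*} [AddCommGroup V''] [Module ℂ V''] [LieRingModule (kAlg m) V'']
  [LieModule ℂ (kAlg m) V'']

variable (V) in
/-- The action of the matrix units of `gl_n`. -/
def eK (a b : Fin (m + 2)) : V →ₗ[ℂ] V := LieModule.toEnd ℂ (kAlg m) V (kE a.castSucc b.castSucc)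

theorem eK_apply (a b : Fin (m + 2)) (x : V) :
    eK V a b x = ⁅(kE a.castSucc b.castSucc : kAlg m), x⁆ := rfl

theorem lie_comp (X : kAlg m) (S : V' →ₗ[ℂ] V'') (T : V →ₗ[ℂ] V') :
    ⁅X, S ∘ₗ T⁆ = ⁅X, S⁆ ∘ₗ T + S ∘ₗ ⁅X, T⁆ := by
  ext x
  simp only [LieHom.lie_apply, LinearMap.comp_apply, LinearMap.add_apply, map_sub]
  abel

theorem lie_eK (a b c d : Fin (m + 2)) :
    ⁅(kE a.castSucc b.castSucc : kAlg m), eK V c d⁆ =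
      (if b = c then eK V a d else 0) - (if d = a then eK V c b else 0) := by
  ext x
  rw [LieHom.lie_apply, eK_apply, eK_apply, leibniz_lie, add_sub_cancel_right, kE_lie, sub_lie,
    LinearMap.sub_apply]
  congr 1 <;> split_ifs <;> simp [eK_apply]

theorem lie_last_eK (c d : Fin (m + 2)) : ⁅(kE (iL m) (iL m) : kAlg m), eK V c d⁆ = 0 := by
  ext x
  rw [LieHom.lie_apply, eK_apply, eK_apply, leibniz_lie, add_sub_cancel_right, kE_lie_last, zero_lie]
  rfl

theorem apply_lie (T : V →ₗ[ℂ] V') (X : kAlg m) (x : V) : ⁅X, T x⁆ = T ⁅X, x⁆ + ⁅X, T⁆ x := by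
  rw [LieHom.lie_apply]; abel

/-- `A` transforms like the standard basis of `s ∩ Hom(ℂ, ℂ^n)`, up to duality. -/
structure IsVec (A : Fin (m + 2) → V →ₗ[ℂ] V') : Prop where
  lie : ∀ a b i, ⁅(kE a.castSucc b.castSucc : kAlg m), A i⁆ = if a = i then -A b else 0
  lie_last : ∀ i, ⁅(kE (iL m) (iL m) : kAlg m), A i⁆ = A i

/-- The dual of `IsVec`. -/
structure IsCovec (B : Fin (m + 2) → V →ₗ[ℂ] V') : Prop where
  lie : ∀ a b j, ⁅(kE a.castSucc b.castSucc : kAlg m), B j⁆ = if j = b then B a else 0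
  lie_last : ∀ j, ⁅(kE (iL m) (iL m) : kAlg m), B j⁆ = -B j

/-- `X` transforms like the products `A i * B j`. -/
structure IsTensor (X : Fin (m + 2) → Fin (m + 2) → V →ₗ[ℂ] V') : Prop where
  lie : ∀ a b i j, ⁅(kE a.castSucc b.castSucc : kAlg m), X i j⁆ =
    (if j = b then X i a else 0) - (if a = i then X b j else 0)
  lie_last : ∀ i j, ⁅(kE (iL m) (iL m) : kAlg m), X i j⁆ = 0

theorem IsVec.comp_covec {A : Fin (m + 2) → V' →ₗ[ℂ] V''} {B : Fin (m + 2) → V →ₗ[ℂ] V'}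
    (hA : IsVec A) (hB : IsCovec B) : IsTensor fun i j => A i ∘ₗ B j where
  lie a b i j := by
    rw [lie_comp, hA.lie, hB.lie]
    split_ifs <;> simp [LinearMap.comp_neg, LinearMap.neg_comp]; abel
  lie_last i j := by
    rw [lie_comp, hA.lie_last, hB.lie_last, LinearMap.comp_neg, add_neg_cancel]

theorem IsCovec.comp_vec {A : Fin (m + 2) → V →ₗ[ℂ] V'} {B : Fin (m + 2) → V' →ₗ[ℂ] V''}
    (hA : IsVec A) (hB : IsCovec B) : IsTensor fun i j => B j ∘ₗ A i where
  lie a b i j := by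
    rw [lie_comp, hA.lie, hB.lie]
    split_ifs <;> simp [LinearMap.comp_neg, LinearMap.neg_comp]; abel
  lie_last i j := by
    rw [lie_comp, hA.lie_last, hB.lie_last, LinearMap.neg_comp, neg_add_cancel]

theorem IsTensor.sub_smul {X Y : Fin (m + 2) → Fin (m + 2) → V →ₗ[ℂ] V'} (hX : IsTensor X)
    (hY : IsTensor Y) (c : ℂ) : IsTensor fun i j => X i j - c • Y i j where
  lie a b i j := by
    rw [lie_sub, lie_smul, hX.lie, hY.lie]
    split_ifs <;> module
  lie_last i j := by
    rw [lie_sub, lie_smul, hX.lie_last, hY.lie_last, smul_zero, sub_zero]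

/-- The summed index is contracted invariantly, so the result is again a vector operator and can be
tested on one component by `vec_eq_zero`. -/
theorem IsVec.contract {A : Fin (m + 2) → V →ₗ[ℂ] V'} (hA : IsVec A) (s : ℂ) :
    IsVec fun b => ∑ i, eK V' i b ∘ₗ A i + s • A b where
  lie a b c := by
    simp only [lie_add, lie_sum, lie_smul, lie_comp, lie_eK, hA.lie]
    have e : ∀ i, ((if b = i then eK V' a c else 0) - if c = a then eK V' i b else 0) ∘ₗ A i +
        eK V' i c ∘ₗ (if a = i then -A b else 0) =
        ((if b = i then eK V' a c ∘ₗ A i else 0) - if a = i then eK V' i c ∘ₗ A b else 0) -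
          if a = c then eK V' i b ∘ₗ A i else 0 := by
      intro i
      simp only [eq_comm (a := c) (b := a)]
      split_ifs <;> simp [LinearMap.sub_comp, LinearMap.comp_neg, LinearMap.neg_comp] <;> abel
    rw [Finset.sum_congr rfl fun i _ => e i, Finset.sum_sub_distrib, Finset.sum_sub_distrib,
      Finset.sum_ite_eq, Finset.sum_ite_eq, if_pos (Finset.mem_univ _), if_pos (Finset.mem_univ _),
      sub_self, zero_sub]
    split_ifs
    · rw [smul_neg, neg_add]
    · simp
  lie_last c := by
    simp only [lie_add, lie_sum, lie_smul, lie_comp, lie_last_eK, hA.lie_last, LinearMap.zero_comp,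
      zero_add]

/-- Each of the n commutators contributes one copy of A_b. This converts the relation with E on the
left into one with E on the right. -/
theorem IsVec.comp_eK {A : Fin (m + 2) → V →ₗ[ℂ] V'} (hA : IsVec A) (b : Fin (m + 2)) :
    ∑ i, A i ∘ₗ eK V i b = ∑ i, eK V' i b ∘ₗ A i + ((m + 2 : ℕ) : ℂ) • A b := by
  have e : ∀ i, A i ∘ₗ eK V i b = eK V' i b ∘ₗ A i + A b := by
    intro i
    ext x
    have := apply_lie (A i) (kE i.castSucc b.castSucc) x
    rw [hA.lie, if_pos rfl] at this
    change A i ⁅_, x⁆ = ⁅_, A i x⁆ + A b x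
    rw [this, LinearMap.neg_apply, neg_add_cancel_right]
  rw [Finset.sum_congr rfl fun i _ => e i, Finset.sum_add_distrib, Finset.sum_const,
    Finset.card_univ, Fintype.card_fin, ← Nat.cast_smul_eq_nsmul ℂ]

namespace HighestWeight
variable {lam lam' : Weight m} {v : V} {f : V →ₗ[ℂ] ℂ} {v' : V'} {f' : V' →ₗ[ℂ] ℂ}
  (H : HighestWeight lam v f) (H' : HighestWeight lam' v' f')
include H H'

theorem family_eq_zero {ι : Type*} (Y : ι → V →ₗ[ℂ] V')
    (hE : ∀ s a b, ⁅(kE (Fin.castSucc a) (Fin.castSucc b) : kAlg m), Y s⁆ ∈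
      Submodule.span ℂ (Set.range Y))
    (hL : ∀ s, ⁅(kE (iL m) (iL m) : kAlg m), Y s⁆ ∈ Submodule.span ℂ (Set.range Y))
    (h0 : ∀ s, f' (Y s v) = 0) (s : ι) : Y s = 0 := by
  refine H.eq_zero_of_stable H' (Submodule.span ℂ (Set.range Y)) ?_ ?_ (Submodule.subset_span ⟨s, rfl⟩)
  · intro T hT X
    have key : ⁅X, T⁆ ∈ Submodule.span ℂ (Set.range Y) := by
      induction hT using Submodule.span_induction with
      | mem T hT =>
        obtain ⟨s, rfl⟩ := hT
        let P : Submodule ℂ (kAlg m) :=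
          { carrier := {X | ⁅X, Y s⁆ ∈ Submodule.span ℂ (Set.range Y)}
            add_mem' := fun {a b} ha hb => by
              rw [Set.mem_ofPred_eq, add_lie]; exact Submodule.add_mem _ ha hb
            zero_mem' := by rw [Set.mem_ofPred_eq, zero_lie]; exact Submodule.zero_mem _
            smul_mem' := fun c a ha => by
              rw [Set.mem_ofPred_eq, smul_lie]; exact Submodule.smul_mem _ _ ha }
        exact mem_of_kE (P := P) (hE s) (hL s) X
      | zero => rw [lie_zero]; exact Submodule.zero_mem _
      | add a b _ _ ha hb => rw [lie_add]; exact Submodule.add_mem _ ha hb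
      | smul c a _ ha => rw [lie_smul]; exact Submodule.smul_mem _ _ ha
    refine ⟨-⁅X, T⁆, Submodule.neg_mem _ key, fun x => ?_⟩
    rw [apply_lie, LinearMap.neg_apply, add_neg_cancel_right]
  · intro T hT
    induction hT using Submodule.span_induction with
    | mem T hT =>
      obtain ⟨s, rfl⟩ := hT
      exact h0 s
    | zero => simp
    | add a b _ _ ha hb => rw [LinearMap.add_apply, map_add, ha, hb, add_zero]
    | smul c a _ ha => rw [LinearMap.smul_apply, map_smul, ha, smul_zero]

theorem apply_eq_zero_of_weight {T : V →ₗ[ℂ] V'} {c : ℂ} {a : Fin (m + 3)}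
    (hT : ⁅(kE a a : kAlg m), T⁆ = c • T) (h : (lam' a : ℂ) ≠ lam a + c) : f' (T v) = 0 := by
  have e := H'.apply_diag a (T v)
  rw [apply_lie, hT, H.diag, map_smul, LinearMap.smul_apply, ← add_smul, map_smul, smul_eq_mul] at e
  by_contra h0
  exact h (mul_right_cancel₀ h0 e).symm

theorem vec_apply_eq_zero {A : Fin (m + 2) → V →ₗ[ℂ] V'} (hA : IsVec A) (i : Fin (m + 2))
    (h : lam' i.castSucc = lam i.castSucc) : f' (A i v) = 0 := by
  refine H.apply_eq_zero_of_weight H' (c := -1) (a := i.castSucc) ?_ ?_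
  · rw [hA.lie, if_pos rfl, neg_one_smul]
  · rw [h]; simp

theorem covec_apply_eq_zero {B : Fin (m + 2) → V →ₗ[ℂ] V'} (hB : IsCovec B) (i : Fin (m + 2))
    (h : lam' i.castSucc = lam i.castSucc) : f' (B i v) = 0 := by
  refine H.apply_eq_zero_of_weight H' (c := 1) (a := i.castSucc) ?_ ?_
  · rw [hB.lie, if_pos rfl, one_smul]
  · rw [h]; simp

/-- The span of the components is k-stable, and by weights only A_r can carry the highest weight
vector of V to that of V'. -/
theorem vec_eq_zero {A : Fin (m + 2) → V →ₗ[ℂ] V'} (hA : IsVec A) {r : Fin (m + 2)}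
    (h : ∀ i, i ≠ r → lam' i.castSucc = lam i.castSucc) (h0 : f' (A r v) = 0) (i : Fin (m + 2)) :
    A i = 0 := by
  refine H.family_eq_zero H' A ?_ ?_ ?_ i
  · intro s a b
    rw [hA.lie]
    split_ifs
    · exact Submodule.neg_mem _ (Submodule.subset_span ⟨b, rfl⟩)
    · exact Submodule.zero_mem _
  · intro s
    rw [hA.lie_last]
    exact Submodule.subset_span ⟨s, rfl⟩
  · intro s
    by_cases hs : s = r
    · rw [hs, h0]
    · exact H.vec_apply_eq_zero H' hA s (h s hs)

theorem covec_eq_zero {B : Fin (m + 2) → V →ₗ[ℂ] V'} (hB : IsCovec B) {r : Fin (m + 2)}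
    (h : ∀ i, i ≠ r → lam' i.castSucc = lam i.castSucc) (h0 : f' (B r v) = 0) (i : Fin (m + 2)) :
    B i = 0 := by
  refine H.family_eq_zero H' B ?_ ?_ ?_ i
  · intro s a b
    rw [hB.lie]
    split_ifs
    · exact Submodule.subset_span ⟨a, rfl⟩
    · exact Submodule.zero_mem _
  · intro s
    rw [hB.lie_last]
    exact Submodule.neg_mem _ (Submodule.subset_span ⟨s, rfl⟩)
  · intro s
    by_cases hs : s = r
    · rw [hs, h0]
    · exact H.covec_apply_eq_zero H' hB s (h s hs)

/-- Off-diagonal components shift the weight, so only diagonal ones can join the highest weight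
vectors. -/
theorem tensor_eq_zero {X : Fin (m + 2) → Fin (m + 2) → V →ₗ[ℂ] V'} (hX : IsTensor X)
    (hlam : lam' = lam) (h0 : ∀ i, f' (X i i v) = 0) (i j : Fin (m + 2)) : X i j = 0 := by
  refine H.family_eq_zero H' (fun p : Fin (m + 2) × Fin (m + 2) => X p.1 p.2) ?_ ?_ ?_ (i, j)
  · rintro ⟨i, j⟩ a b
    change ⁅_, X i j⁆ ∈ _
    rw [hX.lie]
    refine Submodule.sub_mem _ ?_ ?_
    · split_ifs
      · exact Submodule.subset_span ⟨(i, a), rfl⟩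
      · exact Submodule.zero_mem _
    · split_ifs
      · exact Submodule.subset_span ⟨(b, j), rfl⟩
      · exact Submodule.zero_mem _
  · rintro ⟨i, j⟩
    change ⁅_, X i j⁆ ∈ _
    rw [hX.lie_last]
    exact Submodule.zero_mem _
  · rintro ⟨i, j⟩
    by_cases hij : i = j
    · subst hij; exact h0 i
    · refine H.apply_eq_zero_of_weight H' (c := -1) (a := i.castSucc) ?_ ?_
      · change ⁅_, X i j⁆ = (-1 : ℂ) • X i j
        rw [hX.lie, if_neg (Ne.symm hij), if_pos rfl, zero_sub, neg_one_smul]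
      · rw [hlam]; simp

/-- A_r v has weight λ', and the corresponding weight space of V' is ℂ v'. -/
theorem vec_apply {A : Fin (m + 2) → V →ₗ[ℂ] V'} (hA : IsVec A) {r : Fin (m + 2)}
    (h : ∀ i, lam i.castSucc = lam' i.castSucc + if i = r then 1 else 0)
    (hL : lam (iL m) = lam' (iL m) - 1) : A r v = f' (A r v) • v' := by
  refine H'.eq_smul _ fun i => ?_
  rw [apply_lie, H.diag, map_smul]
  induction i using Fin.lastCases with
  | last =>
    change _ + ⁅(kE (iL m) (iL m) : kAlg m), A r⁆ v = (lam' (iL m) : ℂ) • _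
    change (lam (iL m) : ℂ) • _ + _ = _
    rw [hA.lie_last, hL]
    push_cast
    module
  | cast i =>
    rw [hA.lie, h]
    split_ifs
    · subst_vars
      rw [LinearMap.neg_apply]; push_cast; module
    · simp

theorem covec_apply {B : Fin (m + 2) → V →ₗ[ℂ] V'} (hB : IsCovec B) {r : Fin (m + 2)}
    (h : ∀ i, lam' i.castSucc = lam i.castSucc + if i = r then 1 else 0)
    (hL : lam' (iL m) = lam (iL m) - 1) : B r v = f' (B r v) • v' := by
  refine H'.eq_smul _ fun i => ?_
  rw [apply_lie, H.diag, map_smul]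
  induction i using Fin.lastCases with
  | last =>
    change _ + ⁅(kE (iL m) (iL m) : kAlg m), B r⁆ v = (lam' (iL m) : ℂ) • _
    change (lam (iL m) : ℂ) • _ + _ = _
    rw [hB.lie_last, hL, LinearMap.neg_apply]
    push_cast
    module
  | cast i =>
    rw [hB.lie, h]
    by_cases hi : r = i
    · subst hi
      simp only [if_true]; push_cast; module
    · rw [if_neg hi, if_neg (Ne.symm hi)]; simp

/-- A vector operator that lowers the `r`-th component of the weight satisfies a first order
relation. -/
theorem vec_contract_eq_zero {A : Fin (m + 2) → V →ₗ[ℂ] V'} (hA : IsVec A) {r : Fin (m + 2)}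
    (h : ∀ i, i ≠ r → lam' i.castSucc = lam i.castSucc) {s : ℂ}
    (hs : (lam' r.castSucc : ℂ) + s = r.val) (b : Fin (m + 2)) :
    ∑ i, eK V' i b ∘ₗ A i + s • A b = 0 := by
  refine H.vec_eq_zero H' (hA.contract s) h ?_ b
  rw [LinearMap.add_apply, LinearMap.sum_apply, map_add, map_sum, LinearMap.smul_apply, map_smul]
  -- On highest weight vectors the term i = r gives λ'_r, each of the r terms i < r gives -1 through
  -- a commutator, and those with i > r are killed by `f'`. The assumption on `s` makes the total
  -- vanish.
  have e : ∀ i, f' ((eK V' i r ∘ₗ A i) v) =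
      ((if i = r then (lam' r.castSucc : ℂ) else 0) - if i < r then 1 else 0) * f' (A r v) := by
    intro i
    rw [LinearMap.comp_apply, eK_apply]
    rcases lt_trichotomy i r with hi | rfl | hi
    · rw [apply_lie, H.up i r hi, map_zero, zero_add, hA.lie, if_pos rfl, if_neg hi.ne, if_pos hi,
        LinearMap.neg_apply, map_neg]
      ring
    · rw [H'.apply_diag, if_pos rfl, if_neg (lt_irrefl _), sub_zero]
    · rw [H'.apply_low i r hi, if_neg hi.ne', if_neg (lt_asymm hi)]
      ring
  rw [Finset.sum_congr rfl fun i _ => e i, ← Finset.sum_mul, Finset.sum_sub_distrib,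
    Finset.sum_ite_eq', if_pos (Finset.mem_univ r), Finset.sum_boole]
  have hc : (Finset.univ.filter fun i => i < r).card = r.val := by
    rw [← Fin.card_Iio r]; congr 1; ext; simp
  rw [hc, smul_eq_mul]
  linear_combination f' (A r v) * hs

end HighestWeight

namespace HighestWeight
variable {lam : Weight m} {v : V} {f : V →ₗ[ℂ] ℂ} (H : HighestWeight lam v f)
include H

/-- Between highest weight vectors the relation is triangular: X_bb occurs with coefficient λ_b + s
- b, and the only other terms are X_ii with i < b. Induction upwards in `b` works except at b = r,
where the value is assumed zero. -/
theorem tensor_eq_zero_left {X : Fin (m + 2) → Fin (m + 2) → V →ₗ[ℂ] V} (hX : IsTensor X) {s : ℂ}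
    (h : ∀ b, ∑ i, eK V i b ∘ₗ X i b + s • X b b = 0) {r : Fin (m + 2)}
    (hs : ∀ b : Fin (m + 2), b ≠ r → (lam b.castSucc : ℂ) + s - b.val ≠ 0) (hr : f (X r r v) = 0)
    (i j : Fin (m + 2)) : X i j = 0 := by
  refine H.tensor_eq_zero H hX rfl (fun b => ?_) i j
  induction b using WellFoundedLT.induction with
  | ind b ih =>
    by_cases hb : b = r
    · rw [hb, hr]
    have e := congrArg f (LinearMap.congr_fun (h b) v)
    rw [LinearMap.add_apply, LinearMap.sum_apply, map_add, map_sum, LinearMap.smul_apply, map_smul,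
      LinearMap.zero_apply, map_zero] at e
    have t : ∀ i, f ((eK V i b ∘ₗ X i b) v) =
        ((if i = b then (lam b.castSucc : ℂ) else 0) - if i < b then 1 else 0) * f (X b b v) := by
      intro i
      rw [LinearMap.comp_apply, eK_apply]
      rcases lt_trichotomy i b with hi | rfl | hi
      · rw [apply_lie, H.up i b hi, map_zero, zero_add, hX.lie, if_pos rfl, if_pos rfl,
          LinearMap.sub_apply, map_sub, ih i hi, if_neg hi.ne, if_pos hi]
        ring
      · rw [H.apply_diag, if_pos rfl, if_neg (lt_irrefl _), sub_zero]
      · rw [H.apply_low i b hi, if_neg hi.ne', if_neg (lt_asymm hi)]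
        ring
    rw [Finset.sum_congr rfl fun i _ => t i, ← Finset.sum_mul, Finset.sum_sub_distrib,
      Finset.sum_ite_eq', if_pos (Finset.mem_univ b), Finset.sum_boole] at e
    have hc : (Finset.univ.filter fun i => i < b).card = b.val := by
      rw [← Fin.card_Iio b]; congr 1; ext; simp
    rw [hc, smul_eq_mul] at e
    refine (mul_eq_zero.1 (?_ : ((lam b.castSucc : ℂ) + s - b.val) * f (X b b v) = 0)).resolve_left
      (hs b hb)
    linear_combination e

/-- With E on the right the terms i > b contribute instead, so the induction runs downwards and the
coefficient counts the larger indices. -/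
theorem tensor_eq_zero_right {X : Fin (m + 2) → Fin (m + 2) → V →ₗ[ℂ] V} (hX : IsTensor X) {s : ℂ}
    (h : ∀ b, ∑ i, X i b ∘ₗ eK V i b + s • X b b = 0) {r : Fin (m + 2)}
    (hs : ∀ b : Fin (m + 2), b ≠ r → (lam b.castSucc : ℂ) + s + b.rev.val ≠ 0)
    (hr : f (X r r v) = 0) (i j : Fin (m + 2)) : X i j = 0 := by
  refine H.tensor_eq_zero H hX rfl (fun b => ?_) i j
  induction b using WellFoundedGT.induction with
  | ind b ih =>
    by_cases hb : b = r
    · rw [hb, hr]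
    have e := congrArg f (LinearMap.congr_fun (h b) v)
    rw [LinearMap.add_apply, LinearMap.sum_apply, map_add, map_sum, LinearMap.smul_apply, map_smul,
      LinearMap.zero_apply, map_zero] at e
    have t : ∀ i, f ((X i b ∘ₗ eK V i b) v) =
        ((if i = b then (lam b.castSucc : ℂ) else 0) + if b < i then 1 else 0) * f (X b b v) := by
      intro i
      rw [LinearMap.comp_apply, eK_apply]
      rcases lt_trichotomy i b with hi | rfl | hi
      · rw [H.up i b hi, map_zero, map_zero, if_neg hi.ne, if_neg (lt_asymm hi)]
        ring
      · rw [H.diag, map_smul, map_smul, smul_eq_mul, if_pos rfl, if_neg (lt_irrefl _), add_zero]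
      · have l := H.apply_low i b hi (X i b v)
        rw [apply_lie, hX.lie, if_pos rfl, if_pos rfl, map_add, LinearMap.sub_apply, map_sub,
          ih i hi] at l
        rw [if_neg hi.ne', if_pos hi]
        linear_combination l
    rw [Finset.sum_congr rfl fun i _ => t i, ← Finset.sum_mul, Finset.sum_add_distrib,
      Finset.sum_ite_eq', if_pos (Finset.mem_univ b), Finset.sum_boole] at e
    have hc : (Finset.univ.filter fun i => b < i).card = b.rev.val := by
      have h1 : (Finset.univ.filter fun i => b < i) = Finset.Ioi b := by ext; simp
      rw [h1, Fin.card_Ioi, Fin.val_rev]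
      omega
    rw [hc, smul_eq_mul] at e
    refine (mul_eq_zero.1 (?_ : ((lam b.castSucc : ℂ) + s + b.rev.val) * f (X b b v) = 0)).resolve_left
      (hs b hb)
    linear_combination e

end HighestWeight
end tensors
end
end ShiftOps

namespace ShiftOps
noncomputable section

/-! ### Cofactors as operators on K-types, and factorization into vector operators. -/

section operators
variable {m : ℕ} {V : Type*} [AddCommGroup V] [Module ℂ V] [LieRingModule (kAlg m) V]
  [LieModule ℂ (kAlg m) V]
  {V' : Type*} [AddCommGroup V'] [Module ℂ V'] [LieRingModule (kAlg m) V']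
  [LieModule ℂ (kAlg m) V']

variable (V) in
/-- The action of the quantum cofactors on `V`. -/
def cofK (i j : Fin (m + 2)) (u : ℂ) : V →ₗ[ℂ] V := actK V (cof (kU (m := m)) i j u)

variable (V) in
/-- The action of the quantum minor on `V`. -/
def minorK (m : ℕ) [LieRingModule (kAlg m) V] [LieModule ℂ (kAlg m) V] (u : ℂ) : V →ₗ[ℂ] V :=
  actK V (minor (kU (m := m)) u)

theorem actK_kU (a b : Fin (m + 2)) : actK V (kU (m := m) a.castSucc b) = eK V a b := by
  ext x
  rw [kU, actK_ι, eK_apply]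

/-- The eigenvalue of the cofactor of a diagonal entry on a highest weight vector. -/
def cofVal (lam : Weight m) (r : Fin (m + 2)) (u : ℂ) : ℂ := ∏ b ∈ Finset.univ.erase r,
  ((lam b.castSucc : ℂ) + u + (b.rev.val : ℂ) + if b < r then 0 else 1)

theorem sum_eK_cofK (j b : Fin (m + 2)) (u : ℂ) :
    ∑ i, eK V i b ∘ₗ cofK V i j u + (u + (m + 2 : ℕ)) • cofK V b j u =
      if b = j then minorK V m (u + 1) else 0 := by
  have e := congrArg (actK V) (sum_cof_left (glRel_kU (m := m)) j b u)
  rw [map_sum, apply_ite (actK V), map_zero] at e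
  refine Eq.trans ?_ e
  simp only [add_mul, map_add, Finset.sum_add_distrib, map_mul, actK_kU]
  congr 1
  rw [Finset.sum_eq_single b]
  · rw [if_pos rfl, AlgHom.commutes, ← Algebra.smul_def]; rfl
  · intro i _ hi; rw [if_neg hi, map_zero, map_zero, zero_mul]
  · simp

theorem sum_cofK_eK (j b : Fin (m + 2)) (u : ℂ) :
    ∑ i, cofK V i j u ∘ₗ eK V i b + u • cofK V b j u = if b = j then minorK V m u else 0 := by
  have e := congrArg (actK V) (sum_cof_right (glRel_kU (m := m)) j b u)
  rw [map_sum, apply_ite (actK V), map_zero] at e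
  refine Eq.trans ?_ e
  simp only [mul_add, map_add, Finset.sum_add_distrib, map_mul, actK_kU]
  congr 1
  rw [Finset.sum_eq_single b]
  · rw [if_pos rfl, AlgHom.commutes, ← Algebra.commutes, ← Algebra.smul_def]; rfl
  · intro i _ hi; rw [if_neg hi, map_zero, map_zero, mul_zero]
  · simp

namespace HighestWeight
variable {lam lam' : Weight m} {v : V} {f : V →ₗ[ℂ] ℂ} {v' : V'} {f' : V' →ₗ[ℂ] ℂ}
  (H : HighestWeight lam v f) (H' : HighestWeight lam' v' f')

include H in
theorem lie_last_endo (T : V →ₗ[ℂ] V) : ⁅(kE (iL m) (iL m) : kAlg m), T⁆ = 0 := by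
  ext x
  rw [LieHom.lie_apply, H.last_smul, H.last_smul, map_smul, sub_self]
  rfl

include H in
theorem isTensor_cofK (u : ℂ) : IsTensor fun i j : Fin (m + 2) => cofK V i j u where
  lie a b i j := by
    have e := congrArg (actK (m := m) V) (cof_comm (glRel_kU (m := m)) a b i j u)
    simp only [map_sub, map_mul, actK_kU, apply_ite (actK V), map_zero] at e
    refine Eq.trans ?_ e
    ext x
    rfl
  lie_last i j := H.lie_last_endo _

include H in
-- The minor commutes with gl_n, and E_{n+1,n+1} acts by a scalar; Schur's lemma reduces the claim
-- to the highest weight vector.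
theorem minorK_apply (u : ℂ) (x : V) :
    minorK V m u x = (∏ b : Fin (m + 2), ((lam b.castSucc : ℂ) + u + (b.rev.val : ℂ))) • x := by
  refine H.schur _ _ ?_ ?_ x
  · intro X x
    have hX : X ∈ LinearMap.ker (((LieModule.toEnd ℂ (kAlg m) (V →ₗ[ℂ] V)).toLinearMap).flip
        (minorK V m u)) := by
      refine mem_of_kE (fun a b => ?_) (H.lie_last_endo _) X
      have e := congrArg (actK V) (minor_comm (glRel_kU (m := m)) a b u)
      rw [map_mul, map_mul, actK_kU] at e
      change ⁅(kE a.castSucc b.castSucc : kAlg m), minorK V m u⁆ = 0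
      ext x
      exact sub_eq_zero.2 (LinearMap.congr_fun e x)
    have hX' : ⁅X, minorK V m u⁆ = 0 := hX
    rw [apply_lie, hX', LinearMap.zero_apply, add_zero]
  · refine minor_highest (glRel_kU (m := m)) (actK V) v (fun b => (lam b.castSucc : ℂ)) ?_ ?_ u
    · intro i b hib
      rw [actK_kU]; exact H.up i b hib
    · intro b
      rw [actK_kU]; exact H.diag _

include H in
theorem apply_cofK (r : Fin (m + 2)) (u : ℂ) : f (cofK V r r u v) = cofVal lam r u := by
  have e := cof_highest (glRel_kU (m := m)) (actK V) v (fun b => (lam b.castSucc : ℂ))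
    (fun i b hib => by rw [actK_kU]; exact H.up i b hib)
    (fun b => by rw [actK_kU]; exact H.diag _) r u
  change f (actK V _ v) = _
  rw [e, map_smul, H.apply_self, smul_eq_mul, mul_one]
  rfl

include H in
theorem minorK_eq_zero {u : ℂ} (r : Fin (m + 2)) (h : (lam r.castSucc : ℂ) + u + r.rev.val = 0) :
    minorK V m u = 0 := by
  ext x
  rw [H.minorK_apply, Finset.prod_eq_zero (Finset.mem_univ r) h, zero_smul]
  rfl

end HighestWeight

/-- λ_b - b is strictly decreasing in b. -/
theorem Dominant.sub_ne {lam : Weight m} (h : Dominant lam) {b r : Fin (m + 2)} (hb : b ≠ r) :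
    lam b.castSucc - b.val ≠ lam r.castSucc - r.val := by
  rcases lt_or_gt_of_ne hb with hb | hb
  · have := h b r hb.le
    have : b.val < r.val := hb
    omega
  · have := h r b hb.le
    have : r.val < b.val := hb
    omega

theorem cast_rev {n : ℕ} (b : Fin (n + 1)) : (b.rev.val : ℂ) = n - b.val := by
  have : b.rev.val + b.val = n := by rw [Fin.val_rev]; omega
  rw [eq_sub_iff_add_eq]
  exact_mod_cast this

namespace HighestWeight
variable {lam lam' : Weight m} {v : V} {f : V →ₗ[ℂ] ℂ} {v' : V'} {f' : V' →ₗ[ℂ] ℂ}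
  (H : HighestWeight lam v f) (H' : HighestWeight lam' v' f')

include H in
-- At this `u` the minor at `u + 1` vanishes, so the cofactors satisfy the same homogeneous relation
-- as X. In the recursion of `tensor_eq_zero_left` the coefficient of index `b` is (λ_b - b) - (λ_r
-- - r), which is zero only for b = r, where `hc` matches the values.
theorem eq_of_left (hd : Dominant lam) {X : Fin (m + 2) → Fin (m + 2) → V →ₗ[ℂ] V}
    (hX : IsTensor X) {r : Fin (m + 2)} {u : ℂ} (hu : (lam r.castSucc : ℂ) + u + r.rev.val + 1 = 0)
    (h : ∀ b, ∑ i, eK V i b ∘ₗ X i b + (u + (m + 2 : ℕ)) • X b b = 0) {c : ℂ}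
    (hc : cofVal lam r u = c * f (X r r v)) (i j : Fin (m + 2)) : cofK V i j u = c • X i j := by
  rw [← sub_eq_zero]
  refine H.tensor_eq_zero_left (r := r) ((H.isTensor_cofK u).sub_smul hX c)
    (s := u + (m + 2 : ℕ)) (fun b => ?_) ?_ ?_ i j
  · have h1 := sum_eK_cofK (V := V) b b u
    rw [if_pos rfl, H.minorK_eq_zero r (by linear_combination hu)] at h1
    have h2 := h b
    simp only [LinearMap.comp_sub, LinearMap.comp_smul, Finset.sum_sub_distrib, ← Finset.smul_sum]
    have : ∀ P Q R S : V →ₗ[ℂ] V, ∀ s : ℂ, P + s • Q = 0 → R + s • S = 0 →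
        P - c • R + s • (Q - c • S) = 0 := by
      intro P Q R S s e1 e2
      rw [eq_neg_of_add_eq_zero_left e1, eq_neg_of_add_eq_zero_left e2]
      module
    exact this _ _ _ _ _ h1 h2
  · intro b hb e
    rw [cast_rev] at hu
    refine hd.sub_ne hb ?_
    have : ((lam b.castSucc - b.val : ℤ) : ℂ) = (lam r.castSucc - r.val : ℤ) := by
      push_cast at hu e ⊢
      linear_combination e - hu
    exact_mod_cast this
  · rw [LinearMap.sub_apply, map_sub, H.apply_cofK, hc, LinearMap.smul_apply, map_smul, smul_eq_mul,
      sub_self]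

include H in
-- The same with the relation on the other side, where it is the minor at `u` that has to vanish. It
-- is applied to λ' = λ + ε_r, for which the same `u` meets `hu`.
theorem eq_of_right (hd : Dominant lam) {X : Fin (m + 2) → Fin (m + 2) → V →ₗ[ℂ] V}
    (hX : IsTensor X) {r : Fin (m + 2)} {u : ℂ} (hu : (lam r.castSucc : ℂ) + u + r.rev.val = 0)
    (h : ∀ b, ∑ i, X i b ∘ₗ eK V i b + u • X b b = 0) {c : ℂ}
    (hc : cofVal lam r u = c * f (X r r v)) (i j : Fin (m + 2)) : cofK V i j u = c • X i j := by
  rw [← sub_eq_zero]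
  refine H.tensor_eq_zero_right (r := r) ((H.isTensor_cofK u).sub_smul hX c)
    (s := u) (fun b => ?_) ?_ ?_ i j
  · have h1 := sum_cofK_eK (V := V) b b u
    rw [if_pos rfl, H.minorK_eq_zero r hu] at h1
    have h2 := h b
    simp only [LinearMap.sub_comp, LinearMap.smul_comp, Finset.sum_sub_distrib, ← Finset.smul_sum]
    have : ∀ P Q R S : V →ₗ[ℂ] V, ∀ s : ℂ, P + s • Q = 0 → R + s • S = 0 →
        P - c • R + s • (Q - c • S) = 0 := by
      intro P Q R S s e1 e2
      rw [eq_neg_of_add_eq_zero_left e1, eq_neg_of_add_eq_zero_left e2]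
      module
    exact this _ _ _ _ _ h1 h2
  · intro b hb e
    rw [cast_rev] at hu e
    refine hd.sub_ne hb ?_
    have : ((lam b.castSucc - b.val : ℤ) : ℂ) = (lam r.castSucc - r.val : ℤ) := by
      push_cast at hu e ⊢
      linear_combination e - hu
    exact_mod_cast this
  · rw [LinearMap.sub_apply, map_sub, H.apply_cofK, hc, LinearMap.smul_apply, map_smul, smul_eq_mul,
      sub_self]

end HighestWeight

theorem cofVal_congr {lam lam' : Weight m} {r : Fin (m + 2)}
    (h : ∀ i, i ≠ r → lam' i.castSucc = lam i.castSucc) (u : ℂ) : cofVal lam' r u = cofVal lam r u :=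
  Finset.prod_congr rfl fun b hb => by rw [h b (Finset.ne_of_mem_erase hb)]

/-- For b > r this compares λ_b - b with λ_r - r; for b < r it compares it with (λ_r + 1) - r, the
coordinate of λ'. -/
theorem cofVal_factor {lam : Weight m} {r b : Fin (m + 2)} {u : ℂ}
    (hu : (lam r.castSucc : ℂ) + u + r.rev.val + 1 = 0) :
    (lam b.castSucc : ℂ) + u + (b.rev.val : ℂ) + (if b < r then 0 else 1) =
      (((lam b.castSucc - b.val) - (lam r.castSucc - r.val) - if b < r then 1 else 0 : ℤ) : ℂ) := by
  rw [cast_rev] at hu ⊢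
  split_ifs
  · push_cast at hu ⊢
    linear_combination hu
  · push_cast at hu ⊢
    linear_combination hu

/-- By `cofVal_factor` a zero factor would make two coordinates λ_b - b coincide, for λ or for λ'.
-/
theorem cofVal_ne_zero {lam lam' : Weight m} (hd : Dominant lam) (hd' : Dominant lam')
    {r : Fin (m + 2)} {u : ℂ}
    (h : ∀ i : Fin (m + 2), lam' i.castSucc = lam i.castSucc + if i = r then 1 else 0)
    (hu : (lam r.castSucc : ℂ) + u + r.rev.val + 1 = 0) : cofVal lam r u ≠ 0 := by
  refine Finset.prod_ne_zero_iff.2 fun b hb => ?_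
  have hb : b ≠ r := Finset.ne_of_mem_erase hb
  rw [cofVal_factor hu]
  refine Int.cast_ne_zero.2 ?_
  have h1 := hd.sub_ne hb
  have h2 := hd'.sub_ne hb
  rw [h, h, if_neg hb, if_pos rfl] at h2
  split_ifs <;> omega

/-- If exactly one weight is dominant, adding ε_r crosses a wall, and the neighbouring index on that
side gives the zero factor. -/
theorem cofVal_eq_zero {lam lam' : Weight m} (hd : ¬(Dominant lam ∧ Dominant lam'))
    (hd' : Dominant lam ∨ Dominant lam') {r : Fin (m + 2)} {u : ℂ}
    (h : ∀ i : Fin (m + 2), lam' i.castSucc = lam i.castSucc + if i = r then 1 else 0)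
    (hu : (lam r.castSucc : ℂ) + u + r.rev.val + 1 = 0) : cofVal lam r u = 0 := by
  suffices hs : ∃ b, b ≠ r ∧ (lam b.castSucc - b.val) - (lam r.castSucc - r.val) -
      (if b < r then 1 else 0 : ℤ) = 0 by
    obtain ⟨b, hb, e⟩ := hs
    refine Finset.prod_eq_zero (Finset.mem_erase.2 ⟨hb, Finset.mem_univ b⟩) ?_
    rw [cofVal_factor hu, e, Int.cast_zero]
  rcases hd' with hd' | hd'
  · have hn : ¬Dominant lam' := fun e => hd ⟨hd', e⟩
    simp only [Dominant, not_forall, not_le] at hn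
    obtain ⟨i, j, hij, hlt⟩ := hn
    rw [h, h] at hlt
    have h1 := hd' i j hij
    have hj : j = r := by
      by_contra hj
      rw [if_neg hj] at hlt
      split_ifs at hlt <;> omega
    subst hj
    have hi : i ≠ j := by
      rintro rfl
      exact lt_irrefl _ hlt
    rw [if_pos rfl, if_neg hi] at hlt
    have hij' : i.val < j.val := lt_of_le_of_ne hij (Fin.val_ne_of_ne hi)
    have hb : j.val - 1 < m + 2 := by omega
    have h2 := hd' i ⟨j.val - 1, hb⟩ (by rw [Fin.le_def]; change i.val ≤ j.val - 1; omega)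
    have h3 := hd' ⟨j.val - 1, hb⟩ j (by rw [Fin.le_def]; change j.val - 1 ≤ j.val; omega)
    -- Raising λ_r breaks dominance only if λ_{r-1} = λ_r, so b = r - 1.
    refine ⟨⟨j.val - 1, hb⟩, fun e => ?_, ?_⟩
    · have : j.val - 1 = j.val := congrArg Fin.val e
      omega
    · rw [if_pos (by rw [Fin.lt_def]; change j.val - 1 < j.val; omega)]
      change _ - ((j.val - 1 : ℕ) : ℤ) - _ - _ = _
      omega
  · have hn : ¬Dominant lam := fun e => hd ⟨e, hd'⟩
    simp only [Dominant, not_forall, not_le] at hn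
    obtain ⟨i, j, hij, hlt⟩ := hn
    have h1 := hd' i j hij
    rw [h, h] at h1
    have hi : i = r := by
      by_contra hi
      rw [if_neg hi] at h1
      split_ifs at h1 <;> omega
    subst hi
    have hi : j ≠ i := by
      rintro rfl
      exact lt_irrefl _ hlt
    rw [if_pos rfl, if_neg hi] at h1
    have hij' : i.val < j.val := lt_of_le_of_ne hij (Fin.val_ne_of_ne hi.symm)
    have hb : i.val + 1 < m + 2 := by omega
    have n1 : (⟨i.val + 1, hb⟩ : Fin (m + 2)) ≠ i := fun e => by
      have : i.val + 1 = i.val := congrArg Fin.val e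
      omega
    have h2 := hd' ⟨i.val + 1, hb⟩ j (by rw [Fin.le_def]; change i.val + 1 ≤ j.val; omega)
    have h3 := hd' i ⟨i.val + 1, hb⟩ (by rw [Fin.le_def]; change i.val ≤ i.val + 1; omega)
    rw [h, h, if_neg hi, if_neg n1] at h2
    rw [h, h, if_pos rfl, if_neg n1] at h3
    -- Here λ is not dominant but λ' is, which forces λ_{r+1} = λ_r + 1, so b = r + 1.
    refine ⟨⟨i.val + 1, hb⟩, n1, ?_⟩
    rw [if_neg (by rw [Fin.lt_def]; change ¬(i.val + 1 < i.val); omega)]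
    change _ - ((i.val + 1 : ℕ) : ℤ) - _ - _ = _
    omega

namespace HighestWeight
variable {lam lam' : Weight m} {v : V} {f : V →ₗ[ℂ] ℂ} {v' : V'} {f' : V' →ₗ[ℂ] ℂ}
  (H : HighestWeight lam v f) (H' : HighestWeight lam' v' f')
include H H'

/-- The cofactors are multiples of the products of vector operators between the two `K`-types. -/
theorem exists_cofK_eq (hd : Dominant lam) (hd' : Dominant lam') {r : Fin (m + 2)} {u : ℂ}
    (h : ∀ i : Fin (m + 2), lam' i.castSucc = lam i.castSucc + if i = r then 1 else 0)
    (hL : lam' (iL m) = lam (iL m) - 1) (hu : (lam r.castSucc : ℂ) + u + r.rev.val + 1 = 0)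
    {A : Fin (m + 2) → V' →ₗ[ℂ] V} (hA : IsVec A) (hA0 : A ≠ 0)
    {B : Fin (m + 2) → V →ₗ[ℂ] V'} (hB : IsCovec B) (hB0 : B ≠ 0) :
    ∃ c : ℂ, c ≠ 0 ∧ (∀ i j, cofK V i j u = c • (A i ∘ₗ B j)) ∧
      ∀ i j, cofK V' i j u = c • (B j ∘ₗ A i) := by
  have hne : ∀ i, i ≠ r → lam' i.castSucc = lam i.castSucc := fun i hi => by
    rw [h, if_neg hi, add_zero]
  have hne' : ∀ i, i ≠ r → lam i.castSucc = lam' i.castSucc := fun i hi => (hne i hi).symm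
  have ha : f (A r v') ≠ 0 := fun e => hA0 (funext fun i => H'.vec_eq_zero H hA hne' e i)
  have hb : f' (B r v) ≠ 0 := fun e => hB0 (funext fun i => H.covec_eq_zero H' hB hne e i)
  have eA : A r v' = f (A r v') • v := H'.vec_apply H hA h hL
  have eB : B r v = f' (B r v) • v' := H.covec_apply H' hB h hL
  -- The parameter u + n is the one in the left cofactor relation, and `hu` makes it the value for
  -- which the contraction of A vanishes. Thus A_i B_j and the cofactors obey the same relation.
  have hc := H'.vec_contract_eq_zero H hA hne' (s := u + (m + 2 : ℕ)) (by
    rw [cast_rev] at hu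
    push_cast at hu ⊢
    linear_combination hu)
  -- The quotient of the r-th diagonal values on highest weight vectors. It is symmetric in A and B,
  -- so it serves for both orders of the product.
  refine ⟨cofVal lam r u / (f (A r v') * f' (B r v)),
    div_ne_zero (cofVal_ne_zero hd hd' h hu) (mul_ne_zero ha hb), ?_, ?_⟩
  · refine H.eq_of_left hd (hA.comp_covec hB) hu ?_ ?_
    · intro b
      ext x
      have := LinearMap.congr_fun (hc b) (B b x)
      simpa only [LinearMap.add_apply, LinearMap.smul_apply, LinearMap.zero_apply,
        LinearMap.sum_apply, LinearMap.comp_apply] using this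
    · have e : f (A r (B r v)) = f' (B r v) * f (A r v') := by
        conv_lhs => rw [eB]
        rw [map_smul, map_smul, smul_eq_mul]
      rw [LinearMap.comp_apply, e]
      field_simp
  · refine H'.eq_of_right (r := r) hd' (hB.comp_vec hA) ?_ (fun b => ?_) ?_
    · rw [h, if_pos rfl]
      push_cast
      linear_combination hu
    · have e := hA.comp_eK b
      have e2 : ∑ i, A i ∘ₗ eK V' i b + u • A b = 0 := by
        rw [e, add_assoc, ← add_smul, add_comm _ u]
        exact hc b
      ext x
      have := congrArg (B b) (LinearMap.congr_fun e2 x)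
      simpa only [LinearMap.add_apply, LinearMap.smul_apply, LinearMap.zero_apply,
        LinearMap.sum_apply, LinearMap.comp_apply, map_add, map_sum, map_smul, map_zero] using this
    · have e : f' (B r (A r v')) = f (A r v') * f' (B r v) := by
        conv_lhs => rw [eA]
        rw [map_smul, map_smul, smul_eq_mul]
      -- The product omits the index `r`, the only one among 1, …, n at which λ and λ' differ.
      rw [LinearMap.comp_apply, e, cofVal_congr hne]
      field_simp

end HighestWeight

end operators
end
end ShiftOps

namespace ShiftOps
noncomputable section

/-! ### Components of K-homomorphisms into V ⊗ s. -/

section coordinates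
variable {m : ℕ} {V : Type*} [AddCommGroup V] [Module ℂ V] [LieRingModule (kAlg m) V]
  [LieModule ℂ (kAlg m) V]
  {V' : Type*} [AddCommGroup V'] [Module ℂ V'] [LieRingModule (kAlg m) V']
  [LieModule ℂ (kAlg m) V']

/-- The basis elements `E_{i,n+1}` of `s`. -/
def sCol (i : Fin (m + 2)) : sMod m := ⟨E i.castSucc (iL m), fun a b h => by
  rw [E_apply, if_neg]
  rintro ⟨rfl, rfl⟩
  exact castSucc_ne_iL i (h.2 rfl)⟩

/-- The basis elements `E_{n+1,j}` of `s`. -/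
def sRow (j : Fin (m + 2)) : sMod m := ⟨E (iL m) j.castSucc, fun a b h => by
  rw [E_apply, if_neg]
  rintro ⟨rfl, rfl⟩
  exact castSucc_ne_iL j (h.1 rfl)⟩

/-- A matrix entry as a functional on `s`. -/
def sEntry (i j : Fin (m + 3)) : sMod m →ₗ[ℂ] ℂ where
  toFun X := (X : Gl m) i j
  map_add' _ _ := rfl
  map_smul' _ _ := rfl

theorem eq_sum_sCol_sRow (S : sMod m) : S = ∑ i, sEntry i.castSucc (iL m) S • sCol i +
    ∑ j, sEntry (iL m) j.castSucc S • sRow j := by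
  apply (sMod m).injective_incl
  rw [map_add, map_sum, map_sum]
  change (S : Gl m) = _
  conv_lhs => rw [sum_E (S : Gl m)]
  have z1 : ∀ i j : Fin (m + 2), (S : Gl m) i.castSucc j.castSucc = 0 := fun i j =>
    S.2 _ _ (by simp [castSucc_ne_iL])
  have z2 : (S : Gl m) (Fin.last (m + 2)) (Fin.last (m + 2)) = 0 := S.2 _ _ Iff.rfl
  rw [Fin.sum_univ_castSucc]
  simp only [Fin.sum_univ_castSucc (n := m + 2), z1, z2, zero_smul, Finset.sum_const_zero, zero_add,
    add_zero]
  rfl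

variable (V) in
/-- The components of tensors in `V ⊗ s`. -/
def tEntry (i j : Fin (m + 3)) : V ⊗[ℂ] sMod m →ₗ[ℂ] V :=
  (TensorProduct.rid ℂ V).toLinearMap ∘ₗ LinearMap.lTensor V (sEntry i j)

theorem tEntry_tmul (i j : Fin (m + 3)) (v : V) (S : sMod m) :
    tEntry V i j (v ⊗ₜ S) = sEntry i j S • v := by
  simp [tEntry]

theorem eq_sum_tEntry (t : V ⊗[ℂ] sMod m) : t = ∑ i, tEntry V i.castSucc (iL m) t ⊗ₜ[ℂ] sCol i +
    ∑ j, tEntry V (iL m) j.castSucc t ⊗ₜ[ℂ] sRow j := by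
  induction t with
  | zero => simp
  | add a b ha hb =>
    conv_lhs => rw [ha, hb]
    simp only [map_add, TensorProduct.add_tmul, Finset.sum_add_distrib]
    abel
  | tmul v S =>
    conv_lhs => rw [eq_sum_sCol_sRow S]
    simp only [tEntry_tmul, TensorProduct.tmul_add, TensorProduct.tmul_sum, TensorProduct.tmul_smul,
      TensorProduct.smul_tmul]

/-- `T` stands for the component of the action of X on the second tensor factor, in whatever form is
convenient for the X at hand. -/
theorem tEntry_lie {X : kAlg m} {i j : Fin (m + 3)} {T : V ⊗[ℂ] sMod m →ₗ[ℂ] V}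
    (hT : ∀ v S, T (v ⊗ₜ S) = (⁅(X : Gl m), (S : Gl m)⁆ : Gl m) i j • v) (t : V ⊗[ℂ] sMod m) :
    tEntry V i j ⁅X, t⁆ = ⁅X, tEntry V i j t⁆ + T t := by
  induction t with
  | zero => simp
  | add a b ha hb => rw [lie_add, map_add, ha, hb, map_add, lie_add, map_add]; abel
  | tmul v S =>
    rw [TensorProduct.LieModule.lie_tmul_right, map_add, tEntry_tmul, tEntry_tmul, tEntry_tmul, hT,
      lie_smul]
    rfl

theorem E_lie_apply (a b : Fin (m + 3)) (S : Gl m) (i j : Fin (m + 3)) :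
    (⁅(E a b : Gl m), S⁆ : Gl m) i j = (if a = i then S b j else 0) - if b = j then S i a else 0 := by
  rw [LieRing.of_associative_ring_bracket, Matrix.sub_apply, E, Matrix.mul_apply, Matrix.mul_apply]
  congr 1
  · simp only [Matrix.single_apply, ite_and]
    simp
  · simp only [Matrix.single_apply, ite_and]
    simp

theorem isVec_tEntry (ι : V' →ₗ⁅ℂ, kAlg m⁆ V ⊗[ℂ] sMod m) :
    IsVec fun i => tEntry V i.castSucc (iL m) ∘ₗ (ι : V' →ₗ[ℂ] V ⊗[ℂ] sMod m) where
  lie a b i := by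
    ext x
    rw [LieHom.lie_apply]
    change ⁅_, tEntry V _ _ (ι x)⁆ - tEntry V _ _ (ι ⁅_, x⁆) = _
    rw [LieModuleHom.map_lie, tEntry_lie (T := if a = i then tEntry V b.castSucc (iL m) else 0)]
    · split_ifs
      · rw [sub_add_cancel_left]; rfl
      · simp
    · intro v S
      rw [coe_kE_castSucc, E_lie_apply, if_neg (castSucc_ne_iL b), sub_zero]
      simp only [Fin.castSucc_inj]
      split_ifs
      · rw [tEntry_tmul]; rfl
      · simp
  lie_last i := by
    ext x
    rw [LieHom.lie_apply]
    change ⁅_, tEntry V _ _ (ι x)⁆ - tEntry V _ _ (ι ⁅_, x⁆) = _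
    rw [LieModuleHom.map_lie, tEntry_lie (T := -tEntry V i.castSucc (iL m))]
    · rw [sub_add_cancel_left, LinearMap.neg_apply, neg_neg]; rfl
    · intro v S
      rw [coe_kE_last, E_lie_apply, if_neg (castSucc_ne_iL i).symm, if_pos rfl, zero_sub, neg_smul,
        LinearMap.neg_apply, tEntry_tmul]
      rfl

theorem isCovec_tEntry (ι : V' →ₗ⁅ℂ, kAlg m⁆ V ⊗[ℂ] sMod m) :
    IsCovec fun j => tEntry V (iL m) j.castSucc ∘ₗ (ι : V' →ₗ[ℂ] V ⊗[ℂ] sMod m) where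
  lie a b j := by
    ext x
    rw [LieHom.lie_apply]
    change ⁅_, tEntry V _ _ (ι x)⁆ - tEntry V _ _ (ι ⁅_, x⁆) = _
    rw [LieModuleHom.map_lie, tEntry_lie (T := if j = b then -tEntry V (iL m) a.castSucc else 0)]
    · split_ifs
      · rw [sub_add_cancel_left, LinearMap.neg_apply, neg_neg]; rfl
      · simp
    · intro v S
      rw [coe_kE_castSucc, E_lie_apply, if_neg (castSucc_ne_iL a), zero_sub]
      simp only [Fin.castSucc_inj, eq_comm (a := b)]
      split_ifs
      · rw [LinearMap.neg_apply, tEntry_tmul, neg_smul]; rfl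
      · simp
  lie_last j := by
    ext x
    rw [LieHom.lie_apply]
    change ⁅_, tEntry V _ _ (ι x)⁆ - tEntry V _ _ (ι ⁅_, x⁆) = _
    rw [LieModuleHom.map_lie, tEntry_lie (T := tEntry V (iL m) j.castSucc)]
    · rw [sub_add_cancel_left]; rfl
    · intro v S
      rw [coe_kE_last, E_lie_apply, if_neg (castSucc_ne_iL j).symm, if_pos rfl, sub_zero,
        tEntry_tmul]
      rfl

variable {lam lam' : Weight m} {v : V} {f : V →ₗ[ℂ] ℂ} {v' : V'} {f' : V' →ₗ[ℂ] ℂ}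

theorem HighestWeight.lie_last (H : HighestWeight lam v f) (H' : HighestWeight lam' v' f')
    (T : V →ₗ[ℂ] V') : ⁅(kE (iL m) (iL m) : kAlg m), T⁆ =
      ((lam' (iL m) - lam (iL m) : ℤ) : ℂ) • T := by
  ext x
  rw [LieHom.lie_apply, H.last_smul, H'.last_smul, map_smul, LinearMap.smul_apply]
  push_cast
  module

/-- A vector operator raises the eigenvalue of E_{n+1,n+1} by one, whereas here it would have to
fall by one. -/
theorem HighestWeight.vec_eq_zero_of_last (H : HighestWeight lam v f) (H' : HighestWeight lam' v' f')
    {A : Fin (m + 2) → V →ₗ[ℂ] V'} (hA : IsVec A) (h : lam' (iL m) = lam (iL m) - 1)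
    (i : Fin (m + 2)) : A i = 0 := by
  have e := hA.lie_last i
  rw [H.lie_last H', h] at e
  have e2 : (2 : ℂ) • A i = 0 := by
    have : (2 : ℂ) • A i = A i - ((lam (iL m) - 1 - lam (iL m) : ℤ) : ℂ) • A i := by
      push_cast; module
    rw [this, e, sub_self]
  exact (smul_eq_zero.1 e2).resolve_left two_ne_zero

theorem HighestWeight.covec_eq_zero_of_last (H : HighestWeight lam v f)
    (H' : HighestWeight lam' v' f') {B : Fin (m + 2) → V →ₗ[ℂ] V'} (hB : IsCovec B)
    (h : lam (iL m) = lam' (iL m) - 1) (i : Fin (m + 2)) : B i = 0 := by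
  have e := hB.lie_last i
  rw [H.lie_last H', h] at e
  have e2 : (2 : ℂ) • B i = 0 := by
    have : (2 : ℂ) • B i = ((lam' (iL m) - (lam' (iL m) - 1) : ℤ) : ℂ) • B i - -B i := by
      push_cast; module
    rw [this, e, sub_self]
  exact (smul_eq_zero.1 e2).resolve_left two_ne_zero

end coordinates

/-! ### Compositions of shift operators in coordinates. -/

section shift
variable {m : ℕ} {V : Type*} [AddCommGroup V] [Module ℂ V] [LieRingModule (kAlg m) V]
  [LieModule ℂ (kAlg m) V]
  {V' : Type*} [AddCommGroup V'] [Module ℂ V'] [LieRingModule (kAlg m) V']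
  [LieModule ℂ (kAlg m) V'] {W : Type*} [NormedAddCommGroup W] [NormedSpace ℂ W]

/-- `v ⊗ X ↦ (u X · φ)(v)`. -/
def nablaMul (φ : SmoothHom V W) (u : UG m) : V ⊗[ℂ] sMod m →ₗ[ℂ] SmoothA W :=
  TensorProduct.lift (LinearMap.mk₂ ℂ
    (fun v (X : sMod m) => evAct φ v (u * UniversalEnvelopingAlgebra.ι ℂ (X : Gl m)))
    (fun v v' X => by rw [map_add, LinearMap.add_apply])
    (fun c v X => by rw [map_smul, LinearMap.smul_apply])
    (fun v X X' => by rw [LieSubmodule.coe_add, map_add, mul_add, map_add])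
    (fun c v X => by rw [LieSubmodule.coe_smul, map_smul, mul_smul_comm, map_smul]))

theorem nablaMul_tmul (φ : SmoothHom V W) (u : UG m) (v : V) (X : sMod m) :
    nablaMul φ u (v ⊗ₜ X) = evAct φ v (u * UniversalEnvelopingAlgebra.ι ℂ (X : Gl m)) := by
  simp [nablaMul]

theorem nablaMul_one (φ : SmoothHom V W) : nablaMul (m := m) φ 1 = nabla φ := by
  ext v X : 3
  change nablaMul φ 1 (v ⊗ₜ X) = nabla φ (v ⊗ₜ X)
  rw [nablaMul_tmul, one_mul, nabla, TensorProduct.lift.tmul]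
  rfl

theorem nablaMul_add (φ : SmoothHom V W) (a b : UG m) (t : V ⊗[ℂ] sMod m) :
    nablaMul φ (a + b) t = nablaMul φ a t + nablaMul φ b t := by
  induction t with
  | zero => simp
  | add x y hx hy => rw [map_add, map_add, map_add, hx, hy]; abel
  | tmul v S => rw [nablaMul_tmul, nablaMul_tmul, nablaMul_tmul, add_mul, map_add]

theorem nablaMul_smul (φ : SmoothHom V W) (c : ℂ) (a : UG m) (t : V ⊗[ℂ] sMod m) :
    nablaMul φ (c • a) t = c • nablaMul φ a t := by
  induction t with
  | zero => simp
  | add x y hx hy => rw [map_add, map_add, smul_add, hx, hy]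
  | tmul v S => rw [nablaMul_tmul, nablaMul_tmul, smul_mul_assoc, map_smul]

/-- Moving X past the element of s gives a commutator, which is the action of X on s; what remains
acts on `V`. Together these are the action on the tensor product. -/
theorem nablaMul_mul_ι (φ : SmoothHom V W) (u : UG m) (X : kAlg m) (t : V ⊗[ℂ] sMod m) :
    nablaMul φ (u * UniversalEnvelopingAlgebra.ι ℂ (X : Gl m)) t = nablaMul φ u ⁅X, t⁆ := by
  induction t with
  | zero => simp
  | add a b ha hb => rw [map_add, ha, hb, lie_add, map_add]
  | tmul v S =>
    rw [TensorProduct.LieModule.lie_tmul_right, map_add, nablaMul_tmul, nablaMul_tmul, nablaMul_tmul,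
      ← evAct_mul_ι, ← map_add]
    congr 1
    have e : UniversalEnvelopingAlgebra.ι ℂ ((⁅X, S⁆ : sMod m) : Gl m) =
        UniversalEnvelopingAlgebra.ι ℂ (X : Gl m) * UniversalEnvelopingAlgebra.ι ℂ (S : Gl m) -
        UniversalEnvelopingAlgebra.ι ℂ (S : Gl m) * UniversalEnvelopingAlgebra.ι ℂ (X : Gl m) := by
      rw [← LieRing.of_associative_ring_bracket, ← LieHom.map_lie]
      rfl
    rw [e]
    noncomm_ring

/-- The operator on `C^∞(A → W)` by which `X ∈ ℂh ⊕ n` acts. -/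
def leftOp (X : Gl m) : Module.End ℂ (SmoothA W) :=
  coordH m X • eulerOp W + coordY (Fin.last m) X • mulIT W

theorem evAct_b_mul (φ : SmoothHom V W) (v : V) {X : Gl m} (hX : projK m X = 0) (u : UG m) :
    evAct φ v (UniversalEnvelopingAlgebra.ι ℂ X * u) = leftOp X (evAct φ v u) := by
  rw [evAct_apply, isAct_envAct.b_mul hX]
  rfl

theorem nablaMul_b_mul (φ : SmoothHom V W) {X : Gl m} (hX : projK m X = 0) (u : UG m)
    (t : V ⊗[ℂ] sMod m) :
    nablaMul φ (UniversalEnvelopingAlgebra.ι ℂ X * u) t = leftOp X (nablaMul φ u t) := by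
  induction t with
  | zero => simp
  | add a b ha hb => rw [map_add, ha, hb, map_add, map_add]
  | tmul v S => rw [nablaMul_tmul, nablaMul_tmul, mul_assoc, evAct_b_mul φ v hX]

/-- U(g) acts on ∇φ ∘ ι as it acts on φ, with the letter of s placed to the right. The statement
holds at 1 and is preserved by left factors from ℂh ⊕ n and by right factors from k, the latter
because ι is a k-homomorphism. -/
theorem evAct_nabla_comp (φ : SmoothHom V W) (ι : V' →ₗ⁅ℂ, kAlg m⁆ V ⊗[ℂ] sMod m) (v' : V')
    (u : UG m) : evAct (nabla φ ∘ₗ (ι : V' →ₗ[ℂ] V ⊗[ℂ] sMod m)) v' u = nablaMul φ u (ι v') := by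
  let S : Submodule ℂ (UG m) :=
    { carrier := {u | ∀ v', evAct (nabla φ ∘ₗ (ι : V' →ₗ[ℂ] V ⊗[ℂ] sMod m)) v' u =
        nablaMul φ u (ι v')}
      add_mem' := fun {a b} ha hb v' => by rw [map_add, nablaMul_add, ha v', hb v']
      zero_mem' := fun v' => by
        rw [map_zero, ← zero_smul ℂ (0 : UG m), nablaMul_smul, zero_smul]
      smul_mem' := fun c a ha v' => by rw [map_smul, nablaMul_smul, ha v'] }
  have hS : S = ⊤ := by
    refine submodule_eq_top S (projK m) (fun A => projK_of_mem (projK_mem A)) ?_ ?_ ?_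
    · intro v'
      rw [nablaMul_one, evAct_apply, isAct_envAct.one]
      rfl
    · intro X u hX hu v'
      rw [evAct_b_mul _ _ hX, nablaMul_b_mul _ hX, hu v']
    · intro X u hX hu v'
      have e := evAct_mul_ι ⟨X, projK_eq_self.1 hX⟩ u (nabla φ ∘ₗ (ι : V' →ₗ[ℂ] V ⊗[ℂ] sMod m)) v'
      have e2 := nablaMul_mul_ι φ u ⟨X, projK_eq_self.1 hX⟩ (ι v')
      rw [← LieModuleHom.map_lie] at e2
      exact (e.trans (hu _)).trans e2.symm
  exact (hS ▸ Submodule.mem_top : u ∈ S) v'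

/-- The composite of a raising and a lowering shift operator in coordinates. -/
theorem nabla_row_nabla_col (φ : SmoothHom V W) {ι : V' →ₗ⁅ℂ, kAlg m⁆ V ⊗[ℂ] sMod m}
    {ι' : V →ₗ⁅ℂ, kAlg m⁆ V' ⊗[ℂ] sMod m} {A : Fin (m + 2) → V' →ₗ[ℂ] V}
    {B : Fin (m + 2) → V →ₗ[ℂ] V'} (hA : ∀ x, ι x = ∑ i, A i x ⊗ₜ[ℂ] sCol i)
    (hB : ∀ x, ι' x = ∑ j, B j x ⊗ₜ[ℂ] sRow j) (v : V) :
    nabla (nabla φ ∘ₗ (ι : V' →ₗ[ℂ] V ⊗[ℂ] sMod m)) (ι' v) =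
      ∑ i, ∑ j, evAct φ (A i (B j v)) (gU (iL m) j.castSucc * gU i.castSucc (iL m)) := by
  rw [← nablaMul_one, hB, map_sum, Finset.sum_comm]
  refine Finset.sum_congr rfl fun j _ => ?_
  rw [nablaMul_tmul, one_mul, evAct_nabla_comp, hA, map_sum]
  refine Finset.sum_congr rfl fun i _ => ?_
  rw [nablaMul_tmul]
  rfl

/-- The composite of a lowering and a raising shift operator in coordinates. -/
theorem nabla_col_nabla_row (φ : SmoothHom V' W) {ι : V' →ₗ⁅ℂ, kAlg m⁆ V ⊗[ℂ] sMod m}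
    {ι' : V →ₗ⁅ℂ, kAlg m⁆ V' ⊗[ℂ] sMod m} {A : Fin (m + 2) → V' →ₗ[ℂ] V}
    {B : Fin (m + 2) → V →ₗ[ℂ] V'} (hA : ∀ x, ι x = ∑ i, A i x ⊗ₜ[ℂ] sCol i)
    (hB : ∀ x, ι' x = ∑ j, B j x ⊗ₜ[ℂ] sRow j) (v' : V') :
    nabla (nabla φ ∘ₗ (ι' : V →ₗ[ℂ] V' ⊗[ℂ] sMod m)) (ι v') =
      ∑ i, ∑ j, evAct φ (B j (A i v')) (gU i.castSucc (iL m) * gU (iL m) j.castSucc) := by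
  rw [← nablaMul_one, hA, map_sum]
  refine Finset.sum_congr rfl fun i _ => ?_
  rw [nablaMul_tmul, one_mul, evAct_nabla_comp, hB, map_sum]
  refine Finset.sum_congr rfl fun j _ => ?_
  rw [nablaMul_tmul]
  rfl

end shift
end
end ShiftOps

namespace ShiftOps
noncomputable section

/-! ### Case analysis on dominance, and conclusion. -/

section main
variable {m : ℕ} {V : Type*} [AddCommGroup V] [Module ℂ V] [LieRingModule (kAlg m) V]
  [LieModule ℂ (kAlg m) V]
  {V' : Type*} [AddCommGroup V'] [Module ℂ V'] [LieRingModule (kAlg m) V']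
  [LieModule ℂ (kAlg m) V'] {W : Type*} [NormedAddCommGroup W] [NormedSpace ℂ W]

theorem IsKType.exists_highestWeight {lam : Weight m} (hV : IsKType lam V) (hd : Dominant lam) :
    ∃ v f, HighestWeight lam (V := V) v f := by
  obtain ⟨hirr, v, hv, h⟩ := hV.1 hd
  exact ⟨v, exists_functional hirr lam hv h⟩

theorem add_shiftWeight_castSucc (lam : Weight m) (k i : Fin (m + 2)) :
    (lam + shiftWeight k) i.castSucc = lam i.castSucc + if i = k.rev then 1 else 0 := by
  rw [Pi.add_apply, shiftWeight, Pi.sub_apply, Pi.single_apply,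
    Pi.single_eq_of_ne (castSucc_ne_iL i), sub_zero]
  simp only [Fin.castSucc_inj]

theorem add_shiftWeight_last (lam : Weight m) (k : Fin (m + 2)) :
    (lam + shiftWeight k) (iL m) = lam (iL m) - 1 := by
  rw [Pi.add_apply, shiftWeight, Pi.sub_apply, Pi.single_eq_same,
    Pi.single_eq_of_ne (castSucc_ne_iL k.rev).symm, zero_sub, sub_eq_add_neg]

theorem lParam_shift (lam : Weight m) (k : Fin (m + 2)) :
    lParam (lam + shiftWeight k) k + 1 = lParam lam k := by
  rw [lParam, lParam, dualWeight, dualWeight, add_shiftWeight_castSucc, if_pos rfl]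
  push_cast
  ring

/-- With r = n + 1 - k, this is the condition under which M(u+1) vanishes on V_λ and M(u) on
V_{λ+α_k}, for u = l_{k,n}. -/
theorem add_lParam (lam : Weight m) (k : Fin (m + 2)) :
    (lam k.rev.castSucc : ℂ) + lParam lam k + k.rev.rev.val + 1 = 0 := by
  rw [lParam, dualWeight, Fin.rev_rev]
  push_cast
  ring

theorem isTensor_zero : IsTensor fun _ _ : Fin (m + 2) => (0 : V →ₗ[ℂ] V') where
  lie a b i j := by simp
  lie_last i j := by simp

/-- Only the quadratic part in s survives, in the order in which P⁻ ∘ P⁺ produces it. -/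
theorem evAct_capelli_left {u : ℂ} (h : minorK V m (u + 1) = 0) (φ : SmoothHom V W) (v : V) :
    evAct φ v (capelli m u) = -∑ i : Fin (m + 2), ∑ j : Fin (m + 2),
      evAct φ (cofK V i j u v) (gU (iL m) j.castSucc * gU i.castSucc (iL m)) := by
  have e := evAct_capelli' (m := m) u φ v
  have h' : actK (m := m) V (minor (kU (m := m)) (u + 1)) v = 0 := LinearMap.congr_fun h v
  rw [h', map_zero, LinearMap.zero_apply, zero_sub] at e
  exact e

theorem evAct_capelli_right {u : ℂ} (h : minorK V m u = 0) (φ : SmoothHom V W) (v : V) :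
    evAct φ v (capelli m u) = -∑ i : Fin (m + 2), ∑ j : Fin (m + 2),
      evAct φ (cofK V i j u v) (gU i.castSucc (iL m) * gU (iL m) j.castSucc) := by
  have e := evAct_capelli (m := m) u φ v
  have h' : actK (m := m) V (minor (kU (m := m)) u) v = 0 := LinearMap.congr_fun h v
  rw [h', map_zero, LinearMap.zero_apply, zero_sub] at e
  exact e

/-- The embeddings of `V_{λ'}` in `V_λ ⊗ s` and of `V_λ` in `V_{λ'} ⊗ s` have components in one half
of `s` only, and the cofactors are multiples of the products of these components. -/
theorem exists_components {lam lam' : Weight m} (hd : Dominant lam) (hd' : Dominant lam')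
    {v : V} {f : V →ₗ[ℂ] ℂ} {v' : V'} {f' : V' →ₗ[ℂ] ℂ} (H : HighestWeight lam v f)
    (H' : HighestWeight lam' v' f') {r : Fin (m + 2)} {u : ℂ}
    (h : ∀ i : Fin (m + 2), lam' i.castSucc = lam i.castSucc + if i = r then 1 else 0)
    (hL : lam' (iL m) = lam (iL m) - 1) (hu : (lam r.castSucc : ℂ) + u + r.rev.val + 1 = 0)
    {ιp : V' →ₗ⁅ℂ, kAlg m⁆ V ⊗[ℂ] sMod m} (hp : ιp ≠ 0)
    {ιm : V →ₗ⁅ℂ, kAlg m⁆ V' ⊗[ℂ] sMod m} (hm : ιm ≠ 0) :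
    ∃ (A : Fin (m + 2) → V' →ₗ[ℂ] V) (B : Fin (m + 2) → V →ₗ[ℂ] V') (c : ℂ), c ≠ 0 ∧
      (∀ x, ιp x = ∑ i, A i x ⊗ₜ[ℂ] sCol i) ∧ (∀ x, ιm x = ∑ j, B j x ⊗ₜ[ℂ] sRow j) ∧
      (∀ i j, cofK V i j u = c • (A i ∘ₗ B j)) ∧ ∀ i j, cofK V' i j u = c • (B j ∘ₗ A i) := by
  -- The components along E_{n+1,j} would change the eigenvalue of E_{n+1,n+1} in the wrong
  -- direction.
  have hp1 : ∀ x, ιp x = ∑ i, tEntry V i.castSucc (iL m) (ιp x) ⊗ₜ[ℂ] sCol i := by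
    intro x
    have z : ∀ j : Fin (m + 2), tEntry V (iL m) j.castSucc (ιp x) = 0 := fun j =>
      LinearMap.congr_fun (H'.covec_eq_zero_of_last H (isCovec_tEntry ιp) hL j) x
    conv_lhs => rw [eq_sum_tEntry (ιp x)]
    simp only [z, TensorProduct.zero_tmul, Finset.sum_const_zero, add_zero]
  have hm1 : ∀ x, ιm x = ∑ j, tEntry V' (iL m) j.castSucc (ιm x) ⊗ₜ[ℂ] sRow j := by
    intro x
    have z : ∀ i : Fin (m + 2), tEntry V' i.castSucc (iL m) (ιm x) = 0 := fun j =>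
      LinearMap.congr_fun (H.vec_eq_zero_of_last H' (isVec_tEntry ιm) hL j) x
    conv_lhs => rw [eq_sum_tEntry (ιm x)]
    simp only [z, TensorProduct.zero_tmul, Finset.sum_const_zero, zero_add]
  obtain ⟨c, hc, e1, e2⟩ := H.exists_cofK_eq H' hd hd' h hL hu (isVec_tEntry ιp) (fun e => hp (by
    ext x
    rw [hp1]
    refine Finset.sum_eq_zero fun i _ => ?_
    have : tEntry V i.castSucc (iL m) (ιp x) = 0 := LinearMap.congr_fun (congrFun e i) x
    rw [this, TensorProduct.zero_tmul])) (isCovec_tEntry ιm) (fun e => hm (by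
    ext x
    rw [hm1]
    refine Finset.sum_eq_zero fun j _ => ?_
    have : tEntry V' (iL m) j.castSucc (ιm x) = 0 := LinearMap.congr_fun (congrFun e j) x
    rw [this, TensorProduct.zero_tmul]))
  exact ⟨_, _, c, hc, hp1, hm1, e1, e2⟩

variable [FiniteDimensional ℂ W] [LieRingModule (mEta m) W] [LieModule ℂ (mEta m) W]

theorem WhittakerSpace.subsingleton [Subsingleton V] : Subsingleton (WhittakerSpace m V W) :=
  ⟨fun φ ψ => Subtype.ext (LinearMap.ext fun v => by
    rw [Subsingleton.elim v 0, map_zero, map_zero])⟩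

theorem centralAction_eq_zero {z : UG m} (hz : z ∈ Subalgebra.center ℂ (UG m))
    (h : ∀ (φ : SmoothHom V W) (v : V), evAct φ v z = 0) : centralAction V W z hz = 0 :=
  LinearMap.ext fun φ => Subtype.ext (LinearMap.ext fun v => h φ.1 v)

theorem shiftOp_comp_eq {ι : V' →ₗ⁅ℂ, kAlg m⁆ V ⊗[ℂ] sMod m}
    {ι' : V →ₗ⁅ℂ, kAlg m⁆ V' ⊗[ℂ] sMod m} {z : UG m} (hz : z ∈ Subalgebra.center ℂ (UG m))
    (h : ∀ (φ : SmoothHom V W) (v : V),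
      nabla (nabla φ ∘ₗ (ι : V' →ₗ[ℂ] V ⊗[ℂ] sMod m)) (ι' v) = evAct φ v z) :
    shiftOp W ι' ∘ₗ shiftOp W ι = centralAction V W z hz :=
  LinearMap.ext fun φ => Subtype.ext (LinearMap.ext fun v => h φ.1 v)

theorem centralAction_congr {z z' : UG m} (hz : z ∈ Subalgebra.center ℂ (UG m))
    (hz' : z' ∈ Subalgebra.center ℂ (UG m)) (h : z = z') :
    centralAction V W z hz = centralAction V W z' hz' := by
  subst h; rfl

universe w in
/-- The statement for one `K`-type: the compositions of the shift operators, with `u` the spectral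
parameter at which the quantum minor vanishes. -/
theorem exists_normalization {lam lam' : Weight m} {r : Fin (m + 2)} {u : ℂ}
    (h : ∀ i : Fin (m + 2), lam' i.castSucc = lam i.castSucc + if i = r then 1 else 0)
    (hL : lam' (iL m) = lam (iL m) - 1) (hu : (lam r.castSucc : ℂ) + u + r.rev.val + 1 = 0)
    (hV : IsKType lam V) (hV' : IsKType lam' V')
    (ιp : V' →ₗ⁅ℂ, kAlg m⁆ V ⊗[ℂ] sMod m) (ιm : V →ₗ⁅ℂ, kAlg m⁆ V' ⊗[ℂ] sMod m)
    (hι : Dominant lam → Dominant lam' → ιp ≠ 0 ∧ ιm ≠ 0) :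
    ∃ c : ℂ, c ≠ 0 ∧ ∀ (W : Type w) [NormedAddCommGroup W] [NormedSpace ℂ W]
      [FiniteDimensional ℂ W] [LieRingModule (mEta m) W] [LieModule ℂ (mEta m) W],
      shiftOp W (c • ιm) ∘ₗ shiftOp W ιp =
        centralAction V W (capelli m u) (capelli_mem_center u) ∧
      shiftOp W ιp ∘ₗ shiftOp W (c • ιm) =
        centralAction V' W (capelli m u) (capelli_mem_center u) := by
  have hu' : (lam' r.castSucc : ℂ) + u + r.rev.val = 0 := by
    rw [h, if_pos rfl]
    push_cast
    linear_combination hu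
  by_cases hd : Dominant lam
  · obtain ⟨v, f, H⟩ := hV.exists_highestWeight hd
    have hmin : minorK V m (u + 1) = 0 := H.minorK_eq_zero r (by linear_combination hu)
    by_cases hd' : Dominant lam'
    · obtain ⟨v', f', H'⟩ := hV'.exists_highestWeight hd'
      have hmin' : minorK V' m u = 0 := H'.minorK_eq_zero r hu'
      obtain ⟨A, B, c, hc, hA, hB, e1, e2⟩ := exists_components hd hd' H H' h hL hu
        (hι hd hd').1 (hι hd hd').2
      have hB' : ∀ x, (-c • ιm) x = ∑ j, (-c • B j) x ⊗ₜ[ℂ] sRow j := by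
        intro x
        rw [LieModuleHom.smul_apply, hB, Finset.smul_sum]
        rfl
      -- The sign compensates the minus sign in front of the cofactor sum in the expansion.
      refine ⟨-c, neg_ne_zero.2 hc, fun W _ _ _ _ _ => ⟨?_, ?_⟩⟩
      · refine shiftOp_comp_eq _ fun φ v => ?_
        rw [nabla_row_nabla_col φ hA hB', evAct_capelli_left hmin, ← Finset.sum_neg_distrib]
        refine Finset.sum_congr rfl fun i _ => ?_
        rw [← Finset.sum_neg_distrib]
        refine Finset.sum_congr rfl fun j _ => ?_
        rw [e1]
        simp
      · refine shiftOp_comp_eq _ fun φ v => ?_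
        rw [nabla_col_nabla_row φ hA hB', evAct_capelli_right hmin', ← Finset.sum_neg_distrib]
        refine Finset.sum_congr rfl fun i _ => ?_
        rw [← Finset.sum_neg_distrib]
        refine Finset.sum_congr rfl fun j _ => ?_
        rw [e2]
        simp
    · have hsub : Subsingleton V' := hV'.2 hd'
      -- The composition passes through V' = 0, so the Capelli element has to act by zero on V.
      -- Comparing with the zero tensor, it suffices that `cofVal` vanishes.
      have hcof : ∀ i j, cofK V i j u = 0 := fun i j => by
        rw [H.eq_of_left hd isTensor_zero hu (fun b => by simp) (c := 0) ?_ i j, smul_zero]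
        rw [zero_mul]
        exact cofVal_eq_zero (fun e => hd' e.2) (Or.inl hd) h hu
      refine ⟨1, one_ne_zero, fun W _ _ _ _ _ => ⟨?_, ?_⟩⟩
      · have := WhittakerSpace.subsingleton (m := m) (V := V') (W := W)
        rw [centralAction_eq_zero _ fun φ v => by
          rw [evAct_capelli_left hmin]
          simp [hcof]]
        rw [Subsingleton.elim (shiftOp W ιp) 0, LinearMap.comp_zero]
      · have := WhittakerSpace.subsingleton (m := m) (V := V') (W := W)
        exact Subsingleton.elim _ _
  · have hsub : Subsingleton V := hV.2 hd
    refine ⟨1, one_ne_zero, fun W _ _ _ _ _ => ⟨?_, ?_⟩⟩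
    · have := WhittakerSpace.subsingleton (m := m) (V := V) (W := W)
      exact Subsingleton.elim _ _
    · have := WhittakerSpace.subsingleton (m := m) (V := V) (W := W)
      rw [Subsingleton.elim (shiftOp W ((1 : ℂ) • ιm)) 0, LinearMap.comp_zero]
      by_cases hd' : Dominant lam'
      · obtain ⟨v', f', H'⟩ := hV'.exists_highestWeight hd'
        have hmin' : minorK V' m u = 0 := H'.minorK_eq_zero r hu'
        -- The mirror case V = 0: the cofactors are compared with the zero tensor on V', through the
        -- relation on the right.
        have hcof : ∀ i j, cofK V' i j u = 0 := fun i j => by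
          rw [H'.eq_of_right hd' isTensor_zero hu' (fun b => by simp) (c := 0) ?_ i j, smul_zero]
          rw [zero_mul, cofVal_congr (lam := lam) fun i hi => by rw [h, if_neg hi, add_zero]]
          exact cofVal_eq_zero (fun e => hd e.1) (Or.inr hd') h hu
        rw [centralAction_eq_zero _ fun φ v => by
          rw [evAct_capelli_right hmin']
          simp [hcof]]
      · have hsub : Subsingleton V' := hV'.2 hd'
        have := WhittakerSpace.subsingleton (m := m) (V := V') (W := W)
        exact Subsingleton.elim _ _

end main
end
end ShiftOps

open ShiftOps in
theorem lemma5p6 (m : ℕ) :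
    -- the Capelli-type elements are central
    ∃ hC : ∀ u : ℂ, capelli m u ∈ Subalgebra.center ℂ (UniversalEnvelopingAlgebra ℂ (Gl m)),
    -- `V` and `V'` are the `K`-types `λ` and `λ + ε_{n+1-k} - ε_{n+1}` (zero if not dominant)
    ∀ (k : Fin (m + 2)) (lam : Weight m)
      (V : Type*) [AddCommGroup V] [Module ℂ V] [FiniteDimensional ℂ V]
      [LieRingModule (kAlg m) V] [LieModule ℂ (kAlg m) V]
      (V' : Type*) [AddCommGroup V'] [Module ℂ V'] [FiniteDimensional ℂ V']
      [LieRingModule (kAlg m) V'] [LieModule ℂ (kAlg m) V']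
      (_ : IsKType lam V) (_ : IsKType (lam + shiftWeight k) V')
      -- the maps that define `P_k^+` on `λ` and `P_k^-` on `λ + ε_{n+1-k} - ε_{n+1}`
      (ιp : V' →ₗ⁅ℂ, kAlg m⁆ V ⊗[ℂ] sMod m) (ιm : V →ₗ⁅ℂ, kAlg m⁆ V' ⊗[ℂ] sMod m)
      (_ : Dominant lam → Dominant (lam + shiftWeight k) → ιp ≠ 0 ∧ ιm ≠ 0),
    -- the normalization
    ∃ c : ℂ, c ≠ 0 ∧ ∀ (gam : Fin (m + 1) → ℤ)
      (W : Type*) [NormedAddCommGroup W] [NormedSpace ℂ W] [FiniteDimensional ℂ W]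
      [LieRingModule (mEta m) W] [LieModule ℂ (mEta m) W] (_ : IsMEtaType gam W),
      -- on the `K`-type `λ`: `P_k^- ∘ P_k^+ = D(C_{n+1}(l_{k,n}))`
      shiftOp W (c • ιm) ∘ₗ shiftOp W ιp =
        centralAction V W (capelli m (lParam lam k)) (hC _) ∧
      -- on the `K`-type `λ' = λ + ε_{n+1-k} - ε_{n+1}`: `P_k^+ ∘ P_k^- = D(C_{n+1}(l_{k,n} + 1))`
      shiftOp W ιp ∘ₗ shiftOp W (c • ιm) =
        centralAction V' W (capelli m (lParam (lam + shiftWeight k) k + 1)) (hC _) := by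
  refine ⟨capelli_mem_center, ?_⟩
  intro k lam V _ _ _ _ _ V' _ _ _ _ _ hV hV' ιp ιm hι
  obtain ⟨c, hc, h⟩ := exists_normalization (add_shiftWeight_castSucc lam k)
    (add_shiftWeight_last lam k) (add_lParam lam k) hV hV' ιp ιm hι
  refine ⟨c, hc, fun gam W _ _ _ _ _ _ => ⟨(h W).1, (h W).2.trans ?_⟩⟩
  -- Passing from λ to λ' lowers l_{k,n} by one, so both identities use the same Capelli element.
  exact centralAction_congr _ _ (congrArg (capelli m) (lParam_shift lam k).symm)
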